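/- **Setting.** Let $G=(V,E)$ be a finite tree in which every vertex has degree $1$ or $3$, let $T$ be the set of its leaves (the terminals), let $c:E\to\{1,2,3,\dots\}$ be a capacity function, and root $G$ at a terminal $r\in T$. An edge $e$ whose upper end is $u$ and whose lower end is $v$ is written $e=(u,v)$; its depth is the distance from $r$ to $v$; it is a leaf-edge if $v$ is a leaf; the edges $(v,w)$ are its child-edges. Let $V_e$ consist of $u$, $v$ and all descendants of $v$, let $G_e=(V_e,E_e)$ be the induced subtree, and $T_e=(T\cap V_e)\setminus\{u\}$. The instance $I(e)$ is $G_e$ with capacities $c$ and terminal set $T_e\cup\{u\}$. $P_{s,t}$ is the path between $s$ and $t$. Inside $I(e)$, for $X\subseteq V_e$ let $E(X)$ be the set of edges of $E_e$ with exactly one end in $X$ and $h(X)=\sum_{e'\in E(X)}h(e')$. A *flow* of $I(e)$ is a function $f:E_e\to\mathbb Z_{\ge0}$ having a *decomposition*: a function $g$ from unordered pairs of distinct terminals of $I(e)$ to $\mathbb Z_{\ge 0}$ with $f(e')=\sum\{g(s,t): e'\in P_{s,t}\}$ for all $e'\in E_e$. It is feasible if $f\le c$ on $E_e$. For a feasible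 flow $f$ and $s\in V_e$, $V_f(s)$ is the set of $w\in V_e$ such that, with $z$ the lowest common ancestor of $s$ and $w$, $c-f\ge1$ on $P_{s,z}$ and $c-f\ge2$ on $P_{z,w}$. A *cut-system* of $T_e$ in $I(e)$ is a family of pairwise disjoint sets $X_t\subseteq V_e$ $(t\in T_e)$, each inducing a connected subgraph, with $X_t\cap(T_e\cup\{u\})=\{t\}$; $\mathrm{odd}(X_t)$ is the set of components $W$ of $G_e-\bigcup_{t'} X_{t'}$ with $c(W)$ odd for which the edge from $W$ to the parent of its top vertex has its upper end in $X_t$. The flow $f$ is *blocking* if $\{V_f(t)\}_{t\in T_e}$ is a cut-system of $T_e$ and $f(e_t)=f(V_f(t))=c(V_f(t))-|\mathrm{odd}(V_f(t))|$ for all $t\in T_e$, where $e_t$ is the edge at $t$. Let $\Psi(e)=\{f(e): f \text{ a blocking flow of } I(e)\}$, and let $a(e)=\min\Psi(e)$, $b(e)=\max\Psi(e)$. For $b=a+2k$ with integers $a,k\ge0$ put $\langle a,b\rangle=\{a,a+2,\dots,b\}$, and put $A\otimes B=\{\alpha+\beta-2i:\alpha\in A,\ \beta\in B,\ 0\le i\le\min\{\alpha,\beta\}\}$.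 For a non-leaf-edge $e$ with child-edges $e_1,e_2$ put $\tilde b(e)=b(e_1)+b(e_2)$ and $$\tilde a(e)=\begin{cases}a(e_i)-b(e_j)&\text{if } b(e_j)+2\le a(e_i),\ \{i,j\}=\{1,2\},\\ 0&\text{if neither holds and } a(e_1)+a(e_2)\text{ is even},\\ 1&\text{if neither holds and } a(e_1)+a(e_2)\text{ is odd}.\end{cases}$$ The edge $e_i$ is *dominating* if $b(e_j)+2\le a(e_i)$. A *dominating path* is a path all of whose edges are dominating. An edge $e=(u,v)$ satisfies * **(a)** if $\Psi(e)=\langle a(e),b(e)\rangle$ and: when $e$ is a leaf-edge, $a(e)=b(e)=c(e)$; when $e$ is a non-leaf-edge with child-edges $e_1,e_2$, $\Psi(e_1)\otimes\Psi(e_2)=\langle\tilde a(e),\tilde b(e)\rangle$, moreover $\Psi(e)=(\Psi(e_1)\otimes\Psi(e_2))\cap[0,c(e)]$ if $\tilde a(e)\le c(e)$ and $\Psi(e)=\{c(e)\}$ if $c(e)<\tilde a(e)$, that is, $$\langle a(e),b(e)\rangle=\begin{cases}\langle\tilde a(e),\tilde b(e)\rangle&\text{if }\tilde b(e)\le c(e),\\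 \langle\tilde a(e),c(e)\rangle&\text{if }\tilde a(e)\le c(e)<\tilde b(e)\text{ and }\tilde a(e)+c(e)\text{ is even},\\ \langle\tilde a(e),c(e)-1\rangle&\text{if }\tilde a(e)\le c(e)<\tilde b(e)\text{ and }\tilde a(e)+c(e)\text{ is odd},\\ \langle c(e),c(e)\rangle&\text{if }c(e)<\tilde a(e);\end{cases}$$ * **(b)** if, whenever $e$ has a dominating child-edge $e'=(v,w)$, there is a terminal $t\in T_{e'}$ such that $P_{v,t}$ is a dominating path and $g(u,t)\ge a(e)$ for every decomposition $g$ of every blocking flow of $I(e)$. **Lemma.** Let $e=(u,v)$ be a non-leaf-edge such that all edges of depth greater than that of $e$ satisfy (a) and (b). Let $w_1,w_2$ be the two children of $v$, in any order, $\tilde a=\tilde a(e)$, $\tilde b=\tilde b(e)$. Then $\Psi(vw_1)\otimes\Psi(vw_2)=\langle\tilde a,\tilde b\rangle$, and: 1. If $f$ is a blocking flow of $I(e)$ and $e\in E(V_f(t))$ for some $t\in T_e$, then $P_{v,t}$ is a dominating path, $g(u,t)\ge c(e)$ for every decomposition $g$ of every blocking flow of $I(e)$, and $c(e)<\tilde a$.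 2. If $c(e)<\tilde a$, then $vw_1$ or $vw_2$ is dominating. Edge $e$ satisfies (b); if $vw_1$ is dominating, there is $t^*\in T_{vw_1}$ such that $P_{v,t^*}$ is a dominating path and $g(u,t^*)\ge\min\{\tilde a,c(e)\}$ for every decomposition $g$ of every blocking flow of $I(e)$. 3. Let $x_i\in\Psi(vw_i)$ $(i=1,2)$ and $x=x_1+x_2-2y$ with an integer $0\le y\le\min\{x_1,x_2\}$. Then $x\ge\tilde a$. If moreover $\tilde a\le c(e)$ and $x\le c(e)$, then for all blocking flows $f_i$ of $I(vw_i)$ with $f_i(vw_i)=x_i$ the function $(x,f_1,f_2)$ on $E_e$ (value $x$ at $e$, and $f_i$ on the edges of $I(vw_i)$) is a blocking flow of $I(e)$. 4. If $f$ is a blocking flow of $I(e)$ with $f(e)<c(e)$, then $f(e)\in\langle\tilde a,\tilde b\rangle$. 5. Assume $c(e)<\tilde a$ and $vw_1$ is dominating, and let $t^*\in T_{vw_1}$ be such that $P_{v,t^*}$ is a dominating path. Put $\delta=\tilde a-c(e)$. There are blocking flows $f_1$ of $I(vw_1)$ with $f_1(vw_1)=a(vw_1)$ and $f_2$ of $I(vw_2)$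 with $f_2(vw_2)=b(vw_2)$; and for all such $f_1,f_2$ one has $f_1\ge\delta$ on $P_{v,t^*}$, and the function $(c(e),f_1',f_2)$ is a blocking flow of $I(e)$ with value $c(e)$ at $e$, where $f_1'$ is $f_1$ decreased by $\delta$ on all edges of $P_{v,t^*}$. 6. Edge $e$ satisfies (a). -/

import Mathlib

/-- A rooted tree instance: a finite tree whose leaves are the terminals and whose other vertices
have degree 3, with positive integer edge capacities, rooted at a terminal `r`.
Only the values of `c` at edges of `G` matter. -/
structure TreeInstance (V : Type*) where
  G : SimpleGraph V
  isTree : G.IsTree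
  r : V
  c : Sym2 V → ℕ
  degree_root : (G.neighborSet r).ncard = 1
  degree_eq : ∀ x, (G.neighborSet x).ncard = 1 ∨ (G.neighborSet x).ncard = 3
  one_le_c : ∀ e ∈ G.edgeSet, 1 ≤ c e

/-- The set `⟨a, b⟩ = {a, a + 2, …, b}`; it is used for `b = a + 2 * k`. -/
def parityInterval (a b : ℕ) : Set ℕ := {x | ∃ i : ℕ, x = a + 2 * i ∧ x ≤ b}

/-- `A ⊗ B`, the set of all `a + b - 2 * i` with `a ∈ A`, `b ∈ B`, `0 ≤ i ≤ min a b`. -/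
def otimes (A B : Set ℕ) : Set ℕ :=
  {x | ∃ a ∈ A, ∃ b ∈ B, ∃ i ≤ min a b, x + 2 * i = a + b}

/-- The lower end of `⟨a₁, b₁⟩ ⊗ ⟨a₂, b₂⟩`. -/
def tildeLower (a₁ b₁ a₂ b₂ : ℕ) : ℕ :=
  if b₂ + 2 ≤ a₁ then a₁ - b₂
  else if b₁ + 2 ≤ a₂ then a₂ - b₁
  else if Even (a₁ + a₂) then 0 else 1

/-- The lower end of the updated interval, from `⟨aT, bT⟩ = ⟨a₁, b₁⟩ ⊗ ⟨a₂, b₂⟩` and the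
capacity. -/
def updateLower (aT cap : ℕ) : ℕ := if cap < aT then cap else aT

/-- The upper end of the updated interval; it is used for `bT = aT + 2 * k`. -/
def updateUpper (aT bT cap : ℕ) : ℕ :=
  if cap < aT then cap
  else if bT ≤ cap then bT
  else if Even (aT + cap) then cap else cap - 1

namespace TreeInstance

variable {V : Type*}

/-- The terminals: the leaves of the tree. -/
def T (I : TreeInstance V) : Set V := {x | (I.G.neighborSet x).ncard = 1}

/-- The edge set of the path `P_{x,y}`. -/
def pathEdges (I : TreeInstance V) (x y : V) : Set (Sym2 V) :=
  {e | ∃ p : I.G.Walk x y, p.IsPath ∧ e ∈ p.edges}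

/-- `x` lies on the path from the root to `y`. Every vertex is an ancestor of itself. -/
def IsAncestor (I : TreeInstance V) (x y : V) : Prop :=
  ∃ p : I.G.Walk I.r y, p.IsPath ∧ x ∈ p.support

/-- `x` is the parent of `y`, i.e. `(x, y)` is an edge of the rooted tree. -/
def IsParent (I : TreeInstance V) (x y : V) : Prop := I.G.Adj x y ∧ I.IsAncestor x y

/-- `z` is the lowest common ancestor of `x` and `y`. -/
def IsLCA (I : TreeInstance V) (z x y : V) : Prop :=
  I.IsAncestor z x ∧ I.IsAncestor z y ∧
    ∀ z', I.IsAncestor z' x → I.IsAncestor z' y → I.IsAncestor z' z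

/-- The depth of the edge whose lower end is `y`. -/
noncomputable def depth (I : TreeInstance V) (y : V) : ℕ := I.G.dist I.r y

/-! The instance `I(e)` of an edge `e = (u, v)`, where `u` is the parent of `v`. -/

/-- `V_e`: the vertex `u`, the vertex `v` and all descendants of `v`. -/
def subV (I : TreeInstance V) (u v : V) : Set V := insert u {x | I.IsAncestor v x}

/-- `E_e`: the edges of the subgraph induced by `V_e`. -/
def subE (I : TreeInstance V) (u v : V) : Set (Sym2 V) :=
  {e | e ∈ I.G.edgeSet ∧ ∀ x ∈ e, x ∈ I.subV u v}

/-- `T_e`: the terminals in `V_e` other than `u`. -/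
def subT (I : TreeInstance V) (u v : V) : Set V := (I.T ∩ I.subV u v) \ {u}

/-- The terminals `T_e ∪ {u}` of the instance `I(e)`. -/
def terminals (I : TreeInstance V) (u v : V) : Set V := insert u (I.subT u v)

/-- `E(X)` in the graph `G_e`: the edges of `G_e` with exactly one end in `X`. -/
def cut (I : TreeInstance V) (u v : V) (X : Set V) : Set (Sym2 V) :=
  {e | e ∈ I.subE u v ∧ ∃ x y, e = s(x, y) ∧ x ∈ X ∧ y ∉ X}

/-- `h(X)`: the sum of `h` over `E(X)` in `G_e`. -/
noncomputable def cutValue [Finite V] (I : TreeInstance V) (u v : V) (h : Sym2 V → ℕ)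
    (X : Set V) : ℕ :=
  ∑ e ∈ (Set.toFinite (I.cut u v X)).toFinset, h e

/-- The unordered pairs of distinct terminals of `I(e)` whose path contains the edge `d`. -/
def pairsThrough (I : TreeInstance V) (u v : V) (d : Sym2 V) : Set (Sym2 V) :=
  {q | ∃ x ∈ I.terminals u v, ∃ y ∈ I.terminals u v,
    x ≠ y ∧ q = s(x, y) ∧ d ∈ I.pathEdges x y}

/-- `g` is an integer decomposition of `f` in `I(e)`; `g s(x, y)` is the amount sent along the
path `P_{x,y}`. -/
def IsDecomposition [Finite V] (I : TreeInstance V) (u v : V) (f g : Sym2 V → ℕ) : Prop :=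
  ∀ d ∈ I.subE u v, f d = ∑ q ∈ (Set.toFinite (I.pairsThrough u v d)).toFinset, g q

/-- `f` is a feasible (integral) flow of `I(e)`. Only its values on `E_e` matter. -/
def IsFeasibleFlow [Finite V] (I : TreeInstance V) (u v : V) (f : Sym2 V → ℕ) : Prop :=
  (∃ g, I.IsDecomposition u v f g) ∧ ∀ d ∈ I.subE u v, f d ≤ I.c d

/-- `V_f(x)`: the vertices of `V_e` that are reachable from `x` by going up along edges of
residual capacity at least 1 and then down along edges of residual capacity at least 2. -/
def reach (I : TreeInstance V) (u v : V) (f : Sym2 V → ℕ) (x : V) : Set V :=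
  {w | w ∈ I.subV u v ∧ ∃ z, I.IsLCA z x w ∧
    (∀ d ∈ I.pathEdges x z, f d + 1 ≤ I.c d) ∧ (∀ d ∈ I.pathEdges z w, f d + 2 ≤ I.c d)}

/-- `X` is a `t`-set of `I(e)`. -/
def IsTerminalSet (I : TreeInstance V) (u v t : V) (X : Set V) : Prop :=
  X ⊆ I.subV u v ∧ X ∩ I.terminals u v = {t} ∧ (I.G.induce X).Connected

/-- The sets `X t`, `t ∈ T_e`, form a cut-system of `T_e` in `I(e)`. -/
def IsCutSystem (I : TreeInstance V) (u v : V) (X : V → Set V) : Prop :=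
  (∀ t ∈ I.subT u v, I.IsTerminalSet u v t (X t)) ∧ (I.subT u v).PairwiseDisjoint X

/-- `W` is a connected component of `G_e` minus the union of the cut-system `X`. -/
def IsComponent (I : TreeInstance V) (u v : V) (X : V → Set V) (W : Set V) : Prop :=
  ∃ C : (I.G.induce (I.subV u v \ ⋃ t ∈ I.subT u v, X t)).ConnectedComponent,
    W = Subtype.val '' C.supp

/-- `odd(X t)`: the components `W` with `c(W)` odd whose parent-edge `(x, y)` is a child-edge
of `X t`. -/
def oddSets [Finite V] (I : TreeInstance V) (u v : V) (X : V → Set V) (t : V) : Set (Set V) :=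
  {W | I.IsComponent u v X W ∧ Odd (I.cutValue u v I.c W) ∧
    ∃ x y, I.IsParent x y ∧ (x ∉ W ∧ y ∈ W) ∧ (x ∈ X t ∧ y ∉ X t)}

/-- `X t` is blocked by `f`: `f(e_t) = f(X t) = c(X t) - |odd(X t)|`, where `e_t` is the edge
incident to `t`. -/
def IsBlocked [Finite V] (I : TreeInstance V) (u v : V) (f : Sym2 V → ℕ) (X : V → Set V)
    (t : V) : Prop :=
  (∀ d ∈ I.G.incidenceSet t, f d = I.cutValue u v f (X t)) ∧
    (I.cutValue u v f (X t) : ℤ) = (I.cutValue u v I.c (X t) : ℤ) - ((I.oddSets u v X t).ncard : ℤ)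

/-- `f` is a blocking flow of `I(e)`: a feasible flow for which the sets `V_f(t)`, `t ∈ T_e`,
form a cut-system of `T_e` blocked by `f`. -/
def IsBlocking [Finite V] (I : TreeInstance V) (u v : V) (f : Sym2 V → ℕ) : Prop :=
  I.IsFeasibleFlow u v f ∧ I.IsCutSystem u v (I.reach u v f) ∧
    ∀ t ∈ I.subT u v, I.IsBlocked u v f (I.reach u v f) t

/-- `Ψ(e)`: the set of values `f(e)` of blocking flows `f` of `I(e)`. -/
def Psi [Finite V] (I : TreeInstance V) (u v : V) : Set ℕ :=
  {x | ∃ f, I.IsBlocking u v f ∧ f s(u, v) = x}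

/-- `a(e)`, the least element of `Ψ(e)`. -/
noncomputable def lo [Finite V] (I : TreeInstance V) (u v : V) : ℕ := sInf (I.Psi u v)

/-- `b(e)`, the largest element of `Ψ(e)`. -/
noncomputable def hi [Finite V] (I : TreeInstance V) (u v : V) : ℕ := sSup (I.Psi u v)

/-- `ã(e)` for an edge `e` with lower end `v` and child-edges `(v, w₁)`, `(v, w₂)`. -/
noncomputable def tildeA [Finite V] (I : TreeInstance V) (v w₁ w₂ : V) : ℕ :=
  tildeLower (I.lo v w₁) (I.hi v w₁) (I.lo v w₂) (I.hi v w₂)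

/-- `b̃(e) = b(e₁) + b(e₂)`. -/
noncomputable def tildeB [Finite V] (I : TreeInstance V) (v w₁ w₂ : V) : ℕ :=
  I.hi v w₁ + I.hi v w₂

/-- The edge `(v, w)` is dominating: with its sibling edge `(v, w')` one has
`b(v, w') + 2 ≤ a(v, w)`. -/
def IsDominating [Finite V] (I : TreeInstance V) (v w : V) : Prop :=
  I.IsParent v w ∧ ∃ w', I.IsParent v w' ∧ w' ≠ w ∧ I.hi v w' + 2 ≤ I.lo v w

/-- All edges of the path `P_{x,y}` are dominating. -/
def IsDominatingPath [Finite V] (I : TreeInstance V) (x y : V) : Prop :=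
  ∀ d ∈ I.pathEdges x y, ∃ p q, d = s(p, q) ∧ I.IsDominating p q

/-- Condition (a) for the edge `e = (u, v)`. -/
def CondA [Finite V] (I : TreeInstance V) (u v : V) : Prop :=
  (∃ k : ℕ, I.hi u v = I.lo u v + 2 * k) ∧
  I.Psi u v = parityInterval (I.lo u v) (I.hi u v) ∧
  (v ∈ I.T → I.lo u v = I.c s(u, v) ∧ I.hi u v = I.c s(u, v)) ∧
  (v ∉ I.T → ∀ w₁ w₂, I.IsParent v w₁ → I.IsParent v w₂ → w₁ ≠ w₂ →
    (∃ k : ℕ, I.tildeB v w₁ w₂ = I.tildeA v w₁ w₂ + 2 * k) ∧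
    otimes (I.Psi v w₁) (I.Psi v w₂) =
      parityInterval (I.tildeA v w₁ w₂) (I.tildeB v w₁ w₂) ∧
    (I.tildeA v w₁ w₂ ≤ I.c s(u, v) →
      I.Psi u v = otimes (I.Psi v w₁) (I.Psi v w₂) ∩ Set.Icc 0 (I.c s(u, v))) ∧
    (I.c s(u, v) < I.tildeA v w₁ w₂ → I.Psi u v = {I.c s(u, v)}) ∧
    I.lo u v = updateLower (I.tildeA v w₁ w₂) (I.c s(u, v)) ∧
    I.hi u v = updateUpper (I.tildeA v w₁ w₂) (I.tildeB v w₁ w₂) (I.c s(u, v)))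

/-- Condition (b) for the edge `e = (u, v)`. -/
def CondB [Finite V] (I : TreeInstance V) (u v : V) : Prop :=
  ∀ w, I.IsDominating v w → ∃ t ∈ I.subT v w,
    (∀ f g, I.IsBlocking u v f → I.IsDecomposition u v f g → I.lo u v ≤ g s(u, t)) ∧
    I.IsDominatingPath v t

open scoped Classical in
/-- The function `(x, f₁, f₂)` on `E_e`: the value `x` at `e = (u, v)`, the function `f₁` on the
edges of `I(v w₁)` and the function `f₂` on the edges of `I(v w₂)`. -/
noncomputable def combine (I : TreeInstance V) (u v w₁ : V) (x : ℕ) (f₁ f₂ : Sym2 V → ℕ) :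
    Sym2 V → ℕ :=
  fun d => if d = s(u, v) then x else if d ∈ I.subE v w₁ then f₁ d else f₂ d

open scoped Classical in
/-- The function `h + (P_{x,y}, -δ)`; it is used when `δ ≤ h d` for all edges `d` of the path. -/
noncomputable def decreasePath (I : TreeInstance V) (h : Sym2 V → ℕ) (x y : V) (δ : ℕ) :
    Sym2 V → ℕ :=
  fun d => if d ∈ I.pathEdges x y then h d - δ else h d

end TreeInstance

/-! ### Ancestor order of the rooted tree, and edges named by their lower ends. -/

namespace TreeInstance

variable {V : Type*} (I : TreeInstance V)

/-! Each edge is named by its lower end, so a flow becomes a function `F` on vertices and all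
conditions can be followed down the tree. A flow has a decomposition exactly when, at every inner
vertex, the three incident values have even sum and satisfy the triangle inequalities
(`IsParent.isFeasibleFlow_iff`). The equality involving odd components is automatic: edges leaving a
reached set upwards are full, edges leaving it downwards have residual 0 or 1, and by a handshake
argument residual 1 occurs exactly above odd components (`Blocking.cutValue_reach_eq`). What remains
is the structure `Blocking` (`IsParent.isBlocking_iff`).

Let `v` have children `w₁`, `w₂`. If no terminal reaches `v`, the flow restricts to blocking flows
on both sides, so its value lies in the product `⊗`; conversely any two blocking flows glue
(`FlowOn.blocking_of_blocking`). If a terminal `t` below `w₁` reaches `v`, comparing the flow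
leaving `t` with the boundary of its set forces `F w₁ = F v + F w₂` and makes the flow below `w₂`
down-blocking (`PreBlocking.passes`). Given (a) below, a blocking flow is down-blocking exactly when
its top value is the maximum `b` (`DownBlocking.eq_hi`, `Blocking.downBlocking_of_eq_hi`).

Hence, if `t` reaches `v` and `F v ≥ 1`, induction gives `F v + b(w₂) = F w₁ < a(w₁)`: the edge to
`w₁` is dominating and `F v < ã` (`PreBlocking.dominating_of_reach`). In a blocking flow the top
edge is then full, so `c < ã`. Thus for `ã ≤ c` only gluing occurs and `Ψ` is the product cut off at
`c`. For `c < ã` gluing would give a value of at least `ã`, so only the value `c` is possible; it is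
attained by lowering a minimal flow along the dominating path by `ã - c`
(`Blocking.decrease_of_eq_lo`).

For decompositions, the end `t` of the dominating path can send to the other leaves at most the flow
on the edges hanging off that path, while `F t` exceeds this sum by at least `min ã c`
(`Blocking.min_add_sideSum_le`, `IsDecomposition.le_add_sideSum`). The surplus must go to `u`. -/

theorem isAncestor_iff_mem_support {x y : V} {p : I.G.Walk I.r y} (hp : p.IsPath) :
    I.IsAncestor x y ↔ x ∈ p.support := by
  constructor
  · rintro ⟨q, hq, hx⟩
    have := (I.isTree.existsUnique_path I.r y).unique hp hq
    rwa [this]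
  · exact fun h => ⟨p, hp, h⟩

theorem exists_path (x y : V) : ∃ p : I.G.Walk x y, p.IsPath :=
  (I.isTree.existsUnique_path x y).exists

theorem isAncestor_refl (x : V) : I.IsAncestor x x := by
  obtain ⟨p, hp⟩ := I.exists_path I.r x
  exact ⟨p, hp, p.end_mem_support⟩

theorem root_isAncestor (x : V) : I.IsAncestor I.r x := by
  obtain ⟨p, hp⟩ := I.exists_path I.r x
  exact ⟨p, hp, p.start_mem_support⟩

theorem isAncestor_root {x : V} : I.IsAncestor x I.r ↔ x = I.r := by
  rw [I.isAncestor_iff_mem_support (p := SimpleGraph.Walk.nil) SimpleGraph.Walk.IsPath.nil]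
  simp

variable {I}

theorem IsParent.exists_concat {p q : V} (h : I.IsParent p q) :
    ∃ a : I.G.Walk I.r p, a.IsPath ∧ (a.concat h.1).IsPath := by
  classical
  obtain ⟨hadj, b, hb, hp⟩ := h
  refine ⟨b.takeUntil p hp, hb.takeUntil hp, ?_⟩
  refine (hb.takeUntil hp).concat ?_ hadj
  exact SimpleGraph.Walk.endpoint_notMem_support_takeUntil hb hp hadj.ne'

theorem IsParent.isAncestor_iff {p q x : V} (h : I.IsParent p q) :
    I.IsAncestor x q ↔ x = q ∨ I.IsAncestor x p := by
  obtain ⟨a, ha, hb⟩ := h.exists_concat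
  rw [I.isAncestor_iff_mem_support ha, I.isAncestor_iff_mem_support hb,
    SimpleGraph.Walk.support_concat]
  simp [or_comm]

theorem IsParent.depth_eq {p q : V} (h : I.IsParent p q) : I.depth q = I.depth p + 1 := by
  obtain ⟨a, ha, hb⟩ := h.exists_concat
  have key : ∀ {y : V} {w : I.G.Walk I.r y}, w.IsPath → I.depth y = w.length := by
    intro y w hw
    obtain ⟨w', hw'⟩ := I.isTree.connected.exists_walk_length_eq_dist I.r y
    rw [(I.isTree.existsUnique_path I.r y).unique hw (w'.isPath_of_length_eq_dist hw'), hw', depth]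
  rw [key ha, key hb, SimpleGraph.Walk.length_concat]

variable (I)

theorem exists_isParent {q : V} (hq : q ≠ I.r) : ∃ p, I.IsParent p q := by
  obtain ⟨a, ha⟩ := I.exists_path I.r q
  have hn : ¬ a.Nil := SimpleGraph.Walk.not_nil_of_ne hq.symm
  exact ⟨a.penultimate, a.adj_penultimate hn, a, ha, a.getVert_mem_support _⟩

theorem isParent_or_isParent {x y : V} (h : I.G.Adj x y) : I.IsParent x y ∨ I.IsParent y x := by
  obtain ⟨a, ha⟩ := I.exists_path I.r x
  by_cases hy : y ∈ a.support
  · exact Or.inr ⟨h.symm, a, ha, hy⟩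
  · exact Or.inl ⟨h, a.concat h, ha.concat hy h, by simp⟩

theorem root_induction {P : V → Prop} (h0 : P I.r) (h1 : ∀ p q, I.IsParent p q → P p → P q)
    (x : V) : P x := by
  induction hn : I.depth x using Nat.strong_induction_on generalizing x with
  | _ n ih =>
    by_cases hx : x = I.r
    · rwa [hx]
    · obtain ⟨p, hp⟩ := I.exists_isParent hx
      have := hp.depth_eq
      exact h1 p x hp (ih (I.depth p) (by omega) p rfl)

variable {I}

theorem IsAncestor.trans {x y z : V} (h1 : I.IsAncestor x y) (h2 : I.IsAncestor y z) :
    I.IsAncestor x z := by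
  induction z using I.root_induction with
  | h0 => rw [isAncestor_root] at h2; rwa [← h2]
  | h1 p q hpq ih =>
    rcases hpq.isAncestor_iff.1 h2 with rfl | h2
    · exact h1
    · exact hpq.isAncestor_iff.2 (Or.inr (ih h2))

theorem IsAncestor.depth_le {x y : V} (h : I.IsAncestor x y) :
    x = y ∨ I.depth x < I.depth y := by
  induction y using I.root_induction with
  | h0 => exact Or.inl (I.isAncestor_root.1 h)
  | h1 p q hpq ih =>
    rcases hpq.isAncestor_iff.1 h with rfl | h
    · exact Or.inl rfl
    · have := hpq.depth_eq
      rcases ih h with rfl | h <;> right <;> omega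

theorem IsAncestor.antisymm {x y : V} (h : I.IsAncestor x y) (h' : I.IsAncestor y x) : x = y := by
  rcases h.depth_le with h | h
  · exact h
  · rcases h'.depth_le with h' | h'
    · exact h'.symm
    · omega

/-- The ancestors of `z` are the vertices of one path from the root, hence a chain. -/
theorem IsAncestor.total {x y z : V} (h1 : I.IsAncestor x z) (h2 : I.IsAncestor y z) :
    I.IsAncestor x y ∨ I.IsAncestor y x := by
  induction z using I.root_induction with
  | h0 =>
    rw [isAncestor_root] at h1 h2
    subst h1; subst h2; exact Or.inl (I.isAncestor_refl _)
  | h1 p q hpq ih =>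
    rcases hpq.isAncestor_iff.1 h1 with rfl | h1'
    · exact Or.inr h2
    · rcases hpq.isAncestor_iff.1 h2 with rfl | h2'
      · exact Or.inl h1
      · exact ih h1' h2'

theorem IsParent.not_isAncestor {p q : V} (h : I.IsParent p q) : ¬ I.IsAncestor q p :=
  fun h' => h.1.ne (h.2.antisymm h')

theorem IsParent.unique {p p' q : V} (h : I.IsParent p q) (h' : I.IsParent p' q) : p = p' := by
  have h1 : I.IsAncestor p' p := (h.isAncestor_iff.1 h'.2).resolve_left h'.1.ne
  have h2 : I.IsAncestor p p' := (h'.isAncestor_iff.1 h.2).resolve_left h.1.ne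
  exact h2.antisymm h1

theorem IsParent.ne_root {p q : V} (h : I.IsParent p q) : q ≠ I.r := by
  rintro rfl
  exact h.1.ne (I.isAncestor_root.1 h.2)

theorem IsAncestor.eq_or_exists_child {x y : V} (h : I.IsAncestor x y) :
    x = y ∨ ∃ w, I.IsParent x w ∧ I.IsAncestor w y := by
  induction y using I.root_induction with
  | h0 => exact Or.inl (I.isAncestor_root.1 h)
  | h1 p q hpq ih =>
    rcases hpq.isAncestor_iff.1 h with rfl | h
    · exact Or.inl rfl
    · right
      rcases ih h with rfl | ⟨w, hw, hwp⟩
      · exact ⟨q, hpq, I.isAncestor_refl q⟩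
      · exact ⟨w, hw, hwp.trans hpq.2⟩

theorem IsParent.eq_of_isAncestor {v w₁ w₂ x : V} (h₁ : I.IsParent v w₁) (h₂ : I.IsParent v w₂)
    (hx₁ : I.IsAncestor w₁ x) (hx₂ : I.IsAncestor w₂ x) : w₁ = w₂ := by
  rcases hx₁.total hx₂ with h | h
  · exact (h₂.isAncestor_iff.1 h).resolve_right h₁.not_isAncestor
  · exact ((h₁.isAncestor_iff.1 h).resolve_right h₂.not_isAncestor).symm

variable (I)

theorem mem_T_root : I.r ∈ I.T := I.degree_root

theorem not_isParent_of_mem_T {v w : V} (hr : v ≠ I.r) (hv : v ∈ I.T) : ¬ I.IsParent v w := by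
  intro h
  obtain ⟨u, hu⟩ := I.exists_isParent hr
  obtain ⟨a, ha⟩ := Set.ncard_eq_one.1 hv
  have h1 : w ∈ I.G.neighborSet v := h.1
  have h2 : u ∈ I.G.neighborSet v := hu.1.symm
  rw [ha] at h1 h2
  have : w = u := by rw [Set.mem_singleton_iff.1 h1, Set.mem_singleton_iff.1 h2]
  subst this
  exact h.not_isAncestor hu.2

theorem exists_children {v : V} (hv : v ∉ I.T) :
    ∃ w₁ w₂, I.IsParent v w₁ ∧ I.IsParent v w₂ ∧ w₁ ≠ w₂ := by
  have hr : v ≠ I.r := fun h => hv (h ▸ I.mem_T_root)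
  obtain ⟨u, hu⟩ := I.exists_isParent hr
  obtain ⟨a, b, d, hab, had, hbd, h⟩ := Set.ncard_eq_three.1 ((I.degree_eq v).resolve_left hv)
  have key : ∀ x ∈ I.G.neighborSet v, x ≠ u → I.IsParent v x := by
    intro x hx hxu
    rcases I.isParent_or_isParent hx with h | h
    · exact h
    · exact absurd (h.unique hu) hxu
  have hu' : u ∈ I.G.neighborSet v := hu.1.symm
  have ha : a ∈ I.G.neighborSet v := by simp [h]
  have hb : b ∈ I.G.neighborSet v := by simp [h]
  have hd : d ∈ I.G.neighborSet v := by simp [h]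
  have hu2 : u = a ∨ u = b ∨ u = d := by simpa [h] using hu'
  rcases hu2 with rfl | rfl | rfl
  · exact ⟨b, d, key b hb hab.symm, key d hd had.symm, hbd⟩
  · exact ⟨a, d, key a ha hab, key d hd hbd.symm, had⟩
  · exact ⟨a, b, key a ha had, key b hb hbd, hab⟩

variable {I}

theorem IsParent.not_mem_T {v w : V} (hr : v ≠ I.r) (h : I.IsParent v w) : v ∉ I.T :=
  fun hv => I.not_isParent_of_mem_T hr hv h

theorem IsParent.eq_or_eq {v w₁ w₂ w : V} (hr : v ≠ I.r) (h₁ : I.IsParent v w₁)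
    (h₂ : I.IsParent v w₂) (hne : w₁ ≠ w₂) (h : I.IsParent v w) : w = w₁ ∨ w = w₂ := by
  obtain ⟨u, hu⟩ := I.exists_isParent hr
  have h3 : (I.G.neighborSet v).ncard = 3 := (I.degree_eq v).resolve_left (h₁.not_mem_T hr)
  have hfin : (I.G.neighborSet v).Finite := Set.finite_of_ncard_ne_zero (by omega)
  by_contra hcon
  push Not at hcon
  have hne' : ∀ {x}, I.IsParent v x → u ≠ x := by
    rintro x hx rfl
    exact hx.not_isAncestor hu.2
  -- A third child would give the degree-3 vertex `v` a fourth neighbour besides its parent.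
  have hsub : ({u, w₁, w₂, w} : Set V) ⊆ I.G.neighborSet v := by
    intro x hx
    simp only [Set.mem_insert_iff, Set.mem_singleton_iff] at hx
    rcases hx with rfl | rfl | rfl | rfl
    · exact hu.1.symm
    · exact h₁.1
    · exact h₂.1
    · exact h.1
  have := Set.ncard_le_ncard hsub hfin
  rw [Set.ncard_insert_of_notMem (by simp [hne' h₁, hne' h₂, hne' h]),
    Set.ncard_insert_of_notMem (by simp [hne, hcon.1.symm]),
    Set.ncard_pair (Ne.symm hcon.2)] at this
  omega

variable (I)

/-- The parent of a vertex (the root is its own parent). -/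
noncomputable def par (y : V) : V := open scoped Classical in
  if h : ∃ x, I.IsParent x y then h.choose else y

/-- The edge between a vertex and its parent. -/
noncomputable def up (y : V) : Sym2 V := s(I.par y, y)

variable {I}

theorem IsParent.par_eq {p q : V} (h : I.IsParent p q) : I.par q = p := by
  have h' : ∃ x, I.IsParent x q := ⟨p, h⟩
  rw [par, dif_pos h']
  exact h'.choose_spec.unique h

theorem IsParent.up_eq {p q : V} (h : I.IsParent p q) : I.up q = s(p, q) := by
  rw [up, h.par_eq]

theorem isParent_par {q : V} (h : q ≠ I.r) : I.IsParent (I.par q) q := by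
  obtain ⟨p, hp⟩ := I.exists_isParent h
  rwa [hp.par_eq]

/-- Two parent edges coincide with swapped ends only if each vertex is the parent of the other,
which the order forbids. This is what allows sums over edges to be sums over vertices. -/
theorem up_injective : Set.InjOn I.up {q | q ≠ I.r} := by
  intro x hx y hy h
  have h1 := isParent_par (I := I) hx
  have h2 := isParent_par (I := I) hy
  unfold up at h
  rcases Sym2.eq_iff.1 h with h | h
  · exact h.2
  · rw [h.1] at h1
    rw [← h.2] at h2
    exact absurd h1.2 h2.not_isAncestor

theorem mem_edgeSet_iff {d : Sym2 V} : d ∈ I.G.edgeSet ↔ ∃ q, q ≠ I.r ∧ d = I.up q := by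
  constructor
  · induction d with | h x y
    intro h
    rcases I.isParent_or_isParent h with h | h
    · exact ⟨y, h.ne_root, h.up_eq.symm⟩
    · exact ⟨x, h.ne_root, by rw [h.up_eq, Sym2.eq_swap]⟩
  · rintro ⟨q, hq, rfl⟩
    exact (isParent_par hq).1

/-- Edges of the tree other than the parent edge of `q` do not leave the set of descendants
of `q`. -/
theorem isAncestor_iff_of_adj {q x y : V} (h : I.G.Adj x y) (hne : s(x, y) ≠ I.up q) :
    I.IsAncestor q x ↔ I.IsAncestor q y := by
  have key : ∀ {x y}, I.IsParent x y → s(x, y) ≠ I.up q →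
      (I.IsAncestor q x ↔ I.IsAncestor q y) := by
    intro x y h hne
    rw [h.isAncestor_iff]
    constructor
    · exact Or.inr
    · rintro (rfl | h')
      · exact absurd h.up_eq.symm hne
      · exact h'
  rcases I.isParent_or_isParent h with h | h
  · exact key h hne
  · exact (key h (by rwa [Sym2.eq_swap])).symm

theorem isAncestor_iff_of_walk {q x y : V} (p : I.G.Walk x y) (hne : I.up q ∉ p.edges) :
    I.IsAncestor q x ↔ I.IsAncestor q y := by
  induction p with
  | nil => rfl
  | cons h p ih =>
    simp only [SimpleGraph.Walk.edges_cons, List.mem_cons, not_or] at hne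
    exact (isAncestor_iff_of_adj h (Ne.symm hne.1)).trans (ih hne.2)

/-- The parent edge of `q` is the only way in or out of the descendants of `q`, and a path uses it
at most once. -/
theorem up_mem_edges_iff {q x y : V} (hq : q ≠ I.r) (p : I.G.Walk x y) (hp : p.IsPath) :
    I.up q ∈ p.edges ↔ ¬ (I.IsAncestor q x ↔ I.IsAncestor q y) := by
  constructor
  · intro hmem
    induction p with
    | nil => simp at hmem
    | @cons x z y h p ih =>
      have hpp := hp.of_cons
      simp only [SimpleGraph.Walk.edges_cons, List.mem_cons] at hmem
      have hnd : (s(x, z) :: p.edges).Nodup := by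
        simpa using hp.isTrail.edges_nodup
      by_cases he : I.up q = s(x, z)
      · have hnot : I.up q ∉ p.edges := by rw [he]; exact (List.nodup_cons.1 hnd).1
        rw [← isAncestor_iff_of_walk p hnot]
        have hpar := isParent_par (I := I) hq
        unfold up at he
        rcases Sym2.eq_iff.1 he with ⟨h1, h2⟩ | ⟨h1, h2⟩
        · rw [← h1, ← h2]
          simp [hpar.not_isAncestor, I.isAncestor_refl]
        · rw [← h1, ← h2]
          simp [hpar.not_isAncestor, I.isAncestor_refl]
      · rw [isAncestor_iff_of_adj h (Ne.symm he)]
        exact ih hpp (hmem.resolve_left he)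
  · intro h
    by_contra hcon
    exact h (isAncestor_iff_of_walk p hcon)

theorem up_mem_pathEdges_iff {q x y : V} (hq : q ≠ I.r) :
    I.up q ∈ I.pathEdges x y ↔ ¬ (I.IsAncestor q x ↔ I.IsAncestor q y) := by
  constructor
  · rintro ⟨p, hp, h⟩
    exact (up_mem_edges_iff hq p hp).1 h
  · intro h
    obtain ⟨p, hp⟩ := I.exists_path x y
    exact ⟨p, hp, (up_mem_edges_iff hq p hp).2 h⟩

theorem mem_pathEdges_iff {d : Sym2 V} {x y : V} :
    d ∈ I.pathEdges x y ↔
      ∃ q, d = I.up q ∧ ¬ (I.IsAncestor q x ↔ I.IsAncestor q y) := by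
  constructor
  · rintro ⟨p, hp, h⟩
    obtain ⟨q, hq, rfl⟩ := mem_edgeSet_iff.1 (p.edges_subset_edgeSet h)
    exact ⟨q, rfl, (up_mem_edges_iff hq p hp).1 h⟩
  · rintro ⟨q, rfl, h⟩
    refine (up_mem_pathEdges_iff ?_).2 h
    rintro rfl
    simp [I.root_isAncestor] at h

end TreeInstance

/-! ### Subtrees, leaves and inner vertices. -/

namespace TreeInstance

variable {V : Type*} (I : TreeInstance V)

/-- The descendants of `v`, including `v` itself. -/
noncomputable def desc [Finite V] (v : V) : Finset V := (Set.toFinite {x | I.IsAncestor v x}).toFinset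

/-- The leaves below `v`. -/
noncomputable def leaves [Finite V] (v : V) : Finset V :=
  (Set.toFinite {x | x ∈ I.T ∧ I.IsAncestor v x}).toFinset

variable {I}

@[simp] theorem mem_desc [Finite V] {v x : V} : x ∈ I.desc v ↔ I.IsAncestor v x := by simp [desc]

@[simp] theorem mem_leaves [Finite V] {v x : V} : x ∈ I.leaves v ↔ x ∈ I.T ∧ I.IsAncestor v x := by
  simp [leaves]

/-- The number of descendants drops strictly from a vertex to a child, so one may induct from the
leaves upwards. -/
theorem subtree_induction [Finite V] {P : V → Prop} (h : ∀ v, (∀ w, I.IsParent v w → P w) → P v) (v : V) :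
    P v := by
  induction hn : (I.desc v).card using Nat.strong_induction_on generalizing v with
  | _ n ih =>
    refine h v fun w hw => ih _ ?_ w rfl
    rw [← hn]
    refine Finset.card_lt_card ⟨fun x hx => ?_, fun hsub => ?_⟩
    · exact mem_desc.2 (hw.2.trans (mem_desc.1 hx))
    · exact hw.not_isAncestor (mem_desc.1 (hsub (mem_desc.2 (I.isAncestor_refl v))))

theorem isAncestor_leaf_iff {v x : V} (hr : v ≠ I.r) (hv : v ∈ I.T) :
    I.IsAncestor v x ↔ x = v := by
  constructor
  · intro h
    rcases h.eq_or_exists_child with h | ⟨w, hw, -⟩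
    · exact h.symm
    · exact absurd hw (I.not_isParent_of_mem_T hr hv)
  · rintro rfl; exact I.isAncestor_refl _

theorem desc_leaf [Finite V] {v : V} (hr : v ≠ I.r) (hv : v ∈ I.T) : I.desc v = {v} := by
  ext x; simp [isAncestor_leaf_iff hr hv]

theorem leaves_leaf [Finite V] {v : V} (hr : v ≠ I.r) (hv : v ∈ I.T) : I.leaves v = {v} := by
  ext x
  simp only [mem_leaves, isAncestor_leaf_iff hr hv, Finset.mem_singleton]
  exact ⟨fun h => h.2, by rintro rfl; exact ⟨hv, rfl⟩⟩

variable (I) in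
/-- `v` is an inner vertex with children `w₁` and `w₂`. -/
structure IsNode (v w₁ w₂ : V) : Prop where
  left : I.IsParent v w₁
  right : I.IsParent v w₂
  ne : w₁ ≠ w₂
  ne_root : v ≠ I.r

theorem exists_isNode {v : V} (hv : v ∉ I.T) : ∃ w₁ w₂, I.IsNode v w₁ w₂ := by
  obtain ⟨w₁, w₂, h₁, h₂, h⟩ := I.exists_children hv
  exact ⟨w₁, w₂, h₁, h₂, h, fun hr => hv (hr ▸ I.mem_T_root)⟩

namespace IsNode

variable {v w₁ w₂ x y : V}

theorem symm (h : I.IsNode v w₁ w₂) : I.IsNode v w₂ w₁ := ⟨h.right, h.left, h.ne.symm, h.ne_root⟩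

theorem not_mem_T (h : I.IsNode v w₁ w₂) : v ∉ I.T := h.left.not_mem_T h.ne_root

theorem eq_or_eq {w : V} (h : I.IsNode v w₁ w₂) (hw : I.IsParent v w) : w = w₁ ∨ w = w₂ :=
  h.left.eq_or_eq h.ne_root h.right h.ne hw

theorem isAncestor_iff (h : I.IsNode v w₁ w₂) :
    I.IsAncestor v x ↔ x = v ∨ I.IsAncestor w₁ x ∨ I.IsAncestor w₂ x := by
  constructor
  · intro hx
    rcases hx.eq_or_exists_child with hx | ⟨w, hw, hwx⟩
    · exact Or.inl hx.symm
    · rcases h.eq_or_eq hw with rfl | rfl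
      · exact Or.inr (Or.inl hwx)
      · exact Or.inr (Or.inr hwx)
  · rintro (rfl | hx | hx)
    · exact I.isAncestor_refl _
    · exact h.left.2.trans hx
    · exact h.right.2.trans hx

theorem disjoint (h : I.IsNode v w₁ w₂) (h₁ : I.IsAncestor w₁ x) (h₂ : I.IsAncestor w₂ x) :
    False := h.ne (h.left.eq_of_isAncestor h.right h₁ h₂)

theorem sum_erase_desc [Finite V] [DecidableEq V] {M : Type*} [AddCommMonoid M] (h : I.IsNode v w₁ w₂)
    (F : V → M) :
    ∑ q ∈ (I.desc v).erase v, F q = ∑ q ∈ I.desc w₁, F q + ∑ q ∈ I.desc w₂, F q := by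
  have : (I.desc v).erase v = I.desc w₁ ∪ I.desc w₂ := by
    ext x
    simp only [Finset.mem_erase, mem_desc, h.isAncestor_iff, Finset.mem_union]
    constructor
    · tauto
    · rintro (hx | hx)
      · refine ⟨?_, Or.inr (Or.inl hx)⟩
        rintro rfl; exact h.left.not_isAncestor hx
      · refine ⟨?_, Or.inr (Or.inr hx)⟩
        rintro rfl; exact h.right.not_isAncestor hx
  rw [this, Finset.sum_union]
  rw [Finset.disjoint_left]
  intro x h₁ h₂
  exact h.disjoint (mem_desc.1 h₁) (mem_desc.1 h₂)

theorem mem_leaves_iff [Finite V] (h : I.IsNode v w₁ w₂) :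
    x ∈ I.leaves v ↔ x ∈ I.leaves w₁ ∨ x ∈ I.leaves w₂ := by
  simp only [mem_leaves, h.isAncestor_iff]
  constructor
  · rintro ⟨hx, rfl | hx'⟩
    · exact absurd hx h.not_mem_T
    · tauto
  · tauto

theorem sum_leaves [Finite V] {M : Type*} [AddCommMonoid M] (h : I.IsNode v w₁ w₂) (F : V → M) :
    ∑ q ∈ I.leaves v, F q = ∑ q ∈ I.leaves w₁, F q + ∑ q ∈ I.leaves w₂, F q := by
  classical
  have : I.leaves v = I.leaves w₁ ∪ I.leaves w₂ := by
    ext x; rw [h.mem_leaves_iff, Finset.mem_union]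
  rw [this, Finset.sum_union]
  rw [Finset.disjoint_left]
  intro x h₁ h₂
  exact h.disjoint (mem_leaves.1 h₁).2 (mem_leaves.1 h₂).2

end IsNode

/-! ### The data of `I(e)` expressed through descendants and ancestors. -/

section Translation

variable {u v x : V}

theorem IsParent.mem_subE (h : I.IsParent u v) {d : Sym2 V} :
    d ∈ I.subE u v ↔ ∃ q, I.IsAncestor v q ∧ d = I.up q := by
  constructor
  · rintro ⟨hd, hd'⟩
    obtain ⟨q, hq, rfl⟩ := mem_edgeSet_iff.1 hd
    refine ⟨q, ?_, rfl⟩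
    rcases hd' q (by simp [up]) with rfl | hvq
    · have hpar := isParent_par (I := I) hq
      rcases hd' (I.par q) (by simp [up]) with hp | hp
      · rw [hp] at hpar; exact absurd rfl hpar.1.ne
      · exact absurd (IsAncestor.trans hp hpar.2) h.not_isAncestor
    · exact hvq
  · rintro ⟨q, hq, rfl⟩
    have hqr : q ≠ I.r := by
      rintro rfl
      exact h.ne_root (I.isAncestor_root.1 hq)
    have hpar := isParent_par (I := I) hqr
    refine ⟨hpar.1, fun x hx => ?_⟩
    rw [up, Sym2.mem_iff] at hx
    rcases hx with rfl | rfl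
    · rcases hpar.isAncestor_iff.1 hq with rfl | hq
      · exact Or.inl h.par_eq
      · exact Or.inr hq
    · exact Or.inr hq

theorem IsParent.ne_root_of_isAncestor (h : I.IsParent u v) {q : V} (hq : I.IsAncestor v q) :
    q ≠ I.r := by
  rintro rfl
  exact h.ne_root (I.isAncestor_root.1 hq)

theorem IsParent.mem_subT (h : I.IsParent u v) : x ∈ I.subT u v ↔ x ∈ I.T ∧ I.IsAncestor v x := by
  constructor
  · rintro ⟨⟨h1, h2⟩, h3⟩
    exact ⟨h1, h2.resolve_left h3⟩
  · rintro ⟨h1, h2⟩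
    refine ⟨⟨h1, Or.inr h2⟩, ?_⟩
    rintro rfl
    exact h.not_isAncestor h2

theorem IsParent.mem_terminals (h : I.IsParent u v) :
    x ∈ I.terminals u v ↔ x = u ∨ x ∈ I.T ∧ I.IsAncestor v x := by
  rw [terminals, Set.mem_insert_iff, h.mem_subT]

theorem IsParent.mem_cut (h : I.IsParent u v) {d : Sym2 V} {X : Set V} :
    d ∈ I.cut u v X ↔ ∃ q, I.IsAncestor v q ∧ d = I.up q ∧ ¬ (q ∈ X ↔ I.par q ∈ X) := by
  constructor
  · rintro ⟨hd, x, y, hxy, hx, hy⟩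
    obtain ⟨q, hq, rfl⟩ := h.mem_subE.1 hd
    refine ⟨q, hq, rfl, ?_⟩
    rw [up] at hxy
    rcases Sym2.eq_iff.1 hxy with ⟨h1, h2⟩ | ⟨h1, h2⟩ <;> rw [h1, h2] <;> tauto
  · rintro ⟨q, hq, rfl, hX⟩
    refine ⟨h.mem_subE.2 ⟨q, hq, rfl⟩, ?_⟩
    by_cases hqX : q ∈ X
    · exact ⟨q, I.par q, by rw [up, Sym2.eq_swap], hqX, by tauto⟩
    · exact ⟨I.par q, q, rfl, by tauto, hqX⟩

open scoped Classical in
theorem IsParent.cutValue_eq [Finite V] (h : I.IsParent u v) (f : Sym2 V → ℕ) (X : Set V) :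
    I.cutValue u v f X =
      ∑ q ∈ I.desc v, if (q ∈ X ↔ I.par q ∈ X) then 0 else f (I.up q) := by
  have hif : ∀ q ∈ I.desc v, (if (q ∈ X ↔ I.par q ∈ X) then 0 else f (I.up q)) =
      if ¬ (q ∈ X ↔ I.par q ∈ X) then f (I.up q) else 0 := fun q _ => (ite_not _ _ _).symm
  rw [cutValue, Finset.sum_congr rfl hif, ← Finset.sum_filter]
  symm
  refine Finset.sum_bij (fun q _ => I.up q) ?_ ?_ ?_ (fun _ _ => rfl)
  · intro q hq
    rw [Finset.mem_filter, mem_desc] at hq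
    rw [Set.Finite.mem_toFinset, h.mem_cut]
    exact ⟨q, hq.1, rfl, hq.2⟩
  · intro q hq q' hq' he
    rw [Finset.mem_filter, mem_desc] at hq hq'
    exact up_injective (h.ne_root_of_isAncestor hq.1) (h.ne_root_of_isAncestor hq'.1) he
  · intro d hd
    rw [Set.Finite.mem_toFinset, h.mem_cut] at hd
    obtain ⟨q, hq, rfl, hX⟩ := hd
    exact ⟨q, by simp [hq, hX], rfl⟩

theorem incidenceSet_leaf {t : V} (hr : t ≠ I.r) (ht : t ∈ I.T) {d : Sym2 V} :
    d ∈ I.G.incidenceSet t ↔ d = I.up t := by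
  constructor
  · rintro ⟨hd, htd⟩
    obtain ⟨q, hq, rfl⟩ := mem_edgeSet_iff.1 hd
    rw [up, Sym2.mem_iff] at htd
    have := isParent_par (I := I) hq
    rcases htd with h | rfl
    · rw [← h] at this
      exact absurd this (I.not_isParent_of_mem_T hr ht)
    · rfl
  · rintro rfl
    exact ⟨(isParent_par hr).1, by simp [up]⟩

variable (I) in
/-- The vertices that are reachable from `x` by going up along edges of residual capacity at least
1 and then down along edges of residual capacity at least 2, where the edge above `q` carries the
flow `F q`. -/
def residualReach (F : V → ℕ) (x : V) : Set V :=
  {w | (∀ q, I.IsAncestor q x → ¬ I.IsAncestor q w → F q + 1 ≤ I.c (I.up q)) ∧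
    ∀ q, I.IsAncestor q w → ¬ I.IsAncestor q x → F q + 2 ≤ I.c (I.up q)}

variable (I) in
theorem exists_isLCA (x y : V) : ∃ z, I.IsLCA z x y := by
  induction x using I.root_induction with
  | h0 => exact ⟨I.r, I.isAncestor_refl _, I.root_isAncestor _, fun z' h _ => h⟩
  | h1 p q hpq ih =>
    by_cases hq : I.IsAncestor q y
    · exact ⟨q, I.isAncestor_refl _, hq, fun z' h _ => h⟩
    · obtain ⟨z, h1, h2, h3⟩ := ih
      refine ⟨z, h1.trans hpq.2, h2, fun z' h h' => h3 z' ?_ h'⟩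
      rcases hpq.isAncestor_iff.1 h with rfl | h
      · exact absurd h' hq
      · exact h

theorem IsLCA.mem_pathEdges_left {x y z : V} (h : I.IsLCA z x y) {d : Sym2 V} :
    d ∈ I.pathEdges x z ↔ ∃ q, d = I.up q ∧ I.IsAncestor q x ∧ ¬ I.IsAncestor q y := by
  rw [mem_pathEdges_iff]
  refine exists_congr fun q => and_congr_right fun _ => ?_
  have h1 : I.IsAncestor q z → I.IsAncestor q x := fun h' => h'.trans h.1
  have h2 : I.IsAncestor q z → I.IsAncestor q y := fun h' => h'.trans h.2.1
  have h3 := h.2.2 q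
  tauto

theorem IsLCA.symm {x y z : V} (h : I.IsLCA z x y) : I.IsLCA z y x :=
  ⟨h.2.1, h.1, fun z' h1 h2 => h.2.2 z' h2 h1⟩

theorem pathEdges_comm (x y : V) : I.pathEdges x y = I.pathEdges y x := by
  ext d
  simp only [mem_pathEdges_iff]
  exact exists_congr fun q => and_congr_right fun _ => not_congr iff_comm

/-- The edges from `x` up to the lowest common ancestor are those above ancestors of `x` that are
not ancestors of `w`, and symmetrically on the way down. The common ancestor thus disappears from
the condition. -/
theorem reach_eq (f : Sym2 V → ℕ) :
    I.reach u v f x = I.subV u v ∩ I.residualReach (fun q => f (I.up q)) x := by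
  ext w
  refine and_congr_right fun _ => ?_
  constructor
  · rintro ⟨z, hz, h1, h2⟩
    refine ⟨fun q hq hq' => h1 _ (hz.mem_pathEdges_left.2 ⟨q, rfl, hq, hq'⟩), fun q hq hq' => ?_⟩
    refine h2 _ ?_
    rw [pathEdges_comm]
    exact hz.symm.mem_pathEdges_left.2 ⟨q, rfl, hq, hq'⟩
  · rintro ⟨h1, h2⟩
    obtain ⟨z, hz⟩ := I.exists_isLCA x w
    refine ⟨z, hz, fun d hd => ?_, fun d hd => ?_⟩
    · obtain ⟨q, rfl, hq, hq'⟩ := hz.mem_pathEdges_left.1 hd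
      exact h1 q hq hq'
    · rw [pathEdges_comm] at hd
      obtain ⟨q, rfl, hq, hq'⟩ := hz.symm.mem_pathEdges_left.1 hd
      exact h2 q hq hq'

end Translation

end TreeInstance

/-! ### Blocking conditions on vertex functions and their behaviour at an inner vertex. -/

namespace TreeInstance

variable {V : Type*} (I : TreeInstance V)

/-- The capacity of the edge above `q`. -/
noncomputable def cap (q : V) : ℕ := I.c (I.up q)

open scoped Classical in
/-- The contribution of the edge above `q` to the cut of `X`. -/
noncomputable def cutTerm (F : V → ℕ) (X : Set V) (q : V) : ℕ :=
  if (q ∈ X ↔ I.par q ∈ X) then 0 else F q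

open scoped Classical in
/-- The value of the cut of `X` in the graph induced by the descendants of `v`. -/
noncomputable def innerCut [Finite V] (F : V → ℕ) (v : V) (X : Set V) : ℕ :=
  ∑ q ∈ (I.desc v).erase v, I.cutTerm F X q

/-- The parity and triangle conditions for the flow values on the edges at `q`. -/
def LocalFlow (F : V → ℕ) (q : V) : Prop :=
  ∀ w₁ w₂, I.IsNode q w₁ w₂ → ∃ y, y ≤ F w₁ ∧ y ≤ F w₂ ∧ F q + 2 * y = F w₁ + F w₂

/-- `F` satisfies the capacity and flow conditions in the subtree of the edge above `v`. -/
def FlowOn (F : V → ℕ) (v : V) : Prop :=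
  ∀ q, I.IsAncestor v q → F q ≤ I.cap q ∧ I.LocalFlow F q

/-- The blocking conditions in the subtree of the edge above `v`, except that a terminal may
reach the upper end of that edge. -/
structure PreBlocking [Finite V] (F : V → ℕ) (v : V) : Prop where
  flow : I.FlowOn F v
  disj : ∀ s ∈ I.leaves v, ∀ t ∈ I.leaves v, s ≠ t → ∀ x, I.IsAncestor v x →
    x ∈ I.residualReach F s → x ∉ I.residualReach F t
  out : ∀ s ∈ I.leaves v, v ∉ I.residualReach F s →
    F s = I.innerCut F v (I.residualReach F s)
  out' : ∀ s ∈ I.leaves v, v ∈ I.residualReach F s →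
    F s = I.innerCut F v (I.residualReach F s) + F v

/-- The blocking conditions in the subtree of the edge above `v`. -/
structure Blocking [Finite V] (F : V → ℕ) (v : V) : Prop extends I.PreBlocking F v where
  top : ∀ t ∈ I.leaves v, v ∈ I.residualReach F t → F v = I.cap v

/-- A blocking flow for which the set reached downwards from the upper end of the edge above `v`
avoids all sets reached from the terminals below, and all flow through its cut goes to that upper
end. -/
structure DownBlocking [Finite V] (F : V → ℕ) (v : V) : Prop extends I.Blocking F v where
  down_disj : F v + 2 ≤ I.cap v → ∀ s ∈ I.leaves v, ∀ x, I.IsAncestor v x →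
    x ∈ I.residualReach F v → x ∉ I.residualReach F s
  down_val : F v + 2 ≤ I.cap v → I.innerCut F v (I.residualReach F v) = F v

variable {I} {F : V → ℕ} {v w w₁ w₂ t x : V} {X Y : Set V}

theorem FlowOn.mono (h : I.FlowOn F v) (hw : I.IsAncestor v w) : I.FlowOn F w :=
  fun q hq => h q (hw.trans hq)

theorem mem_residualReach_self : x ∈ I.residualReach F x :=
  ⟨fun _ h h' => absurd h h', fun _ h h' => absurd h h'⟩

/-- From below `w`, the only new edge on the way to `v` is the one above `w`, and it is used
upwards. -/
theorem mem_residualReach_parent (h : I.IsParent v w) (ht : I.IsAncestor w t) :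
    v ∈ I.residualReach F t ↔ w ∈ I.residualReach F t ∧ F w + 1 ≤ I.cap w := by
  constructor
  · rintro ⟨h1, -⟩
    refine ⟨⟨fun q hq hq' => h1 q hq fun hv => hq' (hv.trans h.2), fun q hq hq' => ?_⟩,
      h1 w ht h.not_isAncestor⟩
    exact absurd (hq.trans ht) hq'
  · rintro ⟨⟨h1, -⟩, h2⟩
    refine ⟨fun q hq hq' => ?_, fun q hq hq' => absurd (hq.trans (h.2.trans ht)) hq'⟩
    by_cases hqw : I.IsAncestor q w
    · rw [(h.isAncestor_iff.1 hqw).resolve_right hq']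
      exact h2
    · exact h1 q hq hqw

theorem mem_residualReach_child (h : I.IsParent v w) (hx : I.IsAncestor w x) :
    x ∈ I.residualReach F v ↔ x ∈ I.residualReach F w ∧ F w + 2 ≤ I.cap w := by
  constructor
  · rintro ⟨-, h1⟩
    refine ⟨⟨fun q hq hq' => absurd (hq.trans hx) hq', fun q hq hq' => h1 q hq fun hv =>
      hq' (hv.trans h.2)⟩, h1 w hx h.not_isAncestor⟩
  · rintro ⟨⟨-, h1⟩, h2⟩
    refine ⟨fun q hq hq' => absurd (hq.trans (h.2.trans hx)) hq', fun q hq hq' => ?_⟩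
    by_cases hqw : I.IsAncestor q w
    · rw [(h.isAncestor_iff.1 hqw).resolve_right hq']
      exact h2
    · exact h1 q hq hqw

/-- A route between the two subtrees turns exactly at `v`: it rises to `v` and then descends, so the
two halves are tested separately. -/
theorem IsNode.mem_residualReach_cross (h : I.IsNode v w₁ w₂) (ht : I.IsAncestor w₁ t)
    (hx : I.IsAncestor w₂ x) :
    x ∈ I.residualReach F t ↔ v ∈ I.residualReach F t ∧ x ∈ I.residualReach F v := by
  have hvt : I.IsAncestor v t := h.left.2.trans ht
  have hvx : I.IsAncestor v x := h.right.2.trans hx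
  have key : ∀ q, I.IsAncestor q t → I.IsAncestor q x → I.IsAncestor q v := by
    intro q hqt hqx
    rcases hqt.total ht with hq | hq
    · rcases h.left.isAncestor_iff.1 hq with rfl | hq
      · exact (h.disjoint hqx hx).elim
      · exact hq
    · exact (h.disjoint (hq.trans hqx) hx).elim
  constructor
  · rintro ⟨h1, h2⟩
    exact ⟨⟨fun q hq hq' => h1 q hq fun hqx => hq' (key q hq hqx),
      fun q hq hq' => absurd (hq.trans hvt) hq'⟩,
      ⟨fun q hq hq' => absurd (hq.trans hvx) hq',
      fun q hq hq' => h2 q hq fun hqt => hq' (key q hqt hq)⟩⟩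
  · rintro ⟨⟨h1, -⟩, ⟨-, h2⟩⟩
    exact ⟨fun q hq hq' => h1 q hq fun hqv => hq' (hqv.trans hvx),
      fun q hq hq' => h2 q hq fun hqv => hq' (hqv.trans hvt)⟩

theorem mem_residualReach_of_between (hv : v ∈ I.residualReach F t) (hvw : I.IsAncestor v w)
    (hwt : I.IsAncestor w t) : w ∈ I.residualReach F t :=
  ⟨fun q hq hq' => hv.1 q hq fun h => hq' (h.trans hvw), fun _ hq hq' => absurd (hq.trans hwt) hq'⟩

theorem cutTerm_congr (h : x ∈ X ↔ x ∈ Y) (h' : I.par x ∈ X ↔ I.par x ∈ Y) :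
    I.cutTerm F X x = I.cutTerm F Y x := by
  unfold cutTerm
  rw [h, h']

theorem IsNode.cutTerm_left (h : I.IsNode v w₁ w₂) :
    I.cutTerm F X w₁ = open scoped Classical in if (w₁ ∈ X ↔ v ∈ X) then 0 else F w₁ := by
  rw [cutTerm, h.left.par_eq]

theorem flowOn_leaf (hv : v ≠ I.r) (hT : v ∈ I.T) (h : F v ≤ I.cap v) : I.FlowOn F v := by
  intro q hq
  rw [isAncestor_leaf_iff hv hT] at hq
  subst hq
  exact ⟨h, fun w₁ w₂ hn => absurd hT hn.not_mem_T⟩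

theorem IsNode.flowOn (h : I.IsNode v w₁ w₂) (hc : F v ≤ I.cap v)
    (hy : ∃ y, y ≤ F w₁ ∧ y ≤ F w₂ ∧ F v + 2 * y = F w₁ + F w₂) (h₁ : I.FlowOn F w₁)
    (h₂ : I.FlowOn F w₂) : I.FlowOn F v := by
  intro q hq
  rcases h.isAncestor_iff.1 hq with rfl | hq | hq
  · refine ⟨hc, fun z₁ z₂ hz => ?_⟩
    obtain ⟨y, hy1, hy2, hy3⟩ := hy
    rcases h.eq_or_eq hz.left with rfl | rfl
    · rcases h.eq_or_eq hz.right with rfl | rfl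
      · exact absurd rfl hz.ne
      · exact ⟨y, hy1, hy2, hy3⟩
    · rcases h.eq_or_eq hz.right with rfl | rfl
      · exact ⟨y, hy2, hy1, by omega⟩
      · exact absurd rfl hz.ne
  · exact h₁ q hq
  · exact h₂ q hq

section Cuts

variable [Finite V]

theorem par_of_mem_erase [DecidableEq V] (hv : v ≠ I.r) {q : V} (hq : q ∈ (I.desc v).erase v) :
    I.IsParent (I.par q) q ∧ I.IsAncestor v (I.par q) := by
  rw [Finset.mem_erase, mem_desc] at hq
  have hqr : q ≠ I.r := by
    rintro rfl
    exact hv (I.isAncestor_root.1 hq.2)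
  have hp := isParent_par (I := I) hqr
  exact ⟨hp, (hp.isAncestor_iff.1 hq.2).resolve_left (Ne.symm hq.1)⟩

theorem innerCut_congr (hv : v ≠ I.r) (h : ∀ x, I.IsAncestor v x → (x ∈ X ↔ x ∈ Y)) :
    I.innerCut F v X = I.innerCut F v Y := by
  classical
  refine Finset.sum_congr (by congr) fun q hq => ?_
  have hq' := par_of_mem_erase hv hq
  exact cutTerm_congr (h q (hq'.2.trans hq'.1.2)) (h _ hq'.2)

theorem innerCut_eq_zero (hv : v ≠ I.r) (h : ∀ x, I.IsAncestor v x → x ∉ X) :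
    I.innerCut F v X = 0 := by
  rw [innerCut_congr (Y := ∅) hv (fun x hx => by simp [h x hx])]
  simp [innerCut, cutTerm]

theorem innerCut_leaf (hv : v ≠ I.r) (hT : v ∈ I.T) : I.innerCut F v X = 0 := by
  simp [innerCut, desc_leaf hv hT]

theorem IsNode.innerCut_eq (h : I.IsNode v w₁ w₂) :
    I.innerCut F v X = I.cutTerm F X w₁ + I.innerCut F w₁ X +
      (I.cutTerm F X w₂ + I.innerCut F w₂ X) := by
  classical
  have key : ∀ w, I.cutTerm F X w + I.innerCut F w X = ∑ q ∈ I.desc w, I.cutTerm F X q := by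
    intro w
    rw [innerCut, ← Finset.add_sum_erase (I.desc w) _ (mem_desc.2 (I.isAncestor_refl w))]
  rw [key, key, ← h.sum_erase_desc, innerCut]

/-- Inside `X` the flow on an edge is at most the sum on its child edges; since no leaf below lies
in `X`, this descent ends on cut edges. -/
theorem FlowOn.le_cut (hF : I.FlowOn F w) (h : I.IsParent v w) (hv : v ∈ X)
    (hX : ∀ s ∈ I.leaves w, s ∉ X) : F w ≤ I.cutTerm F X w + I.innerCut F w X := by
  induction w using subtree_induction (I := I) generalizing v with
  | h w ih =>
    by_cases hw : w ∈ X
    · have hT : w ∉ I.T := fun hT => hX w (mem_leaves.2 ⟨hT, I.isAncestor_refl w⟩) hw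
      obtain ⟨w₁, w₂, hn⟩ := I.exists_isNode hT
      have h1 := ih w₁ hn.left (hF.mono hn.left.2) hn.left hw
        (fun s hs => hX s (hn.mem_leaves_iff.2 (Or.inl hs)))
      have h2 := ih w₂ hn.right (hF.mono hn.right.2) hn.right hw
        (fun s hs => hX s (hn.mem_leaves_iff.2 (Or.inr hs)))
      obtain ⟨y, -, -, hy⟩ := (hF w (I.isAncestor_refl w)).2 w₁ w₂ hn
      rw [hn.innerCut_eq]
      omega
    · have : I.cutTerm F X w = F w := by rw [cutTerm, h.par_eq, if_neg (by tauto)]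
      omega

/-- Climb from `t` to `w` inside `X`: at each step the value below is at most the value above plus
the sibling's, and the sibling's value is bounded by its part of the cut through `FlowOn.le_cut`. -/
theorem FlowOn.leaf_le_cut (hF : I.FlowOn F w) (hw : w ≠ I.r) (ht : t ∈ I.leaves w)
    (hX : ∀ s ∈ I.leaves w, s ≠ t → s ∉ X)
    (hpath : ∀ q, I.IsAncestor w q → I.IsAncestor q t → q ∈ X) :
    F t ≤ F w + I.innerCut F w X := by
  induction w using subtree_induction (I := I) with
  | h w ih =>
    by_cases hT : w ∈ I.T
    · rw [leaves_leaf hw hT, Finset.mem_singleton] at ht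
      rw [ht]; omega
    · have key : ∀ {w₁ w₂}, I.IsNode w w₁ w₂ → t ∈ I.leaves w₁ →
          F t ≤ F w + I.innerCut F w X := by
        intro w₁ w₂ hn ht₁
        have hwX : w ∈ X := hpath w (I.isAncestor_refl w) (mem_leaves.1 ht).2
        have h1 := ih w₁ hn.left (hF.mono hn.left.2) hn.left.ne_root ht₁
          (fun s hs => hX s (hn.mem_leaves_iff.2 (Or.inl hs)))
          (fun q hq => hpath q (hn.left.2.trans hq))
        have h2 := (hF.mono hn.right.2).le_cut hn.right hwX (fun s hs => by
          refine hX s (hn.mem_leaves_iff.2 (Or.inr hs)) ?_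
          rintro rfl
          exact hn.disjoint (mem_leaves.1 ht₁).2 (mem_leaves.1 hs).2)
        obtain ⟨y, -, hy', hy⟩ := (hF w (I.isAncestor_refl w)).2 w₁ w₂ hn
        rw [hn.innerCut_eq]
        omega
      obtain ⟨w₁, w₂, hn⟩ := I.exists_isNode hT
      rcases hn.mem_leaves_iff.1 ht with h | h
      · exact key hn h
      · exact key hn.symm h

/-- A set that misses `v` cannot enter the sibling subtree, so its boundary lies below `w₁` together
with the edge above `w₁`. -/
theorem IsNode.innerCut_of_notMem (h : I.IsNode v w₁ w₂) (ht : I.IsAncestor w₁ t)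
    (hv : v ∉ I.residualReach F t) :
    I.innerCut F v (I.residualReach F t) = I.innerCut F w₁ (I.residualReach F t) +
      open scoped Classical in if w₁ ∈ I.residualReach F t then F w₁ else 0 := by
  have h2 : ∀ x, I.IsAncestor w₂ x → x ∉ I.residualReach F t := fun x hx hx' =>
    hv ((h.mem_residualReach_cross ht hx).1 hx').1
  rw [h.innerCut_eq, innerCut_eq_zero h.right.ne_root h2, h.cutTerm_left, h.symm.cutTerm_left]
  have := h2 w₂ (I.isAncestor_refl _)
  by_cases hw : w₁ ∈ I.residualReach F t <;> simp [hw, hv, this]; ring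

/-- The flow through the cut of the set reached downwards from the parent `v` of `w`. -/
theorem innerCut_down (h : I.IsParent v w) (hX : ∀ x, I.IsAncestor w x →
    (x ∈ X ↔ x ∈ I.residualReach F v)) (hv : v ∈ X) :
    I.cutTerm F X w + I.innerCut F w X = open scoped Classical in
      if F w + 2 ≤ I.cap w then I.innerCut F w (I.residualReach F w) else F w := by
  have hw := (hX w (I.isAncestor_refl w)).trans (mem_residualReach_child h (I.isAncestor_refl w))
  rw [and_iff_right mem_residualReach_self] at hw
  rw [cutTerm, h.par_eq]
  split_ifs with h1 h2 h2
  · rw [innerCut_congr h.ne_root (Y := I.residualReach F w) fun x hx => ?_, zero_add]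
    rw [hX x hx, mem_residualReach_child h hx, and_iff_left h2]
  · exact absurd (hw.1 (h1.2 hv)) h2
  · exact absurd (iff_of_true (hw.2 h2) hv) h1
  · rw [innerCut_eq_zero h.ne_root fun x hx hx' => ?_, add_zero]
    rw [hX x hx, mem_residualReach_child h hx] at hx'
    exact h2 hx'.2

theorem IsNode.innerCut_of_mem (h : I.IsNode v w₁ w₂) (ht : I.IsAncestor w₁ t)
    (hv : v ∈ I.residualReach F t) :
    I.innerCut F v (I.residualReach F t) = I.innerCut F w₁ (I.residualReach F t) +
      open scoped Classical in
      if F w₂ + 2 ≤ I.cap w₂ then I.innerCut F w₂ (I.residualReach F w₂) else F w₂ := by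
  rw [h.innerCut_eq, ← innerCut_down (X := I.residualReach F t) h.right (fun x hx => ?_) hv,
    h.cutTerm_left, if_pos, zero_add]
  · exact iff_of_true ((mem_residualReach_parent h.left ht).1 hv).1 hv
  · rw [h.mem_residualReach_cross ht hx, and_iff_right hv]

end Cuts

/-! ### Splitting and gluing blocking flows at an inner vertex. -/

section Recursion

variable [Finite V]

/-- Sets that stop short of `v` have their whole boundary on the `w₁` side, and one that contains
`w₁` can stop there only because the edge above `w₁` is full. -/
theorem PreBlocking.blocking_left (hB : I.PreBlocking F v) (h : I.IsNode v w₁ w₂)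
    (hno : ∀ s ∈ I.leaves w₁, v ∉ I.residualReach F s) : I.Blocking F w₁ := by
  have hl : ∀ {s}, s ∈ I.leaves w₁ → s ∈ I.leaves v := fun hs => h.mem_leaves_iff.2 (Or.inl hs)
  refine ⟨⟨hB.flow.mono h.left.2, ?_, ?_, ?_⟩, ?_⟩
  · exact fun s hs t ht hst x hx => hB.disj s (hl hs) t (hl ht) hst x (h.left.2.trans hx)
  · intro s hs hw
    rw [hB.out s (hl hs) (hno s hs),
      h.innerCut_of_notMem (mem_leaves.1 hs).2 (hno s hs), if_neg hw, add_zero]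
  · intro s hs hw
    rw [hB.out s (hl hs) (hno s hs),
      h.innerCut_of_notMem (mem_leaves.1 hs).2 (hno s hs), if_pos hw]
  · intro t ht hw
    have h1 := hno t ht
    rw [mem_residualReach_parent h.left (mem_leaves.1 ht).2] at h1
    have h2 := (hB.flow w₁ h.left.2).1
    by_contra hne
    exact h1 ⟨hw, by omega⟩

/-- The structure of a pre-blocking flow for which a terminal `t` reaches the inner vertex `v`. -/
structure Passes (I : TreeInstance V) (F : V → ℕ) (v w₁ w₂ t : V) : Prop where
  pre : I.PreBlocking F w₁
  mem : w₁ ∈ I.residualReach F t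
  lt : F w₁ < I.cap w₁
  down : I.DownBlocking F w₂
  eq : F w₁ = F v + F w₂

/-- Let `X` be the set reached by `t`. The cut bounds below `w₁` and `w₂`, together with the
triangle inequality at `v`, bound `F t` from above by the flow through the boundary of `X`. As `F t`
equals that flow, all these inequalities are tight, and their tightness yields the balance at `v`
and the condition on the sibling. -/
theorem PreBlocking.passes (hB : I.PreBlocking F v) (h : I.IsNode v w₁ w₂) (ht : t ∈ I.leaves w₁)
    (hv : v ∈ I.residualReach F t) : I.Passes F v w₁ w₂ t := by
  have hl₁ : ∀ {s}, s ∈ I.leaves w₁ → s ∈ I.leaves v := fun hs => h.mem_leaves_iff.2 (Or.inl hs)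
  have hl₂ : ∀ {s}, s ∈ I.leaves w₂ → s ∈ I.leaves v := fun hs => h.mem_leaves_iff.2 (Or.inr hs)
  have hvv := I.isAncestor_refl v
  have hno : ∀ s ∈ I.leaves v, s ≠ t → v ∉ I.residualReach F s := fun s hs hst hvs =>
    hB.disj s hs t (hl₁ ht) hst v hvv hvs hv
  have hne₂ : ∀ {s}, s ∈ I.leaves w₂ → s ≠ t := by
    rintro s hs rfl
    exact h.disjoint (mem_leaves.1 ht).2 (mem_leaves.1 hs).2
  have hB₂ : I.Blocking F w₂ :=
    hB.blocking_left h.symm fun s hs => hno s (hl₂ hs) (hne₂ hs)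
  have hup := (mem_residualReach_parent h.left (mem_leaves.1 ht).2).1 hv
  have hcross : ∀ {x}, I.IsAncestor w₂ x → x ∈ I.residualReach F v → x ∈ I.residualReach F t :=
    fun hx hx' => (h.mem_residualReach_cross (mem_leaves.1 ht).2 hx).2 ⟨hv, hx'⟩
  have hleaf : ∀ s ∈ I.leaves v, s ≠ t → s ∉ I.residualReach F t := fun s hs hst =>
    hB.disj s hs t (hl₁ ht) hst s (mem_leaves.1 hs).2 mem_residualReach_self
  have e1 := hB.out' t (hl₁ ht) hv
  have e2 := h.innerCut_of_mem (mem_leaves.1 ht).2 hv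
  have e3 := (hB.flow.mono h.left.2).leaf_le_cut h.left.ne_root ht
    (X := I.residualReach F t) (fun s hs => hleaf s (hl₁ hs))
    (fun q hq hq' => mem_residualReach_of_between hv (h.left.2.trans hq) hq')
  have e4 := (hB.flow.mono h.right.2).le_cut h.right (X := I.residualReach F t) hv
    (fun s hs => hleaf s (hl₂ hs) (hne₂ hs))
  rw [innerCut_down h.right (fun x hx => by
    rw [h.mem_residualReach_cross (mem_leaves.1 ht).2 hx, and_iff_right hv]) hv] at e4
  -- At most `F w₂` units are exchanged between the children; this is the triangle inequality that
  -- becomes an equality.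
  obtain ⟨y', -, hy1, hy2⟩ := (hB.flow v hvv).2 w₁ w₂ h
  have e5 : F w₁ ≤ F v + F w₂ := by omega
  have hpre : I.PreBlocking F w₁ := by
    refine ⟨hB.flow.mono h.left.2, ?_, ?_, ?_⟩
    · exact fun s hs t ht hst x hx => hB.disj s (hl₁ hs) t (hl₁ ht) hst x (h.left.2.trans hx)
    · intro s hs hw
      have hst : s ≠ t := by rintro rfl; exact hw hup.1
      rw [hB.out s (hl₁ hs) (hno s (hl₁ hs) hst),
        h.innerCut_of_notMem (mem_leaves.1 hs).2 (hno s (hl₁ hs) hst), if_neg hw, add_zero]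
    · intro s hs hw
      have hst : s = t := by
        by_contra hst
        exact hB.disj s (hl₁ hs) t (hl₁ ht) hst w₁ h.left.2 hw hup.1
      subst hst
      omega
  refine ⟨hpre, hup.1, hup.2, ⟨hB₂, ?_, ?_⟩, ?_⟩
  · intro hlt s hs x hx hxw hxs
    exact hB.disj s (hl₂ hs) t (hl₁ ht) (hne₂ hs) x (h.right.2.trans hx) hxs
      (hcross hx ((mem_residualReach_child h.right hx).2 ⟨hxw, hlt⟩))
  · intro hlt
    rw [if_pos hlt] at e2 e4
    omega
  · omega

/-- Disjointness of the reached sets is inherited from the two subtrees for terminals that do not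
reach the common vertex. -/
theorem IsNode.disj_of_notMem (h : I.IsNode v w₁ w₂) (h₁ : I.PreBlocking F w₁)
    {s t x : V} (hs : s ∈ I.leaves w₁) (ht : t ∈ I.leaves v)
    (hvs : v ∉ I.residualReach F s) (hvt : v ∉ I.residualReach F t) (hst : s ≠ t)
    (hx : I.IsAncestor v x) (hxs : x ∈ I.residualReach F s) : x ∉ I.residualReach F t := by
  intro hxt
  rcases h.isAncestor_iff.1 hx with rfl | hx₁ | hx₂
  · exact hvs hxs
  · rcases h.mem_leaves_iff.1 ht with ht₁ | ht₂
    · exact h₁.disj s hs t ht₁ hst x hx₁ hxs hxt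
    · exact hvt ((h.symm.mem_residualReach_cross (mem_leaves.1 ht₂).2 hx₁).1 hxt).1
  · exact hvs ((h.mem_residualReach_cross (mem_leaves.1 hs).2 hx₂).1 hxs).1

theorem Blocking.notMem_parent (hB : I.Blocking F w) (h : I.IsParent v w) (ht : t ∈ I.leaves w) :
    v ∉ I.residualReach F t := by
  rw [mem_residualReach_parent h (mem_leaves.1 ht).2]
  rintro ⟨h1, h2⟩
  have := hB.top t ht h1
  omega

theorem IsNode.out_of_notMem (h : I.IsNode v w₁ w₂) (h₁ : I.PreBlocking F w₁)
    (ht : t ∈ I.leaves w₁) (hv : v ∉ I.residualReach F t) :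
    F t = I.innerCut F v (I.residualReach F t) := by
  rw [h.innerCut_of_notMem (mem_leaves.1 ht).2 hv]
  split_ifs with hw
  · exact h₁.out' t ht hw
  · exact h₁.out t ht hw

/-- Blocking on each child edge stops every terminal before `v`, so the reached sets of the two
sides never interact. -/
theorem FlowOn.blocking_of_blocking (hF : I.FlowOn F v) (h : I.IsNode v w₁ w₂)
    (h₁ : I.Blocking F w₁) (h₂ : I.Blocking F w₂) :
    I.Blocking F v ∧ ∀ t ∈ I.leaves v, v ∉ I.residualReach F t := by
  have hno : ∀ t ∈ I.leaves v, v ∉ I.residualReach F t := by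
    intro t ht
    rcases h.mem_leaves_iff.1 ht with ht | ht
    · exact h₁.notMem_parent h.left ht
    · exact h₂.notMem_parent h.right ht
  refine ⟨⟨⟨hF, ?_, ?_, ?_⟩, ?_⟩, hno⟩
  · intro s hs t ht hst x hx hxs
    rcases h.mem_leaves_iff.1 hs with hs' | hs'
    · exact h.disj_of_notMem h₁.toPreBlocking hs' ht (hno s hs) (hno t ht) hst hx hxs
    · exact h.symm.disj_of_notMem h₂.toPreBlocking hs' ht (hno s hs) (hno t ht) hst hx hxs
  · intro t ht hv
    rcases h.mem_leaves_iff.1 ht with ht' | ht'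
    · exact h.out_of_notMem h₁.toPreBlocking ht' hv
    · exact h.symm.out_of_notMem h₂.toPreBlocking ht' hv
  · exact fun t ht hv => absurd hv (hno t ht)
  · exact fun t ht hv => absurd hv (hno t ht)

/-- Only `t` reaches `v`. Its set grows into the sibling subtree exactly as the set reached
downwards from `v`, which is disjoint from the others and contributes `F w₂` to the boundary. -/
theorem Passes.preBlocking (hP : I.Passes F v w₁ w₂ t) (hF : I.FlowOn F v)
    (h : I.IsNode v w₁ w₂) (ht : t ∈ I.leaves w₁) :
    I.PreBlocking F v ∧ v ∈ I.residualReach F t := by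
  have hv : v ∈ I.residualReach F t :=
    (mem_residualReach_parent h.left (mem_leaves.1 ht).2).2 ⟨hP.mem, hP.lt⟩
  have htv : t ∈ I.leaves v := h.mem_leaves_iff.2 (Or.inl ht)
  have hno : ∀ s ∈ I.leaves v, s ≠ t → v ∉ I.residualReach F s := by
    intro s hs hst
    rcases h.mem_leaves_iff.1 hs with hs | hs
    · rw [mem_residualReach_parent h.left (mem_leaves.1 hs).2]
      rintro ⟨hw, -⟩
      exact hP.pre.disj s hs t ht hst w₁ (I.isAncestor_refl _) hw hP.mem
    · exact hP.down.notMem_parent h.right hs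
  have hdt : ∀ s ∈ I.leaves v, s ≠ t → ∀ x, I.IsAncestor v x → x ∈ I.residualReach F s →
      x ∉ I.residualReach F t := by
    intro s hs hst x hx hxs hxt
    have hvs := hno s hs hst
    rcases h.isAncestor_iff.1 hx with rfl | hx₁ | hx₂
    · exact hvs hxs
    · rcases h.mem_leaves_iff.1 hs with hs | hs
      · exact hP.pre.disj s hs t ht hst x hx₁ hxs hxt
      · exact hvs ((h.symm.mem_residualReach_cross (mem_leaves.1 hs).2 hx₁).1 hxs).1
    · rcases h.mem_leaves_iff.1 hs with hs | hs
      · exact hvs ((h.mem_residualReach_cross (mem_leaves.1 hs).2 hx₂).1 hxs).1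
      · have h1 := ((h.mem_residualReach_cross (mem_leaves.1 ht).2 hx₂).1 hxt).2
        have h2 := (mem_residualReach_child h.right hx₂).1 h1
        exact hP.down.down_disj h2.2 s hs x hx₂ h2.1 hxs
  refine ⟨⟨hF, ?_, ?_, ?_⟩, hv⟩
  · intro s hs s' hs' hss x hx hxs
    by_cases hst : s' = t
    · subst hst
      exact hdt s hs hss x hx hxs
    · by_cases hst' : s = t
      · subst hst'
        exact fun hxs' => hdt s' hs' hst x hx hxs' hxs
      · rcases h.mem_leaves_iff.1 hs with hs₁ | hs₂
        · exact h.disj_of_notMem hP.pre hs₁ hs' (hno s hs hst') (hno s' hs' hst) hss hx hxs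
        · exact h.symm.disj_of_notMem hP.down.toPreBlocking hs₂ hs' (hno s hs hst')
            (hno s' hs' hst) hss hx hxs
  · intro s hs hvs
    rcases h.mem_leaves_iff.1 hs with hs' | hs'
    · exact h.out_of_notMem hP.pre hs' hvs
    · exact h.symm.out_of_notMem hP.down.toPreBlocking hs' hvs
  · intro s hs hvs
    have hst : s = t := by
      by_contra hst
      exact hno s hs hst hvs
    subst hst
    have e1 := hP.pre.out' s ht hP.mem
    have e2 := h.innerCut_of_mem (mem_leaves.1 ht).2 hv
    have e3 := hP.eq
    split_ifs at e2 with hlt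
    · have e4 := hP.down.down_val hlt
      omega
    · omega

/-- The boundary of the downward set splits over the children into parts of size at least `F w₁` and
`F w₂`, with total `F v ≤ F w₁ + F w₂`; hence everything is tight and no flow is exchanged at `v`.
-/
theorem DownBlocking.of_node (hD : I.DownBlocking F v) (h : I.IsNode v w₁ w₂)
    (hlt : F v + 2 ≤ I.cap v) :
    I.DownBlocking F w₁ ∧ I.DownBlocking F w₂ ∧ F v = F w₁ + F w₂ := by
  have hvv := I.isAncestor_refl v
  have hself : v ∈ I.residualReach F v := mem_residualReach_self
  have hno : ∀ s ∈ I.leaves v, v ∉ I.residualReach F s := fun s hs =>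
    hD.down_disj hlt s hs v hvv hself
  have e1 := hD.down_val hlt
  rw [h.innerCut_eq, innerCut_down h.left (fun _ _ => Iff.rfl) hself,
    innerCut_down h.right (fun _ _ => Iff.rfl) hself] at e1
  have hleaf : ∀ s ∈ I.leaves v, s ∉ I.residualReach F v := fun s hs hs' =>
    hD.down_disj hlt s hs s (mem_leaves.1 hs).2 hs' mem_residualReach_self
  have e2 := (hD.flow.mono h.left.2).le_cut h.left hself
    (fun s hs => hleaf s (h.mem_leaves_iff.2 (Or.inl hs)))
  have e3 := (hD.flow.mono h.right.2).le_cut h.right hself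
    (fun s hs => hleaf s (h.mem_leaves_iff.2 (Or.inr hs)))
  rw [innerCut_down h.left (fun _ _ => Iff.rfl) hself] at e2
  rw [innerCut_down h.right (fun _ _ => Iff.rfl) hself] at e3
  obtain ⟨y, -, -, hy⟩ := (hD.flow v hvv).2 w₁ w₂ h
  refine ⟨⟨hD.blocking_left h fun s hs => hno s (h.mem_leaves_iff.2 (Or.inl hs)), ?_, ?_⟩,
    ⟨hD.blocking_left h.symm fun s hs => hno s (h.mem_leaves_iff.2 (Or.inr hs)), ?_, ?_⟩,
    by omega⟩
  · exact fun hlt' s hs x hx hxw => hD.down_disj hlt s (h.mem_leaves_iff.2 (Or.inl hs)) x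
      (h.left.2.trans hx) ((mem_residualReach_child h.left hx).2 ⟨hxw, hlt'⟩)
  · intro hlt'
    rw [if_pos hlt'] at e1 e2
    omega
  · exact fun hlt' s hs x hx hxw => hD.down_disj hlt s (h.mem_leaves_iff.2 (Or.inr hs)) x
      (h.right.2.trans hx) ((mem_residualReach_child h.right hx).2 ⟨hxw, hlt'⟩)
  · intro hlt'
    rw [if_pos hlt'] at e1 e3
    omega

theorem FlowOn.downBlocking (hF : I.FlowOn F v) (h : I.IsNode v w₁ w₂)
    (h₁ : I.DownBlocking F w₁) (h₂ : I.DownBlocking F w₂) (heq : F v = F w₁ + F w₂) :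
    I.DownBlocking F v := by
  obtain ⟨hB, hno⟩ := hF.blocking_of_blocking h h₁.toBlocking h₂.toBlocking
  have hself : v ∈ I.residualReach F v := mem_residualReach_self
  refine ⟨hB, ?_, ?_⟩
  · intro _ s hs x hx hxv hxs
    have hvs := hno s hs
    rcases h.isAncestor_iff.1 hx with rfl | hx₁ | hx₂
    · exact hvs hxs
    · have h1 := (mem_residualReach_child h.left hx₁).1 hxv
      rcases h.mem_leaves_iff.1 hs with hs | hs
      · exact h₁.down_disj h1.2 s hs x hx₁ h1.1 hxs
      · exact hvs ((h.symm.mem_residualReach_cross (mem_leaves.1 hs).2 hx₁).1 hxs).1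
    · have h1 := (mem_residualReach_child h.right hx₂).1 hxv
      rcases h.mem_leaves_iff.1 hs with hs | hs
      · exact hvs ((h.mem_residualReach_cross (mem_leaves.1 hs).2 hx₂).1 hxs).1
      · exact h₂.down_disj h1.2 s hs x hx₂ h1.1 hxs
  · intro _
    rw [h.innerCut_eq, innerCut_down h.left (fun _ _ => Iff.rfl) hself,
      innerCut_down h.right (fun _ _ => Iff.rfl) hself, heq]
    congr 1
    · split_ifs with hlt
      · exact h₁.down_val hlt
      · rfl
    · split_ifs with hlt
      · exact h₂.down_val hlt
      · rfl

theorem preBlocking_leaf (hv : v ≠ I.r) (hT : v ∈ I.T) (hF : I.FlowOn F v) :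
    I.PreBlocking F v := by
  refine ⟨hF, ?_, ?_, ?_⟩ <;> rw [leaves_leaf hv hT] <;> simp only [Finset.mem_singleton]
  · rintro s rfl t rfl h
    exact absurd rfl h
  · rintro s rfl h
    exact absurd mem_residualReach_self h
  · rintro s rfl _
    rw [innerCut_leaf hv hT, zero_add]

theorem Blocking.eq_cap_of_leaf (hB : I.Blocking F v) (hT : v ∈ I.T) : F v = I.cap v :=
  hB.top v (mem_leaves.2 ⟨hT, I.isAncestor_refl v⟩) mem_residualReach_self

end Recursion

/-! ### Dependence on the values inside the subtree only. -/

section Congr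

variable {G : V → ℕ}

/-- An edge separating two descendants of `v` lies below `v`. This permits replacing glued functions
by their pieces. -/
theorem residualReach_congr (hFG : ∀ q, I.IsAncestor v q → F q = G q)
    (ht : I.IsAncestor v t) (hx : I.IsAncestor v x) :
    x ∈ I.residualReach F t ↔ x ∈ I.residualReach G t := by
  have key : ∀ {q a b : V}, I.IsAncestor v a → I.IsAncestor v b → I.IsAncestor q a →
      ¬ I.IsAncestor q b → F q = G q := by
    intro q a b ha hb hqa hqb
    apply hFG
    rcases ha.total hqa with h' | h'
    · exact h'
    · exact absurd (h'.trans hb) hqb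
  constructor <;> rintro ⟨h1, h2⟩
  · exact ⟨fun q hq hq' => by rw [← key ht hx hq hq']; exact h1 q hq hq',
      fun q hq hq' => by rw [← key hx ht hq hq']; exact h2 q hq hq'⟩
  · exact ⟨fun q hq hq' => by rw [key ht hx hq hq']; exact h1 q hq hq',
      fun q hq hq' => by rw [key hx ht hq hq']; exact h2 q hq hq'⟩

theorem FlowOn.congr (hF : I.FlowOn F v) (hFG : ∀ q, I.IsAncestor v q → F q = G q) :
    I.FlowOn G v := by
  intro q hq
  obtain ⟨h1, h2⟩ := hF q hq
  refine ⟨by rw [← hFG q hq]; exact h1, fun w₁ w₂ hn => ?_⟩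
  rw [← hFG q hq, ← hFG w₁ (hq.trans hn.left.2), ← hFG w₂ (hq.trans hn.right.2)]
  exact h2 w₁ w₂ hn

variable [Finite V]

theorem innerCut_congr' (h : I.IsParent w v) (hFG : ∀ q, I.IsAncestor v q → F q = G q)
    (ht : I.IsAncestor v t) :
    I.innerCut F v (I.residualReach F t) = I.innerCut G v (I.residualReach G t) := by
  rw [innerCut_congr h.ne_root (fun x hx => residualReach_congr hFG ht hx)]
  classical
  refine Finset.sum_congr rfl fun q hq => ?_
  rw [cutTerm, cutTerm, hFG q (mem_desc.1 (Finset.mem_of_mem_erase hq))]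

theorem PreBlocking.congr (hB : I.PreBlocking F v) (h : I.IsParent w v)
    (hFG : ∀ q, I.IsAncestor v q → F q = G q) : I.PreBlocking G v := by
  have hR : ∀ {t x}, t ∈ I.leaves v → I.IsAncestor v x →
      (x ∈ I.residualReach F t ↔ x ∈ I.residualReach G t) :=
    fun ht hx => residualReach_congr hFG (mem_leaves.1 ht).2 hx
  have hv := I.isAncestor_refl v
  refine ⟨hB.flow.congr hFG, ?_, ?_, ?_⟩
  · intro s hs t ht hst x hx
    rw [← hR hs hx, ← hR ht hx]
    exact hB.disj s hs t ht hst x hx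
  · intro s hs
    rw [← hR hs hv, ← innerCut_congr' h hFG (mem_leaves.1 hs).2, ← hFG s (mem_leaves.1 hs).2]
    exact hB.out s hs
  · intro s hs
    rw [← hR hs hv, ← innerCut_congr' h hFG (mem_leaves.1 hs).2, ← hFG s (mem_leaves.1 hs).2,
      ← hFG v hv]
    exact hB.out' s hs

theorem Blocking.congr (hB : I.Blocking F v) (h : I.IsParent w v)
    (hFG : ∀ q, I.IsAncestor v q → F q = G q) : I.Blocking G v := by
  have hv := I.isAncestor_refl v
  refine ⟨hB.toPreBlocking.congr h hFG, fun t ht => ?_⟩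
  rw [← residualReach_congr hFG (mem_leaves.1 ht).2 hv, ← hFG v hv]
  exact hB.top t ht

theorem DownBlocking.congr (hB : I.DownBlocking F v) (h : I.IsParent w v)
    (hFG : ∀ q, I.IsAncestor v q → F q = G q) : I.DownBlocking G v := by
  have hv := I.isAncestor_refl v
  refine ⟨hB.toBlocking.congr h hFG, ?_, ?_⟩
  · rw [← hFG v hv]
    intro hlt s hs x hx
    rw [← residualReach_congr hFG (mem_leaves.1 hs).2 hx, ← residualReach_congr hFG hv hx]
    exact hB.down_disj hlt s hs x hx
  · rw [← hFG v hv, ← innerCut_congr' h hFG hv]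
    exact hB.down_val

end Congr

end TreeInstance

/-! ### Path decompositions and the local form of feasibility. -/

namespace TreeInstance

variable {V : Type*} [Finite V] {I : TreeInstance V} {F : V → ℕ} {u v w w₁ w₂ t x : V}

theorem leaves_subset (h : I.IsAncestor v w) : I.leaves w ⊆ I.leaves v := fun _ hx =>
  mem_leaves.2 ⟨(mem_leaves.1 hx).1, h.trans (mem_leaves.1 hx).2⟩

theorem IsParent.notMem_leaves {q : V} (h : I.IsParent u v) (hq : I.IsAncestor v q) :
    u ∉ I.leaves q := fun hu => h.not_isAncestor (hq.trans (mem_leaves.1 hu).2)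

-- Every pair separated by the edge above `q` has exactly one end below `q`; listing that end first
-- counts each unordered pair once.
open scoped Classical in
theorem IsParent.sum_pairsThrough (h : I.IsParent u v) (g : Sym2 V → ℕ) {q : V}
    (hq : I.IsAncestor v q) :
    ∑ p ∈ (Set.toFinite (I.pairsThrough u v (I.up q))).toFinset, g p =
      ∑ x ∈ I.leaves q, ∑ y ∈ insert u (I.leaves v) \ I.leaves q, g s(x, y) := by
  have hqr := h.ne_root_of_isAncestor hq
  have hmem : ∀ x, x ∈ I.terminals u v ↔ x ∈ insert u (I.leaves v) := fun x => by
    rw [h.mem_terminals, Finset.mem_insert, mem_leaves]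
  have hlq : ∀ {x}, x ∈ I.terminals u v → I.IsAncestor q x → x ∈ I.leaves q := by
    intro x hx hqx
    rcases h.mem_terminals.1 hx with rfl | hx
    · exact absurd (hq.trans hqx) h.not_isAncestor
    · exact mem_leaves.2 ⟨hx.1, hqx⟩
  rw [← Finset.sum_product']
  symm
  refine Finset.sum_bij (fun p _ => s(p.1, p.2)) ?_ ?_ ?_ (fun _ _ => rfl)
  · rintro ⟨x, y⟩ hp
    rw [Finset.mem_product, Finset.mem_sdiff, ← hmem] at hp
    obtain ⟨hx, hy, hy'⟩ := hp
    have hx' : x ∈ I.terminals u v :=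
      (hmem x).2 (Finset.mem_insert_of_mem (leaves_subset hq hx))
    have hnq : ¬ I.IsAncestor q y := fun hqy => hy' (hlq hy hqy)
    rw [Set.Finite.mem_toFinset]
    refine ⟨x, hx', y, hy, ?_, rfl, (up_mem_pathEdges_iff hqr).2 ?_⟩
    · rintro rfl
      exact hy' hx
    · have := (mem_leaves.1 hx).2
      tauto
  · rintro ⟨x, y⟩ hp ⟨x', y'⟩ hp' he
    rw [Finset.mem_product, Finset.mem_sdiff] at hp hp'
    rcases Sym2.eq_iff.1 he with ⟨h1, h2⟩ | ⟨h1, h2⟩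
    · exact Prod.ext h1 h2
    · simp only at h1 h2 hp hp'
      subst h1
      exact absurd hp.1 hp'.2.2
  · intro p hp
    rw [Set.Finite.mem_toFinset] at hp
    obtain ⟨x, hx, y, hy, -, rfl, hxy⟩ := hp
    rw [up_mem_pathEdges_iff hqr] at hxy
    by_cases hqx : I.IsAncestor q x
    · refine ⟨(x, y), Finset.mem_product.2 ⟨hlq hx hqx, Finset.mem_sdiff.2 ⟨(hmem y).1 hy, ?_⟩⟩, rfl⟩
      intro hy'
      have := (mem_leaves.1 hy').2
      tauto
    · have hqy : I.IsAncestor q y := by tauto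
      refine ⟨(y, x), Finset.mem_product.2 ⟨hlq hy hqy, Finset.mem_sdiff.2 ⟨(hmem x).1 hx, ?_⟩⟩,
        Sym2.eq_swap⟩
      intro hx'
      exact hqx (mem_leaves.1 hx').2

open scoped Classical in
theorem IsParent.isDecomposition_iff (h : I.IsParent u v) {f g : Sym2 V → ℕ} :
    I.IsDecomposition u v f g ↔ ∀ q, I.IsAncestor v q → f (I.up q) =
      ∑ x ∈ I.leaves q, ∑ y ∈ insert u (I.leaves v) \ I.leaves q, g s(x, y) := by
  constructor
  · intro hd q hq
    rw [hd _ (h.mem_subE.2 ⟨q, hq, rfl⟩), h.sum_pairsThrough g hq]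
  · intro hd d hd'
    obtain ⟨q, hq, rfl⟩ := h.mem_subE.1 hd'
    rw [hd q hq, h.sum_pairsThrough g hq]

/-- The amount exchanged at `q` is the total between leaves below one child and leaves below the
other; the rest of each child's flow continues upwards. -/
theorem IsDecomposition.localFlow (h : I.IsParent u v) {f g : Sym2 V → ℕ}
    (hg : I.IsDecomposition u v f g) {q : V} (hq : I.IsAncestor v q) :
    I.LocalFlow (fun q => f (I.up q)) q := by
  classical
  intro q₁ q₂ hn
  rw [h.isDecomposition_iff] at hg
  have key : ∀ {q₁ q₂}, I.IsNode q q₁ q₂ → f (I.up q₁) =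
      ∑ x ∈ I.leaves q₁, ∑ y ∈ insert u (I.leaves v) \ I.leaves q, g s(x, y) +
      ∑ x ∈ I.leaves q₁, ∑ y ∈ I.leaves q₂, g s(x, y) := by
    intro q₁ q₂ hn
    rw [hg q₁ (hq.trans hn.left.2), ← Finset.sum_add_distrib]
    refine Finset.sum_congr rfl fun x _ => ?_
    rw [← Finset.sum_union]
    · refine Finset.sum_congr ?_ fun _ _ => rfl
      ext y
      simp only [Finset.mem_sdiff, Finset.mem_union, hn.mem_leaves_iff, Finset.mem_insert]
      have h1 : y ∈ I.leaves q₂ → y ∈ I.leaves v := fun hy =>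
        leaves_subset (hq.trans hn.right.2) hy
      have h2 : y ∈ I.leaves q₁ → y ∈ I.leaves q₂ → False := fun hy hy' =>
        hn.disjoint (mem_leaves.1 hy).2 (mem_leaves.1 hy').2
      tauto
    · rw [Finset.disjoint_left]
      intro y hy hy'
      exact (Finset.mem_sdiff.1 hy).2 (hn.mem_leaves_iff.2 (Or.inr hy'))
  have e := hg q hq
  rw [hn.sum_leaves] at e
  have e₁ := key hn
  have e₂ := key hn.symm
  have hs : ∑ x ∈ I.leaves q₂, ∑ y ∈ I.leaves q₁, g s(x, y) =
      ∑ x ∈ I.leaves q₁, ∑ y ∈ I.leaves q₂, g s(x, y) := by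
    rw [Finset.sum_comm]
    exact Finset.sum_congr rfl fun x _ => Finset.sum_congr rfl fun y _ => by rw [Sym2.eq_swap]
  exact ⟨∑ x ∈ I.leaves q₁, ∑ y ∈ I.leaves q₂, g s(x, y), by dsimp only; omega,
    by dsimp only; omega, by dsimp only; omega⟩

/-- Greedy: while fewer units are placed than either side offers, some row and some column are
unsaturated, and one more unit fits where they meet. -/
theorem exists_transport {V : Type*} (A B : Finset V) (a b : V → ℕ) (n : ℕ) (ha : n ≤ ∑ x ∈ A, a x)
    (hb : n ≤ ∑ y ∈ B, b y) : ∃ k : V → V → ℕ, (∀ x ∈ A, ∑ y ∈ B, k x y ≤ a x) ∧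
      (∀ y ∈ B, ∑ x ∈ A, k x y ≤ b y) ∧ ∑ x ∈ A, ∑ y ∈ B, k x y = n := by
  classical
  induction n with
  | zero => exact ⟨fun _ _ => 0, by simp, by simp, by simp⟩
  | succ n ih =>
    obtain ⟨k, hka, hkb, hkn⟩ := ih (by omega) (by omega)
    obtain ⟨x₀, hx₀, hx⟩ : ∃ x ∈ A, ∑ y ∈ B, k x y < a x :=
      Finset.exists_lt_of_sum_lt (by omega)
    obtain ⟨y₀, hy₀, hy⟩ : ∃ y ∈ B, ∑ x ∈ A, k x y < b y :=
      Finset.exists_lt_of_sum_lt (by rw [Finset.sum_comm]; omega)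
    have h1 : ∀ x, ∑ y ∈ B, (if x = x₀ ∧ y = y₀ then 1 else 0) = if x = x₀ then 1 else 0 := by
      intro x
      by_cases hx : x = x₀ <;> simp [hx, hy₀]
    have h2 : ∀ y, ∑ x ∈ A, (if x = x₀ ∧ y = y₀ then 1 else 0) = if y = y₀ then 1 else 0 := by
      intro y
      by_cases hy : y = y₀ <;> simp [hy, hx₀]
    refine ⟨fun x y => k x y + if x = x₀ ∧ y = y₀ then 1 else 0, ?_, ?_, ?_⟩
    · intro x hxA
      rw [Finset.sum_add_distrib, h1]
      have := hka x hxA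
      split_ifs with hxx
      · subst hxx; omega
      · omega
    · intro y hyB
      rw [Finset.sum_add_distrib, h2]
      have := hkb y hyB
      split_ifs with hyy
      · subst hyy; omega
      · omega
    · simp only [Finset.sum_add_distrib, h1, hkn]
      simp [hx₀]

-- Here `a x` is what leaf `x` sends out through the top and `m x y` what it exchanges with leaf
-- `y`. At an inner vertex, part of the outgoing amounts of the two sides is matched by a transport
-- plan.
open scoped Classical in
theorem exists_path_decomposition (hr : v ≠ I.r) (hF : ∀ q, I.IsAncestor v q → I.LocalFlow F q) :
    ∃ (a : V → ℕ) (m : V → V → ℕ), (∀ x y, m x y = m y x) ∧ ∀ q, I.IsAncestor v q →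
      F q = ∑ x ∈ I.leaves q, (a x + ∑ y ∈ I.leaves v \ I.leaves q, m x y) := by
  induction v using subtree_induction (I := I) with
  | h v ih =>
  by_cases hT : v ∈ I.T
  · refine ⟨fun _ => F v, fun _ _ => 0, fun _ _ => rfl, fun q hq => ?_⟩
    rw [isAncestor_leaf_iff hr hT] at hq
    subst hq
    simp [leaves_leaf hr hT]
  · obtain ⟨w₁, w₂, hn⟩ := I.exists_isNode hT
    obtain ⟨a₁, m₁, hm₁, h₁⟩ := ih w₁ hn.left hn.left.ne_root
      fun q hq => hF q (hn.left.2.trans hq)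
    obtain ⟨a₂, m₂, hm₂, h₂⟩ := ih w₂ hn.right hn.right.ne_root
      fun q hq => hF q (hn.right.2.trans hq)
    obtain ⟨n, hn₁, hn₂, hnv⟩ := hF v (I.isAncestor_refl v) w₁ w₂ hn
    have e₁ : F w₁ = ∑ x ∈ I.leaves w₁, a₁ x := by simpa using h₁ w₁ (I.isAncestor_refl _)
    have e₂ : F w₂ = ∑ x ∈ I.leaves w₂, a₂ x := by simpa using h₂ w₂ (I.isAncestor_refl _)
    obtain ⟨k, hk₁, hk₂, hkn⟩ := exists_transport (I.leaves w₁) (I.leaves w₂) a₁ a₂ n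
      (e₁ ▸ hn₁) (e₂ ▸ hn₂)
    have hd : ∀ {x}, x ∈ I.leaves w₁ → x ∉ I.leaves w₂ := fun h h' =>
      hn.disjoint (mem_leaves.1 h).2 (mem_leaves.1 h').2
    have hd' : ∀ {x}, x ∈ I.leaves w₂ → x ∉ I.leaves w₁ := fun h h' => hd h' h
    -- A leaf still sends upwards what the plan `k` leaves of its former amount; pairs across `v`
    -- receive the entries of `k`.
    refine ⟨fun x => if x ∈ I.leaves w₁ then a₁ x - ∑ y ∈ I.leaves w₂, k x y
        else a₂ x - ∑ z ∈ I.leaves w₁, k z x,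
      fun x y => if x ∈ I.leaves w₁ then if y ∈ I.leaves w₁ then m₁ x y else k x y
        else if y ∈ I.leaves w₁ then k y x else m₂ x y, ?_, ?_⟩
    · intro x y
      dsimp only
      rw [hm₁ x y, hm₂ x y]
      split_ifs <;> rfl
    · have hsd : ∀ {w₁ w₂ q}, I.IsNode v w₁ w₂ → I.IsAncestor w₁ q → ∀ h : V → ℕ,
          ∑ y ∈ I.leaves v \ I.leaves q, h y =
          ∑ y ∈ I.leaves w₁ \ I.leaves q, h y + ∑ y ∈ I.leaves w₂, h y := by
        intro w₁ w₂ q hn hq h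
        have hd : ∀ {x}, x ∈ I.leaves w₁ → x ∉ I.leaves w₂ := fun h h' =>
          hn.disjoint (mem_leaves.1 h).2 (mem_leaves.1 h').2
        rw [← Finset.sum_union]
        · refine Finset.sum_congr ?_ fun _ _ => rfl
          ext y
          simp only [Finset.mem_sdiff, Finset.mem_union, hn.mem_leaves_iff]
          have := @hd y
          have := @leaves_subset _ _ _ _ _ hq y
          tauto
        · rw [Finset.disjoint_left]
          exact fun y hy => hd (Finset.mem_sdiff.1 hy).1
      intro q hq
      rcases hn.isAncestor_iff.1 hq with rfl | hq | hq
      · simp only [Finset.sdiff_self, Finset.sum_empty, add_zero]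
        rw [hn.sum_leaves, Finset.sum_congr rfl fun x hx => if_pos hx,
          Finset.sum_congr (g := fun x => a₂ x - ∑ z ∈ I.leaves w₁, k z x) rfl
            fun x hx => if_neg (hd' hx)]
        have s₁ : ∑ x ∈ I.leaves w₁, (a₁ x - ∑ y ∈ I.leaves w₂, k x y) + n = F w₁ := by
          rw [e₁, ← hkn, ← Finset.sum_add_distrib]
          exact Finset.sum_congr rfl fun x hx => Nat.sub_add_cancel (hk₁ x hx)
        have s₂ : ∑ x ∈ I.leaves w₂, (a₂ x - ∑ z ∈ I.leaves w₁, k z x) + n = F w₂ := by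
          rw [e₂, ← hkn, Finset.sum_comm, ← Finset.sum_add_distrib]
          exact Finset.sum_congr rfl fun x hx => Nat.sub_add_cancel (hk₂ x hx)
        omega
      · rw [h₁ q hq]
        refine Finset.sum_congr rfl fun x hx => ?_
        have hx₁ := leaves_subset hq hx
        rw [hsd hn hq]
        simp only [hx₁, if_true]
        rw [Finset.sum_congr rfl fun y hy => if_pos (Finset.mem_sdiff.1 hy).1,
          Finset.sum_congr (s₁ := I.leaves w₂) rfl fun y hy => if_neg (hd' hy)]
        have := hk₁ x hx₁
        have h3 : (I.leaves w₂).sum (k x) = ∑ y ∈ I.leaves w₂, k x y := rfl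
        have h4 : (I.leaves w₁ \ I.leaves q).sum (m₁ x) =
          ∑ y ∈ I.leaves w₁ \ I.leaves q, m₁ x y := rfl
        omega
      · rw [h₂ q hq]
        refine Finset.sum_congr rfl fun x hx => ?_
        have hx₂ := leaves_subset hq hx
        rw [hsd hn.symm hq]
        simp only [hd' hx₂, if_false]
        rw [Finset.sum_congr rfl fun y hy => if_neg (hd' (Finset.mem_sdiff.1 hy).1),
          Finset.sum_congr (s₁ := I.leaves w₁) rfl fun y hy => if_pos hy]
        have := hk₂ x hx₂
        have h4 : (I.leaves w₂ \ I.leaves q).sum (m₂ x) =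
          ∑ y ∈ I.leaves w₂ \ I.leaves q, m₂ x y := rfl
        omega

/-- Decomposability is a local condition at the inner vertices; in the converse the outgoing amounts
are assigned to pairs with `u`. -/
theorem IsParent.isFeasibleFlow_iff (h : I.IsParent u v) {f : Sym2 V → ℕ} :
    I.IsFeasibleFlow u v f ↔ I.FlowOn (fun q => f (I.up q)) v := by
  classical
  constructor
  · rintro ⟨⟨g, hg⟩, hc⟩ q hq
    exact ⟨hc _ (h.mem_subE.2 ⟨q, hq, rfl⟩), hg.localFlow h hq⟩
  · intro hF
    refine ⟨?_, fun d hd => ?_⟩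
    · obtain ⟨a, m, hm, ham⟩ := exists_path_decomposition h.ne_root fun q hq => (hF q hq).2
      let g : Sym2 V → ℕ := Sym2.lift ⟨fun x y => if x = u then a y else if y = u then a x
        else m x y, fun x y => by
          by_cases hx : x = u <;> by_cases hy : y = u <;> simp [hx, hy, hm x y]⟩
      refine ⟨g, h.isDecomposition_iff.2 fun q hq => ?_⟩
      refine (ham q hq).trans (Finset.sum_congr rfl fun x hx => ?_)
      have hu := h.notMem_leaves hq
      have huv := h.notMem_leaves (I.isAncestor_refl v)
      have hxu : x ≠ u := by rintro rfl; exact hu hx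
      rw [Finset.insert_sdiff_of_notMem _ hu, Finset.sum_insert (by simp [huv])]
      congr 1
      · simp [g, hxu]
      · refine Finset.sum_congr rfl fun y hy => ?_
        have hyu : y ≠ u := by rintro rfl; exact huv (Finset.mem_sdiff.1 hy).1
        simp [g, hxu, hyu]
    · obtain ⟨q, hq, rfl⟩ := h.mem_subE.1 hd
      exact (hF q hq).1

end TreeInstance

/-! ### Connectivity of reached sets, outside components, and cut parity. -/

namespace TreeInstance

variable {V : Type*} {I : TreeInstance V} {F : V → ℕ} {u v w s t x q : V}

theorem mem_residualReach_par (h : I.IsParent w q) (hx : ¬ I.IsAncestor q x)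
    (hq : q ∈ I.residualReach F x) : w ∈ I.residualReach F x := by
  refine ⟨fun z hz hz' => hq.1 z hz fun hzq => ?_, fun z hz hz' => hq.2 z (hz.trans h.2) hz'⟩
  rcases h.isAncestor_iff.1 hzq with rfl | hzw
  · exact hx hz
  · exact hz' hzw

theorem IsParent.par_mem_subV (h : I.IsParent u v) (hq : I.IsAncestor v q) :
    I.par q ∈ I.subV u v := by
  have hp := isParent_par (I := I) (h.ne_root_of_isAncestor hq)
  rcases hp.isAncestor_iff.1 hq with rfl | hq
  · exact Or.inl h.par_eq
  · exact Or.inr hq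

/-- One spare unit would let the set climb to `w`; and if `q` is not above `s`, it was entered
through `w` in the first place. -/
theorem residual_up_eq (h : I.IsParent w q) (hF : F q ≤ I.cap q) (hq : q ∈ I.residualReach F s)
    (hw : w ∉ I.residualReach F s) : F q = I.cap q := by
  by_cases hqs : I.IsAncestor q s
  · rw [mem_residualReach_parent h hqs] at hw
    by_contra hne
    exact hw ⟨hq, by omega⟩
  · exact absurd (mem_residualReach_par h hqs hq) hw

theorem residual_down_le (h : I.IsParent w q) (hq : q ∉ I.residualReach F s)
    (hw : w ∈ I.residualReach F s) : I.cap q ≤ F q + 1 := by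
  by_contra hlt
  apply hq
  refine ⟨fun z hz hz' => hw.1 z hz fun hzw => hz' (hzw.trans h.2), fun z hz hz' => ?_⟩
  rcases h.isAncestor_iff.1 hz with rfl | hz
  · change F z + 2 ≤ I.cap z
    omega
  · exact hw.2 z hz hz'

/-- The set reached from a terminal of `I(e)` induces a connected subgraph. -/
theorem reach_connected (h : I.IsParent u v) (ht : I.IsAncestor v t) :
    (I.G.induce (I.subV u v ∩ I.residualReach F t)).Connected := by
  set X := I.subV u v ∩ I.residualReach F t with hX
  have htX : t ∈ X := ⟨Or.inr ht, mem_residualReach_self⟩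
  -- Ancestors of `t` in the set are joined to `t` along the ascending path; any other member then
  -- hangs from its parent, which is again in the set.
  have hup : ∀ y (hy : y ∈ X), I.IsAncestor y t →
      (I.G.induce X).Reachable ⟨t, htX⟩ ⟨y, hy⟩ := by
    have key : ∀ z, I.IsAncestor z t → ∀ y (hy : y ∈ X), I.IsAncestor y z →
        (hz : z ∈ X) → (I.G.induce X).Reachable ⟨z, hz⟩ ⟨y, hy⟩ := by
      intro z
      induction z using I.root_induction with
      | h0 =>
        intro _ y hy hyr hz
        have := I.isAncestor_root.1 hyr
        subst this
        rfl
      | h1 p q hpq ih =>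
        intro hqt y hy hyq hq
        rcases hpq.isAncestor_iff.1 hyq with rfl | hyp
        · rfl
        · have hp : p ∈ X := by
            refine ⟨?_, mem_residualReach_of_between hy.2 hyp (hpq.2.trans hqt)⟩
            rcases hy.1 with rfl | hvy
            · rcases (hpq.2.trans hqt).total ht with hpv | hvp
              · rcases h.isAncestor_iff.1 hpv with rfl | hpu
                · exact Or.inr (I.isAncestor_refl _)
                · exact Or.inl (hpu.antisymm hyp)
              · exact Or.inr hvp
            · exact Or.inr (hvy.trans hyp)
          refine SimpleGraph.Reachable.trans ?_ (ih (hpq.2.trans hqt) y hy hyp hp)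
          exact SimpleGraph.Adj.reachable (by simpa using hpq.1.symm)
    exact fun y hy hyt => key t (I.isAncestor_refl t) y hy hyt htX
  have hall : ∀ y (hy : y ∈ X), (I.G.induce X).Reachable ⟨t, htX⟩ ⟨y, hy⟩ := by
    intro y
    induction y using I.root_induction with
    | h0 => exact fun hy => hup _ hy (I.root_isAncestor t)
    | h1 p q hpq ih =>
      intro hq
      by_cases hqt : I.IsAncestor q t
      · exact hup q hq hqt
      · have hp : p ∈ X := by
          refine ⟨?_, mem_residualReach_par hpq hqt hq.2⟩
          rcases hq.1 with rfl | hvq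
          · exact absurd (h.2.trans ht) hqt
          · rw [← hpq.par_eq]
            exact h.par_mem_subV hvq
        refine (ih hp).trans (SimpleGraph.Adj.reachable ?_)
        simpa using hpq.1
  have : Nonempty X := ⟨⟨t, htX⟩⟩
  exact ⟨fun a b => (hall a.1 a.2).symm.trans (hall b.1 b.2)⟩

section Components

variable (I u v) in
/-- The vertices of `I(e)` outside the cut-system `X`. -/
def outside (X : V → Set V) : Set V := I.subV u v \ ⋃ t ∈ I.subT u v, X t

variable (I u v) in
/-- The component of the vertices outside the cut-system `X` that contains `q`. -/
def compOf (X : V → Set V) (q : V) : Set V :=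
  {x | ∃ (hq : q ∈ I.outside u v X) (hx : x ∈ I.outside u v X),
    (I.G.induce (I.outside u v X)).Reachable ⟨q, hq⟩ ⟨x, hx⟩}

variable {X : V → Set V}

theorem isComponent_iff {W : Set V} :
    I.IsComponent u v X W ↔ ∃ q ∈ I.outside u v X, W = I.compOf u v X q := by
  have key : ∀ (q : V) (hq : q ∈ I.outside u v X), Subtype.val ''
      ((I.G.induce (I.outside u v X)).connectedComponentMk ⟨q, hq⟩).supp = I.compOf u v X q := by
    intro q hq
    ext x
    constructor
    · rintro ⟨⟨x, hx⟩, hxC, rfl⟩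
      exact ⟨hq, hx, (SimpleGraph.ConnectedComponent.exact hxC).symm⟩
    · rintro ⟨_, hx, hr⟩
      exact ⟨⟨x, hx⟩, SimpleGraph.ConnectedComponent.sound hr.symm, rfl⟩
  constructor
  · rintro ⟨C, rfl⟩
    induction C using SimpleGraph.ConnectedComponent.ind with
    | h a => exact ⟨a.1, a.2, key a.1 a.2⟩
  · rintro ⟨q, hq, rfl⟩
    exact ⟨_, (key q hq).symm⟩

theorem compOf_eq (h : x ∈ I.compOf u v X q) : I.compOf u v X x = I.compOf u v X q := by
  obtain ⟨hq, hx, hr⟩ := h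
  ext y
  constructor
  · rintro ⟨_, hy, hr'⟩
    exact ⟨hq, hy, hr.trans hr'⟩
  · rintro ⟨_, hy, hr'⟩
    exact ⟨hx, hy, hr.symm.trans hr'⟩

theorem self_mem_compOf (hq : q ∈ I.outside u v X) : q ∈ I.compOf u v X q := ⟨hq, hq, by rfl⟩

theorem mem_compOf_of_adj (hx : x ∈ I.compOf u v X q) (hw : w ∈ I.outside u v X)
    (h : I.G.Adj x w) : w ∈ I.compOf u v X q := by
  obtain ⟨hq, hx', hr⟩ := hx
  exact ⟨hq, hw, hr.trans (SimpleGraph.Adj.reachable (by simpa using h))⟩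

/-- A component that contains `y` but not the parent of `y` lies below `y`. -/
theorem isAncestor_of_mem_compOf (h : I.IsParent w q) (hw : w ∉ I.compOf u v X q)
    (hx : x ∈ I.compOf u v X q) : I.IsAncestor q x := by
  obtain ⟨hq, hx', ⟨p⟩⟩ := hx
  have key : ∀ (a b : I.outside u v X) (_ : (I.G.induce (I.outside u v X)).Walk a b),
      a.1 ∈ I.compOf u v X q → (I.IsAncestor q a.1 ↔ I.IsAncestor q b.1) := by
    intro a b p
    induction p with
    | nil => exact fun _ => Iff.rfl
    | @cons a b c hab p ih =>
      intro ha
      have hab' : I.G.Adj a.1 b.1 := by simpa using hab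
      have hb := mem_compOf_of_adj ha b.2 hab'
      refine Iff.trans (isAncestor_iff_of_adj hab' ?_) (ih hb)
      rw [h.up_eq]
      intro he
      rcases Sym2.eq_iff.1 he with ⟨h1, h2⟩ | ⟨h1, h2⟩
      · exact hw (h1 ▸ ha)
      · exact hw (h2 ▸ hb)
  exact (key _ _ p (self_mem_compOf hq)).1 (I.isAncestor_refl q)

end Components

variable [Finite V]

theorem IsParent.cutValue_eq_cutTerm (h : I.IsParent u v) (f : Sym2 V → ℕ) (X : Set V) :
    I.cutValue u v f X = I.cutTerm (fun q => f (I.up q)) X v +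
      I.innerCut (fun q => f (I.up q)) v X := by
  classical
  rw [h.cutValue_eq, innerCut, ← Finset.add_sum_erase (I.desc v) _ (mem_desc.2 (I.isAncestor_refl v))]
  simp only [cutTerm]

theorem IsParent.cutValue_eq_sum (h : I.IsParent u v) (f : Sym2 V → ℕ) (X : Set V) :
    I.cutValue u v f X = ∑ q ∈ I.desc v, I.cutTerm (fun q => f (I.up q)) X q := by
  rw [h.cutValue_eq]
  rfl

theorem IsParent.cutValue_inter (h : I.IsParent u v) (f : Sym2 V → ℕ) (X : Set V) :
    I.cutValue u v f (I.subV u v ∩ X) = I.cutValue u v f X := by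
  rw [h.cutValue_eq_sum, h.cutValue_eq_sum]
  refine Finset.sum_congr rfl fun q hq => cutTerm_congr ?_ ?_
  · exact ⟨fun h => h.2, fun h => ⟨Or.inr (mem_desc.1 hq), h⟩⟩
  · exact ⟨fun h => h.2, fun h' => ⟨h.par_mem_subV (mem_desc.1 hq), h'⟩⟩

-- Add up the even sums of the three values at the inner vertices in `X`: edges inside `X` count
-- twice. The summand for `u` makes the top edge count, modulo 2, exactly when `v ∈ X`.
open scoped Classical in
theorem FlowOn.even_cut (hF : I.FlowOn F v) (h : I.IsParent u v) {X : Set V}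
    (hX : ∀ s ∈ I.leaves v, s ∉ X) :
    Even (I.cutTerm F X v + I.innerCut F v X + if u ∈ X then F v else 0) := by
  -- Modulo 2, an edge's cut contribution is the sum of its contributions at its two ends.
  have hcut : ∀ {p z}, I.IsParent p z → ∃ k, I.cutTerm F X z + (if p ∈ X then F z else 0) =
      (if z ∈ X then F z else 0) + 2 * k := by
    intro p z hpz
    rw [cutTerm, hpz.par_eq]
    by_cases h1 : p ∈ X <;> by_cases h2 : z ∈ X
    · exact ⟨0, by simp [h1, h2]⟩
    · exact ⟨F z, by simp [h1, h2]; ring⟩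
    · exact ⟨0, by simp [h1, h2]⟩
    · exact ⟨0, by simp [h1, h2]⟩
  induction v using subtree_induction (I := I) generalizing u with
  | h v ih =>
    obtain ⟨k, hk⟩ := hcut h
    by_cases hT : v ∈ I.T
    · have := hX v (mem_leaves.2 ⟨hT, I.isAncestor_refl v⟩)
      rw [innerCut_leaf h.ne_root hT, add_zero, hk, if_neg this]
      exact ⟨k, by ring⟩
    · obtain ⟨w₁, w₂, hn⟩ := I.exists_isNode hT
      obtain ⟨k₁, h₁⟩ := ih w₁ hn.left (hF.mono hn.left.2) hn.left
        (fun s hs => hX s (hn.mem_leaves_iff.2 (Or.inl hs)))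
      obtain ⟨k₂, h₂⟩ := ih w₂ hn.right (hF.mono hn.right.2) hn.right
        (fun s hs => hX s (hn.mem_leaves_iff.2 (Or.inr hs)))
      obtain ⟨y, -, -, hy⟩ := (hF v (I.isAncestor_refl v)).2 w₁ w₂ hn
      rw [hn.innerCut_eq]
      rw [Nat.even_iff]
      split_ifs at * <;> omega

end TreeInstance

/-! ### Odd components and the recursive form of blocking flows. -/

namespace TreeInstance

variable {V : Type*} {I : TreeInstance V} {f : Sym2 V → ℕ} {F : V → ℕ}
  {u v w s t x q : V}

theorem IsParent.down_le_of_reach (h : I.IsParent u v) (hq : I.IsAncestor v q)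
    (hqs : q ∉ I.reach u v f s) (hps : I.par q ∈ I.reach u v f s) :
    I.cap q ≤ f (I.up q) + 1 := by
  rw [reach_eq] at hqs hps
  have hp := isParent_par (I := I) (h.ne_root_of_isAncestor hq)
  exact residual_down_le (F := fun q => f (I.up q)) hp (fun h' => hqs ⟨Or.inr hq, h'⟩) hps.2

variable [Finite V]

theorem IsParent.mem_subT_iff_mem_leaves (h : I.IsParent u v) :
    t ∈ I.subT u v ↔ t ∈ I.leaves v := by
  rw [h.mem_subT, mem_leaves]

theorem Blocking.isCutSystem (hB : I.Blocking (fun q => f (I.up q)) v) (h : I.IsParent u v) :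
    I.IsCutSystem u v (I.reach u v f) := by
  constructor
  · intro t ht
    rw [h.mem_subT_iff_mem_leaves] at ht
    rw [reach_eq]
    refine ⟨Set.inter_subset_left, ?_, reach_connected h (mem_leaves.1 ht).2⟩
    ext x
    constructor
    · rintro ⟨⟨-, hx⟩, hx'⟩
      rcases h.mem_terminals.1 hx' with rfl | hx'
      · exact absurd hx (hB.notMem_parent h ht)
      · by_contra hne
        exact hB.disj x (mem_leaves.2 hx') t ht hne x hx'.2 mem_residualReach_self hx
    · rintro rfl
      exact ⟨⟨Or.inr (mem_leaves.1 ht).2, mem_residualReach_self⟩,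
        h.mem_terminals.2 (Or.inr (mem_leaves.1 ht))⟩
  · intro s hs t ht hst
    rw [h.mem_subT_iff_mem_leaves] at hs ht
    rw [Function.onFun, Set.disjoint_left]
    intro x hx hx'
    rw [reach_eq] at hx hx'
    rcases hx.1 with rfl | hvx
    · exact hB.notMem_parent h hs hx.2
    · exact hB.disj s hs t ht hst x hvx hx.2 hx'.2

theorem cutValue_reach (h : I.IsParent u v) (hu : u ∉ I.residualReach (fun q => f (I.up q)) t) :
    I.cutValue u v f (I.reach u v f t) =
      I.innerCut (fun q => f (I.up q)) v (I.residualReach (fun q => f (I.up q)) t) +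
      open scoped Classical in
      if v ∈ I.residualReach (fun q => f (I.up q)) t then f (I.up v) else 0 := by
  rw [reach_eq, h.cutValue_inter, h.cutValue_eq_cutTerm, cutTerm, h.par_eq, add_comm]
  congr 1
  split_ifs <;> tauto

section

variable (hB : I.Blocking (fun q => f (I.up q)) v) (h : I.IsParent u v)
include hB h

theorem Blocking.up_eq_of_reach (hq : I.IsAncestor v q)
    (hqs : q ∈ I.reach u v f s) (hps : I.par q ∉ I.reach u v f s) : f (I.up q) = I.cap q := by
  rw [reach_eq] at hqs hps
  have hp := isParent_par (I := I) (h.ne_root_of_isAncestor hq)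
  exact residual_up_eq (F := fun q => f (I.up q)) hp (hB.flow q hq).1 hqs.2
    fun h' => hps ⟨h.par_mem_subV hq, h'⟩

/-- The component contains no leaf below `v` and not `u`, so the flow through its boundary is even.
Its other boundary edges rise from reached sets and are full; the parity of its capacity is that of
the slack above `q`. -/
theorem Blocking.odd_cutValue_iff (hq : I.IsAncestor v q)
    (hqo : q ∈ I.outside u v (I.reach u v f))
    (hp : I.par q ∉ I.compOf u v (I.reach u v f) q) :
    Odd (I.cutValue u v I.c (I.compOf u v (I.reach u v f) q)) ↔
      Odd (I.cap q - f (I.up q)) := by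
  classical
  set W := I.compOf u v (I.reach u v f) q with hW
  have hpar := isParent_par (I := I) (h.ne_root_of_isAncestor hq)
  have hbelow : ∀ x ∈ W, I.IsAncestor q x := fun x hx => isAncestor_of_mem_compOf hpar hp hx
  have hWo : W ⊆ I.outside u v (I.reach u v f) := fun x hx => hx.2.1
  have hno : ∀ s ∈ I.leaves v, s ∉ W := by
    intro s hs hsW
    apply (hWo hsW).2
    refine Set.mem_biUnion (h.mem_subT_iff_mem_leaves.2 hs) ?_
    rw [reach_eq]
    exact ⟨Or.inr (mem_leaves.1 hs).2, mem_residualReach_self⟩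
  have huW : u ∉ W := fun hu => h.not_isAncestor (hq.trans (hbelow u hu))
  have heven := hB.flow.even_cut h hno
  rw [if_neg huW, add_zero, ← h.cutValue_eq_cutTerm] at heven
  have hqq := self_mem_compOf hqo
  -- Capacity and flow differ on the boundary of `W` only at the edge above its top vertex `q`.
  have hsum : I.cutValue u v I.c W = I.cutValue u v f W + (I.cap q - f (I.up q)) := by
    have : (I.cap q - f (I.up q)) =
        ∑ z ∈ I.desc v, if z = q then I.cap q - f (I.up q) else 0 := by
      rw [Finset.sum_ite_eq' (I.desc v) q, if_pos (mem_desc.2 hq)]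
    rw [h.cutValue_eq_sum, h.cutValue_eq_sum, this, ← Finset.sum_add_distrib]
    refine Finset.sum_congr rfl fun z hz => ?_
    rw [mem_desc] at hz
    have hzp := isParent_par (I := I) (h.ne_root_of_isAncestor hz)
    have hle := (hB.flow q hq).1
    by_cases hzq : z = q
    · subst hzq
      rw [cutTerm, cutTerm, if_neg (by tauto), if_neg (by tauto), if_pos rfl]
      exact (Nat.add_sub_cancel' hle).symm
    · rw [if_neg hzq, add_zero, cutTerm, cutTerm]
      by_cases hzW : z ∈ W
      · by_cases hpW : I.par z ∈ W
        · simp [hzW, hpW]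
        · rw [hW, ← compOf_eq hzW] at hpW
          have hqz : q ∈ I.compOf u v (I.reach u v f) z := by
            rw [compOf_eq hzW]; exact hqq
          exact absurd ((isAncestor_of_mem_compOf hzp hpW hqz).antisymm (hbelow z hzW)) hzq
      · by_cases hpW : I.par z ∈ W
        · have hzo : z ∉ I.outside u v (I.reach u v f) := fun hzo =>
            hzW (mem_compOf_of_adj hpW hzo hzp.1)
          have hex : ∃ s ∈ I.subT u v, z ∈ I.reach u v f s := by
            by_contra hcon
            refine hzo ⟨Or.inr hz, fun hzU => ?_⟩
            obtain ⟨s, hs, hzs⟩ := Set.mem_iUnion₂.1 hzU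
            exact hcon ⟨s, hs, hzs⟩
          obtain ⟨s, hs, hzs⟩ := hex
          have := hB.up_eq_of_reach h hz hzs
            fun hps => (hWo hpW).2 (Set.mem_biUnion hs hps)
          rw [this]
          rfl
        · simp [hzW, hpW]
  rw [hsum, Nat.odd_add]
  constructor
  · intro h1
    by_contra h2
    exact (Nat.not_odd_iff_even.2 heven) (h1.2 (Nat.not_odd_iff_even.1 h2))
  · intro h1
    exact iff_of_false (Nat.not_odd_iff_even.2 heven) (Nat.not_even_iff_odd.2 h1)

/-- Upward boundary edges are full and downward ones lack at most one unit, so the total slack is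
the number of edges lacking one. Each of those leads to an odd component and every odd component
arises once. -/
theorem Blocking.cutValue_reach_eq (ht : t ∈ I.leaves v) :
    I.cutValue u v I.c (I.reach u v f t) = I.cutValue u v f (I.reach u v f t) +
      (I.oddSets u v (I.reach u v f) t).ncard := by
  classical
  set X := I.reach u v f with hX
  -- These are the top vertices of the odd components below the set of `t`; the fullness of edges
  -- leaving another reached set keeps them out of all reached sets.
  set S : Finset V := (I.desc v).filter
    fun q => q ∉ X t ∧ I.par q ∈ X t ∧ f (I.up q) + 1 = I.cap q with hS
  have hpar : ∀ {q}, I.IsAncestor v q → I.IsParent (I.par q) q := fun hq =>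
    isParent_par (h.ne_root_of_isAncestor hq)
  have hmemS : ∀ {q}, q ∈ S ↔ I.IsAncestor v q ∧ q ∉ X t ∧ I.par q ∈ X t ∧
      f (I.up q) + 1 = I.cap q := by
    intro q; rw [hS, Finset.mem_filter, mem_desc]
  have htT := h.mem_subT_iff_mem_leaves.2 ht
  have hcut := hB.isCutSystem h
  have hout : ∀ {x}, x ∈ X t → ∀ {q}, x ∉ I.compOf u v X q := fun hx q hxq =>
    hxq.2.1.2 (Set.mem_biUnion htT hx)
  have hSo : ∀ {q}, q ∈ S → q ∈ I.outside u v X := by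
    intro q hq
    obtain ⟨h1, h2, h3, h4⟩ := hmemS.1 hq
    refine ⟨Or.inr h1, fun hU => ?_⟩
    obtain ⟨s, hs, hqs⟩ := Set.mem_iUnion₂.1 hU
    have hst : s ≠ t := by rintro rfl; exact h2 hqs
    have := hB.up_eq_of_reach h h1 hqs fun hps =>
      Set.disjoint_left.1 (hcut.2 hs htT hst) hps h3
    omega
  have hcard : (I.oddSets u v X t).ncard = S.card := by
    have himg : I.oddSets u v X t = I.compOf u v X '' S := by
      ext W
      constructor
      · rintro ⟨hW, hodd, x, y, hxy, ⟨hxW, hyW⟩, hxt, hyt⟩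
        obtain ⟨q, hq, rfl⟩ := isComponent_iff.1 hW
        rw [← compOf_eq hyW] at hodd hxW ⊢
        have hyo : y ∈ I.outside u v X := hyW.2.1
        have hvy : I.IsAncestor v y := by
          rcases hyo.1 with rfl | hvy
          · have hx : x ∈ I.subV y v := by
              rw [hX, reach_eq] at hxt
              exact hxt.1
            rcases hx with rfl | hx
            · exact absurd rfl hxy.1.ne
            · exact absurd (IsAncestor.trans hx hxy.2) h.not_isAncestor
          · exact hvy
        refine ⟨y, ?_, rfl⟩
        rw [← hxy.par_eq] at hxt hxW
        rw [hX] at hodd hxW hyo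
        rw [hB.odd_cutValue_iff h hvy hyo hxW] at hodd
        have hle := h.down_le_of_reach hvy hyt hxt
        have := hodd.pos
        exact hmemS.2 ⟨hvy, hyt, hxt, by omega⟩
      · rintro ⟨q, hq, rfl⟩
        have hqo := hSo hq
        obtain ⟨h1, h2, h3, h4⟩ := hmemS.1 hq
        refine ⟨isComponent_iff.2 ⟨q, hqo, rfl⟩, ?_, I.par q, q, hpar h1,
          ⟨hout h3, self_mem_compOf hqo⟩, h3, h2⟩
        rw [hX, hB.odd_cutValue_iff h h1 hqo (hout h3), ← h4, Nat.add_sub_cancel_left]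
        exact odd_one
    rw [himg, Set.InjOn.ncard_image, Set.ncard_coe_finset]
    intro q hq q' hq' he
    have hq₁ := hmemS.1 hq
    have hq₂ := hmemS.1 hq'
    have e1 : q' ∈ I.compOf u v X q := by
      have := self_mem_compOf (hSo hq')
      rwa [← he] at this
    have e2 : q ∈ I.compOf u v X q' := by
      have := self_mem_compOf (hSo hq)
      rwa [he] at this
    exact (isAncestor_of_mem_compOf (hpar hq₁.1) (hout hq₁.2.2.1) e1).antisymm
      (isAncestor_of_mem_compOf (hpar hq₂.1) (hout hq₂.2.2.1) e2)
  rw [hcard, h.cutValue_eq_sum, h.cutValue_eq_sum, hS, Finset.card_filter,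
    ← Finset.sum_add_distrib]
  refine Finset.sum_congr rfl fun q hq => ?_
  rw [mem_desc] at hq
  have hle : f (I.up q) ≤ I.cap q := (hB.flow q hq).1
  rw [cutTerm, cutTerm]
  by_cases hqX : q ∈ X t
  · by_cases hpX : I.par q ∈ X t
    · simp [hqX, hpX]
    · have := hB.up_eq_of_reach h hq hqX hpX
      simp only [hqX, hpX, this]
      simp [cap]
  · by_cases hpX : I.par q ∈ X t
    · have := h.down_le_of_reach hq hqX hpX
      simp only [hqX, hpX]
      unfold cap at *
      by_cases he : f (I.up q) + 1 = I.c (I.up q)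
      · simp [he]
      · simp [he]; omega
    · simp [hqX, hpX]

end

/-- The recursive description of blocking flows. -/
theorem IsParent.isBlocking_iff (h : I.IsParent u v) :
    I.IsBlocking u v f ↔ I.Blocking (fun q => f (I.up q)) v := by
  have hinc : ∀ {t}, t ∈ I.leaves v → ∀ d, d ∈ I.G.incidenceSet t ↔ d = I.up t := fun ht d =>
    incidenceSet_leaf (h.ne_root_of_isAncestor (mem_leaves.1 ht).2) (mem_leaves.1 ht).1
  constructor
  · rintro ⟨hf, hcut, hblk⟩
    rw [h.isFeasibleFlow_iff] at hf
    have hu : ∀ t ∈ I.leaves v, u ∉ I.residualReach (fun q => f (I.up q)) t := by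
      intro t ht hut
      -- The upper end `u` is itself a terminal of `I(e)`, so a `t`-set with `t ≠ u` excludes it.
      have hmem : u ∈ I.reach u v f t ∩ I.terminals u v := by
        rw [reach_eq]
        exact ⟨⟨Or.inl rfl, hut⟩, h.mem_terminals.2 (Or.inl rfl)⟩
      rw [(hcut.1 t (h.mem_subT_iff_mem_leaves.2 ht)).2.1] at hmem
      rw [Set.mem_singleton_iff.1 hmem] at h
      exact h.not_isAncestor (mem_leaves.1 ht).2
    have hval : ∀ t ∈ I.leaves v, f (I.up t) =
        I.innerCut (fun q => f (I.up q)) v (I.residualReach (fun q => f (I.up q)) t) +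
        open scoped Classical in
        if v ∈ I.residualReach (fun q => f (I.up q)) t then f (I.up v) else 0 := by
      intro t ht
      rw [← cutValue_reach h (hu t ht)]
      exact (hblk t (h.mem_subT_iff_mem_leaves.2 ht)).1 _ ((hinc ht _).2 rfl)
    refine ⟨⟨hf, ?_, ?_, ?_⟩, ?_⟩
    · intro s hs t ht hst x hx hxs hxt
      have := hcut.2 (h.mem_subT_iff_mem_leaves.2 hs) (h.mem_subT_iff_mem_leaves.2 ht) hst
      rw [Function.onFun, reach_eq, reach_eq] at this
      exact Set.disjoint_left.1 this ⟨Or.inr hx, hxs⟩ ⟨Or.inr hx, hxt⟩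
    · intro s hs hv
      have := hval s hs
      rwa [if_neg hv, add_zero] at this
    · intro s hs hv
      have := hval s hs
      rwa [if_pos hv] at this
    · intro t ht hv
      have h1 := hu t ht
      rw [mem_residualReach_parent h (mem_leaves.1 ht).2] at h1
      have h2 := (hf v (I.isAncestor_refl v)).1
      dsimp only at h1 h2 ⊢
      by_contra hne
      exact h1 ⟨hv, by omega⟩
  · intro hB
    refine ⟨h.isFeasibleFlow_iff.2 hB.flow, hB.isCutSystem h, fun t ht => ?_⟩
    rw [h.mem_subT_iff_mem_leaves] at ht
    refine ⟨fun d hd => ?_, ?_⟩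
    · rw [hinc ht] at hd
      subst hd
      rw [cutValue_reach h (hB.notMem_parent h ht)]
      split_ifs with hv
      · exact hB.out' t ht hv
      · exact hB.out t ht hv
    · rw [hB.cutValue_reach_eq h ht]
      push_cast
      ring

end TreeInstance

/-! ### Arithmetic of parity intervals. -/

theorem mem_parityInterval {a b x : ℕ} :
    x ∈ parityInterval a b ↔ a ≤ x ∧ x ≤ b ∧ (x - a) % 2 = 0 := by
  constructor
  · rintro ⟨i, rfl, h⟩
    omega
  · rintro ⟨h1, h2, h3⟩
    exact ⟨(x - a) / 2, by omega, h2⟩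

/-- With nonempty intervals the two domination cases exclude each other, so the order of testing is
immaterial. -/
theorem tildeLower_comm {a₁ b₁ a₂ b₂ : ℕ} (h₁ : a₁ ≤ b₁) (h₂ : a₂ ≤ b₂) :
    tildeLower a₁ b₁ a₂ b₂ = tildeLower a₂ b₂ a₁ b₁ := by
  unfold tildeLower
  rw [add_comm a₂ a₁]
  split_ifs <;> omega

theorem exists_tildeLower_add {a₁ b₁ a₂ b₂ k₁ k₂ : ℕ} (h₁ : b₁ = a₁ + 2 * k₁)
    (h₂ : b₂ = a₂ + 2 * k₂) : ∃ k, b₁ + b₂ = tildeLower a₁ b₁ a₂ b₂ + 2 * k := by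
  refine ⟨(b₁ + b₂ - tildeLower a₁ b₁ a₂ b₂) / 2, ?_⟩
  unfold tildeLower
  simp only [Nat.even_iff]
  split_ifs <;> omega

/-- The lower end is attained by cancelling as much as possible. From there every further value up
to the sum of the upper ends is reached in steps of 2. -/
theorem otimes_parityInterval {a₁ b₁ a₂ b₂ k₁ k₂ : ℕ} (h₁ : b₁ = a₁ + 2 * k₁)
    (h₂ : b₂ = a₂ + 2 * k₂) : otimes (parityInterval a₁ b₁) (parityInterval a₂ b₂) =
      parityInterval (tildeLower a₁ b₁ a₂ b₂) (b₁ + b₂) := by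
  ext x
  constructor
  · rintro ⟨α, hα, β, hβ, i, hi, hx⟩
    rw [mem_parityInterval] at hα hβ ⊢
    rw [le_min_iff] at hi
    unfold tildeLower
    simp only [Nat.even_iff]
    split_ifs <;> omega
  · rintro ⟨j, rfl, hj⟩
    simp only [otimes, Set.mem_ofPred_eq, mem_parityInterval, le_min_iff]
    induction j with
    | zero =>
      unfold tildeLower at *
      simp only [Nat.even_iff] at *
      split_ifs with c1 c2 c3
      · exact ⟨a₁, by omega, b₂, by omega, b₂, by omega, by omega⟩
      · exact ⟨b₁, by omega, a₂, by omega, b₁, by omega, by omega⟩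
      -- With equal parity and neither side dominating, both intervals contain the larger lower end
      -- and it cancels completely; with opposite parity the closest values differ by 1.
      · exact ⟨max a₁ a₂, by omega, max a₁ a₂, by omega, max a₁ a₂, by omega, by omega⟩
      · rcases le_total a₁ a₂ with hle | hle
        · exact ⟨a₂ - 1, by omega, a₂, by omega, a₂ - 1, by omega, by omega⟩
        · exact ⟨a₁, by omega, a₁ - 1, by omega, a₁ - 1, by omega, by omega⟩
    | succ j ih =>
      obtain ⟨α, hα, β, hβ, i, hi, hx⟩ := ih (by omega)
      -- To gain 2, cancel one unit less; when nothing cancels, raise a summand that is not yet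
      -- maximal.
      by_cases hi0 : i = 0
      · by_cases hα' : α + 2 ≤ b₁
        · exact ⟨α + 2, by omega, β, hβ, 0, by omega, by omega⟩
        · exact ⟨α, hα, β + 2, by omega, 0, by omega, by omega⟩
      · exact ⟨α, hα, β, hβ, i - 1, by omega, by omega⟩

theorem updateLower_le {a c : ℕ} : updateLower a c ≤ a ∧ updateLower a c ≤ c := by
  unfold updateLower
  split_ifs <;> omega

theorem sInf_parityInterval {a b k : ℕ} (h : b = a + 2 * k) : sInf (parityInterval a b) = a := by
  have ha : a ∈ parityInterval a b := mem_parityInterval.2 (by omega)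
  exact le_antisymm (Nat.sInf_le ha) (le_csInf ⟨a, ha⟩ fun x hx => (mem_parityInterval.1 hx).1)

theorem sSup_parityInterval {a b k : ℕ} (h : b = a + 2 * k) : sSup (parityInterval a b) = b := by
  have hb : b ∈ parityInterval a b := mem_parityInterval.2 (by omega)
  exact le_antisymm (csSup_le ⟨b, hb⟩ fun x hx => (mem_parityInterval.1 hx).2.1)
    (le_csSup ⟨b, fun x hx => (mem_parityInterval.1 hx).2.1⟩ hb)

/-! ### Values of blocking flows, dominating paths, and maximal flows. -/

namespace TreeInstance

variable {V : Type*} {I : TreeInstance V} {F : V → ℕ} {p u v w w₁ w₂ s t x q : V}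

-- Possible because a non-root vertex is determined by its parent edge; it returns from vertex
-- functions to functions on edges.
variable (I) in
theorem exists_edge_function (F : V → ℕ) : ∃ f : Sym2 V → ℕ, ∀ q, q ≠ I.r → f (I.up q) = F q := by
  classical
  refine ⟨fun d => if h : ∃ q, q ≠ I.r ∧ d = I.up q then F h.choose else 0, fun q hq => ?_⟩
  have h : ∃ q', q' ≠ I.r ∧ I.up q = I.up q' := ⟨q, hq, rfl⟩
  dsimp only
  rw [dif_pos h, ← up_injective hq h.choose_spec.1 h.choose_spec.2]

variable [Finite V]


theorem IsParent.mem_Psi (h : I.IsParent u v) {x : ℕ} :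
    x ∈ I.Psi u v ↔ ∃ F, I.Blocking F v ∧ F v = x := by
  constructor
  · rintro ⟨f, hf, rfl⟩
    exact ⟨_, h.isBlocking_iff.1 hf, by rw [h.up_eq]⟩
  · rintro ⟨F, hF, rfl⟩
    obtain ⟨f, hf⟩ := I.exists_edge_function F
    refine ⟨f, h.isBlocking_iff.2 (hF.congr h fun q hq =>
      (hf q (h.ne_root_of_isAncestor hq)).symm), ?_⟩
    rw [← h.up_eq, hf v h.ne_root]

variable (I) in
/-- Condition (a) holds for all edges below `v`. -/
def RegularBelow (v : V) : Prop := ∀ x y, I.IsParent x y → I.IsAncestor v x → I.CondA x y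

theorem RegularBelow.child (h : I.RegularBelow v) (hw : I.IsParent v w) : I.RegularBelow w :=
  fun x y hxy hx => h x y hxy (hw.2.trans hx)

theorem RegularBelow.condA (h : I.RegularBelow v) (hw : I.IsParent v w) : I.CondA v w :=
  h v w hw (I.isAncestor_refl v)

theorem CondA.lo_le_hi (h : I.CondA u v) : I.lo u v ≤ I.hi u v := by
  obtain ⟨k, hk⟩ := h.1
  omega

theorem CondA.bounds (h : I.CondA u v) (huv : I.IsParent u v) (hB : I.Blocking F v) :
    I.lo u v ≤ F v ∧ F v ≤ I.hi u v ∧ (F v - I.lo u v) % 2 = 0 := by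
  have := huv.mem_Psi.2 ⟨F, hB, rfl⟩
  rwa [h.2.1, mem_parityInterval] at this

theorem CondA.exists_hi (h : I.CondA u v) (huv : I.IsParent u v) :
    ∃ F, I.Blocking F v ∧ F v = I.hi u v := by
  obtain ⟨k, hk⟩ := h.1
  rw [← huv.mem_Psi, h.2.1, mem_parityInterval]
  omega

theorem CondA.hi_le_cap (h : I.CondA u v) (huv : I.IsParent u v) : I.hi u v ≤ I.cap v := by
  obtain ⟨F, hF, hv⟩ := h.exists_hi huv
  have := (hF.flow v (I.isAncestor_refl v)).1
  omega

theorem CondA.leaf (h : I.CondA u v) (huv : I.IsParent u v) (hT : v ∈ I.T) :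
    I.lo u v = I.cap v ∧ I.hi u v = I.cap v := by
  rw [cap, huv.up_eq]
  exact h.2.2.1 hT

theorem CondA.node (h : I.CondA u v) (huv : I.IsParent u v) (hn : I.IsNode v w₁ w₂) :
    I.tildeA v w₁ w₂ ≤ I.tildeB v w₁ w₂ ∧
      I.lo u v = updateLower (I.tildeA v w₁ w₂) (I.cap v) ∧
      I.hi u v = updateUpper (I.tildeA v w₁ w₂) (I.tildeB v w₁ w₂) (I.cap v) := by
  rw [cap, huv.up_eq]
  obtain ⟨⟨k, hk⟩, -, -, -, h5, h6⟩ := h.2.2.2 hn.not_mem_T w₁ w₂ hn.left hn.right hn.ne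
  exact ⟨by omega, h5, h6⟩

theorem IsNode.isDominating_iff (hn : I.IsNode v w₁ w₂) :
    I.IsDominating v w₁ ↔ I.hi v w₂ + 2 ≤ I.lo v w₁ := by
  constructor
  · rintro ⟨-, w, hw, hne, h⟩
    rcases hn.eq_or_eq hw with rfl | rfl
    · exact absurd rfl hne
    · exact h
  · exact fun h => ⟨hn.left, w₂, hn.right, hn.ne.symm, h⟩

theorem IsNode.tildeA_of_dominating (hn : I.IsNode v w₁ w₂) (h : I.IsDominating v w₁) :
    I.tildeA v w₁ w₂ = I.lo v w₁ - I.hi v w₂ := by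
  rw [tildeA, tildeLower, if_pos (hn.isDominating_iff.1 h)]

theorem RegularBelow.tildeA_comm (hR : I.RegularBelow v) (hn : I.IsNode v w₁ w₂) :
    I.tildeA v w₁ w₂ = I.tildeA v w₂ w₁ :=
  tildeLower_comm (hR.condA hn.left).lo_le_hi (hR.condA hn.right).lo_le_hi

theorem IsNode.isDominating_of_two_le (hn : I.IsNode v w₁ w₂) (h : 2 ≤ I.tildeA v w₁ w₂) :
    I.IsDominating v w₁ ∨ I.IsDominating v w₂ := by
  rw [hn.isDominating_iff, hn.symm.isDominating_iff]
  rw [tildeA, tildeLower] at h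
  split_ifs at h <;> omega

theorem RegularBelow.not_isDominating (hR : I.RegularBelow v) (hn : I.IsNode v w₁ w₂)
    (h₁ : I.IsDominating v w₁) : ¬ I.IsDominating v w₂ := by
  rw [hn.isDominating_iff] at h₁
  rw [hn.symm.isDominating_iff]
  have := (hR.condA hn.left).lo_le_hi
  have := (hR.condA hn.right).lo_le_hi
  omega

theorem isDominatingPath_iff (h : I.IsAncestor v t) :
    I.IsDominatingPath v t ↔
      ∀ x y, I.IsParent x y → I.IsAncestor v x → I.IsAncestor y t → I.IsDominating x y := by
  constructor
  · intro hP x y hxy hvx hyt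
    have hmem : I.up y ∈ I.pathEdges v t := mem_pathEdges_iff.2 ⟨y, rfl, fun h' =>
      hxy.not_isAncestor ((h'.2 hyt).trans hvx)⟩
    obtain ⟨p, q, he, hd⟩ := hP _ hmem
    rw [← hd.1.up_eq] at he
    have := up_injective hxy.ne_root hd.1.ne_root he
    subst this
    rwa [hxy.unique hd.1]
  · intro hP d hd
    obtain ⟨q, rfl, hq⟩ := mem_pathEdges_iff.1 hd
    have hqt : I.IsAncestor q t := by
      by_contra hqt
      exact hq (iff_of_false (fun h' => hqt (h'.trans h)) hqt)
    have hqv : ¬ I.IsAncestor q v := fun h' => hq (iff_of_true h' hqt)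
    have hp := isParent_par (I := I) (q := q) (by rintro rfl; exact hqv (I.root_isAncestor v))
    refine ⟨I.par q, q, rfl, hP _ _ hp ?_ hqt⟩
    rcases h.total hqt with h' | h'
    · rcases hp.isAncestor_iff.1 h' with rfl | h'
      · exact absurd h' hqv
      · exact h'
    · exact absurd h' hqv

theorem isDominatingPath_self : I.IsDominatingPath v v := by
  rw [isDominatingPath_iff (I.isAncestor_refl v)]
  exact fun x y hxy hvx hyv => absurd (hyv.trans hvx) hxy.not_isAncestor

theorem IsParent.isDominatingPath_iff (h : I.IsParent v w) (ht : I.IsAncestor w t) :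
    I.IsDominatingPath v t ↔ I.IsDominating v w ∧ I.IsDominatingPath w t := by
  rw [TreeInstance.isDominatingPath_iff (h.2.trans ht), TreeInstance.isDominatingPath_iff ht]
  constructor
  · intro hP
    exact ⟨hP v w h (I.isAncestor_refl v) ht, fun x y hxy hx => hP x y hxy (h.2.trans hx)⟩
  · rintro ⟨hd, hP⟩ x y hxy hx hy
    rcases hx.eq_or_exists_child with rfl | ⟨w', hw', hwx⟩
    · rwa [h.eq_of_isAncestor hxy ht hy] at hd
    · have : w = w' := h.eq_of_isAncestor hw' ht (hwx.trans (hxy.2.trans hy))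
      subst this
      exact hP x y hxy hwx hy

/-- Two sibling edges cannot both be dominating, so the way down is forced at each vertex. -/
theorem RegularBelow.dominatingPath_unique (hR : I.RegularBelow v) (hv : v ≠ I.r)
    (hs : s ∈ I.leaves v) (ht : t ∈ I.leaves v) (h₁ : I.IsDominatingPath v s)
    (h₂ : I.IsDominatingPath v t) : s = t := by
  induction v using subtree_induction (I := I) with
  | h v ih =>
    by_cases hT : v ∈ I.T
    · rw [leaves_leaf hv hT, Finset.mem_singleton] at hs ht
      rw [hs, ht]
    · have key : ∀ {w₁ w₂}, I.IsNode v w₁ w₂ → s ∈ I.leaves w₁ → s = t := by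
        intro w₁ w₂ hn hs'
        rw [hn.left.isDominatingPath_iff (mem_leaves.1 hs').2] at h₁
        rcases hn.mem_leaves_iff.1 ht with ht' | ht'
        · rw [hn.left.isDominatingPath_iff (mem_leaves.1 ht').2] at h₂
          exact ih w₁ hn.left (hR.child hn.left) hn.left.ne_root hs' ht' h₁.2 h₂.2
        · rw [hn.right.isDominatingPath_iff (mem_leaves.1 ht').2] at h₂
          exact absurd h₂.1 (hR.not_isDominating hn h₁.1)
      obtain ⟨w₁, w₂, hn⟩ := I.exists_isNode hT
      rcases hn.mem_leaves_iff.1 hs with h | h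
      · exact key hn h
      · exact key hn.symm h

/-- A lower end of at least 2 does not come from the parity cases, so some child edge dominates; its
own lower end is again at least 2, and the descent continues to a leaf. -/
theorem RegularBelow.exists_dominatingPath (hR : I.RegularBelow v) (huv : I.IsParent u v)
    (hA : I.CondA u v) (h : 2 ≤ I.lo u v) : ∃ t ∈ I.leaves v, I.IsDominatingPath v t := by
  induction v using subtree_induction (I := I) generalizing u with
  | h v ih =>
    by_cases hT : v ∈ I.T
    · exact ⟨v, mem_leaves.2 ⟨hT, I.isAncestor_refl v⟩, isDominatingPath_self⟩
    · have key : ∀ {w₁ w₂}, I.IsNode v w₁ w₂ → I.IsDominating v w₁ →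
          ∃ t ∈ I.leaves v, I.IsDominatingPath v t := by
        intro w₁ w₂ hn hd
        have := hn.isDominating_iff.1 hd
        obtain ⟨t, ht, hP⟩ := ih w₁ hn.left (hR.child hn.left) hn.left (hR.condA hn.left)
          (by omega)
        exact ⟨t, hn.mem_leaves_iff.2 (Or.inl ht),
          (hn.left.isDominatingPath_iff (mem_leaves.1 ht).2).2 ⟨hd, hP⟩⟩
      obtain ⟨w₁, w₂, hn⟩ := I.exists_isNode hT
      have h1 := (hA.node huv hn).2.1
      have h2 := (updateLower_le (a := I.tildeA v w₁ w₂) (c := I.cap v)).1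
      rcases hn.isDominating_of_two_le (by omega) with h | h
      · exact key hn h
      · exact key hn.symm h

/-- With slack at least 2, both children are down-blocking and their values add up, so by induction
the value is `b̃`. With smaller slack the value is already as large as capacity and parity permit.
-/
theorem DownBlocking.eq_hi (hD : I.DownBlocking F v) (huv : I.IsParent u v)
    (hR : I.RegularBelow v) (hA : I.CondA u v) : F v = I.hi u v := by
  induction v using subtree_induction (I := I) generalizing u with
  | h v ih =>
    have h1 := hA.bounds huv hD.toBlocking
    by_cases hlt : F v + 2 ≤ I.cap v
    · have hT : v ∉ I.T := fun hT => by
        have := hD.toBlocking.eq_cap_of_leaf hT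
        omega
      obtain ⟨w₁, w₂, hn⟩ := I.exists_isNode hT
      obtain ⟨h₁, h₂, he⟩ := hD.of_node hn hlt
      have e₁ := ih w₁ hn.left h₁ hn.left (hR.child hn.left) (hR.condA hn.left)
      have e₂ := ih w₂ hn.right h₂ hn.right (hR.child hn.right) (hR.condA hn.right)
      obtain ⟨h3, -, h4⟩ := hA.node huv hn
      have h5 : F v = I.tildeB v w₁ w₂ := by rw [tildeB, ← e₁, ← e₂, he]
      unfold updateUpper at h4
      split_ifs at h4 <;> omega
    -- The value and the maximum both lie in `{cap - 1, cap}` and have the same parity.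
    · have h2 := hA.hi_le_cap huv
      obtain ⟨k, hk⟩ := hA.1
      omega

/-- If the maximum leaves slack at least 2, it is `b̃`, untouched by the capacity. Attaining it
requires both children to attain their maxima with nothing exchanged at `v`. -/
theorem Blocking.downBlocking_of_eq_hi (hB : I.Blocking F v) (huv : I.IsParent u v)
    (hR : I.RegularBelow v) (hA : I.CondA u v) (h : F v = I.hi u v) : I.DownBlocking F v := by
  induction v using subtree_induction (I := I) generalizing u with
  | h v ih =>
    by_cases hlt : F v + 2 ≤ I.cap v
    · have hT : v ∉ I.T := fun hT => by
        have := hB.eq_cap_of_leaf hT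
        omega
      have hno : ∀ t ∈ I.leaves v, v ∉ I.residualReach F t := fun t ht hv => by
        have := hB.top t ht hv
        omega
      obtain ⟨w₁, w₂, hn⟩ := I.exists_isNode hT
      have hB₁ := hB.blocking_left hn fun s hs => hno s (hn.mem_leaves_iff.2 (Or.inl hs))
      have hB₂ := hB.blocking_left hn.symm fun s hs => hno s (hn.mem_leaves_iff.2 (Or.inr hs))
      have h₁ := (hR.condA hn.left).bounds hn.left hB₁
      have h₂ := (hR.condA hn.right).bounds hn.right hB₂
      obtain ⟨h3, -, h4⟩ := hA.node huv hn
      obtain ⟨y, -, -, hy⟩ := (hB.flow v (I.isAncestor_refl v)).2 w₁ w₂ hn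
      -- Truncation by the capacity would leave the maximum at `cap` or `cap - 1`, against the slack
      -- assumed here.
      have h5 : I.hi u v = I.hi v w₁ + I.hi v w₂ := by
        change _ = I.tildeB v w₁ w₂
        unfold updateUpper at h4
        split_ifs at h4 <;> omega
      exact hB.flow.downBlocking hn
        (ih w₁ hn.left hB₁ hn.left (hR.child hn.left) (hR.condA hn.left) (by omega))
        (ih w₂ hn.right hB₂ hn.right (hR.child hn.right) (hR.condA hn.right) (by omega))
        (by omega)
    · exact ⟨hB, fun h' => absurd h' hlt, fun h' => absurd h' hlt⟩

open scoped Classical in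
variable (I) in
/-- The total flow on the edges that hang off the path from `v` down to `t`. -/
noncomputable def sideSum (F : V → ℕ) (v t : V) : ℕ :=
  ∑ q ∈ (I.desc v).erase v, if ¬ I.IsAncestor q t ∧ I.IsAncestor (I.par q) t then F q else 0

theorem sideSum_leaf (hv : v ≠ I.r) (hT : v ∈ I.T) : I.sideSum F v t = 0 := by
  simp [sideSum, desc_leaf hv hT]

theorem IsNode.sideSum_eq (hn : I.IsNode v w₁ w₂) (ht : I.IsAncestor w₁ t) :
    I.sideSum F v t = F w₂ + I.sideSum F w₁ t := by
  classical
  have hw₂ : ∀ {q}, I.IsAncestor w₂ q → ¬ I.IsAncestor q t := fun hq hqt =>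
    hn.disjoint ht (hq.trans hqt)
  rw [sideSum, hn.sum_erase_desc, ← Finset.add_sum_erase (I.desc w₁) _
    (mem_desc.2 (I.isAncestor_refl w₁)), if_neg (by simp [ht]), zero_add, add_comm, sideSum]
  congr 1
  · rw [Finset.sum_eq_single w₂]
    · rw [if_pos ⟨hw₂ (I.isAncestor_refl w₂), by rw [hn.right.par_eq]; exact hn.left.2.trans ht⟩]
    · intro q hq hne
      rw [mem_desc] at hq
      rw [if_neg]
      rintro ⟨-, h⟩
      have hp := isParent_par (I := I) (hn.right.ne_root_of_isAncestor hq)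
      rcases hp.isAncestor_iff.1 hq with rfl | hq
      · exact hne rfl
      · exact hw₂ hq h
    · exact fun h => absurd (mem_desc.2 (I.isAncestor_refl w₂)) h

end TreeInstance

/-! ### Terminals that reach the top, lowering along dominating paths, and decomposition bounds. -/

namespace TreeInstance

variable {V : Type*} {I : TreeInstance V} {F G : V → ℕ} {p u v w w₁ w₂ s t x q : V}

theorem IsParent.one_le_cap (h : I.IsParent u v) : 1 ≤ I.cap v := by
  rw [cap, h.up_eq]
  exact I.one_le_c _ h.1

variable [Finite V]


/-- If a terminal reaches `v`, then it is the end of the dominating path from `v`, and all flow that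
hangs off this path goes to it. -/
theorem PreBlocking.dominating_of_reach (hB : I.PreBlocking F v) (hR : I.RegularBelow v)
    (hv : v ≠ I.r) (ht : t ∈ I.leaves v) (hvt : v ∈ I.residualReach F t) (h1 : 1 ≤ F v) :
    I.IsDominatingPath v t ∧ F t = F v + I.sideSum F v t ∧
      ∀ w₁ w₂, I.IsNode v w₁ w₂ → F v < I.tildeA v w₁ w₂ := by
  induction v using subtree_induction (I := I) with
  | h v ih =>
    by_cases hT : v ∈ I.T
    · rw [leaves_leaf hv hT, Finset.mem_singleton] at ht
      subst ht
      exact ⟨isDominatingPath_self, by rw [sideSum_leaf hv hT, add_zero],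
        fun w₁ w₂ hn => absurd hT hn.not_mem_T⟩
    · have key : ∀ {w₁ w₂}, I.IsNode v w₁ w₂ → t ∈ I.leaves w₁ →
          I.IsDominatingPath v t ∧ F t = F v + I.sideSum F v t ∧ F v < I.tildeA v w₁ w₂ := by
        intro w₁ w₂ hn ht₁
        have hP := hB.passes hn ht₁ hvt
        have heq := hP.eq
        have hlt := hP.lt
        obtain ⟨i1, i2, i3⟩ := ih w₁ hn.left hP.pre (hR.child hn.left) hn.left.ne_root ht₁ hP.mem
          (by omega)
        have hA := hR.condA hn.left
        -- The lower end is the minimum of `ã` and the capacity, and `F w₁` is below both: the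
        -- former by induction, the latter because `t` passes through this edge.
        have hlo : F w₁ < I.lo v w₁ := by
          by_cases hT₁ : w₁ ∈ I.T
          · rwa [(hA.leaf hn.left hT₁).1]
          · obtain ⟨z₁, z₂, hz⟩ := I.exists_isNode hT₁
            have := i3 z₁ z₂ hz
            rw [(hA.node hn.left hz).2.1, updateLower]
            split_ifs <;> omega
        have hhi := hP.down.eq_hi hn.right (hR.child hn.right) (hR.condA hn.right)
        -- `lo v w₁ > F v + hi v w₂` with `F v ≥ 1` gives the gap of 2 in the definition of
        -- domination.
        have hdom : I.IsDominating v w₁ := hn.isDominating_iff.2 (by omega)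
        refine ⟨(hn.left.isDominatingPath_iff (mem_leaves.1 ht₁).2).2 ⟨hdom, i1⟩, ?_, ?_⟩
        · rw [hn.sideSum_eq (mem_leaves.1 ht₁).2]
          omega
        · rw [hn.tildeA_of_dominating hdom]
          omega
      obtain ⟨w₁, w₂, hn⟩ := I.exists_isNode hT
      have hall : ∀ z₁ z₂, I.IsNode v z₁ z₂ → I.IsDominatingPath v t ∧
          F t = F v + I.sideSum F v t ∧ F v < I.tildeA v z₁ z₂ := by
        intro z₁ z₂ hz
        rcases hz.mem_leaves_iff.1 ht with h | h
        · exact key hz h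
        · rw [hR.tildeA_comm hz]
          exact key hz.symm h
      exact ⟨(hall w₁ w₂ hn).1, (hall w₁ w₂ hn).2.1, fun z₁ z₂ hz => (hall z₁ z₂ hz).2.2⟩

/-- The dichotomy behind all inductions below: the flow splits at `v`, or a terminal gets to `v` and
is stopped by a full top edge. -/
theorem Blocking.cases (hB : I.Blocking F v) (hn : I.IsNode v w₁ w₂) :
    (I.Blocking F w₁ ∧ I.Blocking F w₂) ∨
      ∃ t ∈ I.leaves v, v ∈ I.residualReach F t ∧ F v = I.cap v := by
  by_cases h : ∃ t ∈ I.leaves v, v ∈ I.residualReach F t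
  · obtain ⟨t, ht, hv⟩ := h
    exact Or.inr ⟨t, ht, hv, hB.top t ht hv⟩
  · push Not at h
    exact Or.inl ⟨hB.blocking_left hn fun s hs => h s (hn.mem_leaves_iff.2 (Or.inl hs)),
      hB.blocking_left hn.symm fun s hs => h s (hn.mem_leaves_iff.2 (Or.inr hs))⟩

/-- In a blocking flow the amount that the end `t` of the dominating path sends to the top is at
least `min ã c`. -/
theorem Blocking.min_add_sideSum_le (hB : I.Blocking F v) (hR : I.RegularBelow v)
    (huv : I.IsParent u v) (ht : t ∈ I.leaves v) (hP : I.IsDominatingPath v t)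
    (hn : I.IsNode v w₁ w₂) :
    min (I.tildeA v w₁ w₂) (I.cap v) + I.sideSum F v t ≤ F t := by
  induction v using subtree_induction (I := I) generalizing u w₁ w₂ with
  | h v ih =>
    have key : ∀ {w₁ w₂}, I.IsNode v w₁ w₂ → t ∈ I.leaves w₁ →
        min (I.tildeA v w₁ w₂) (I.cap v) + I.sideSum F v t ≤ F t := by
      intro w₁ w₂ hn ht₁
      rcases hB.cases hn with ⟨h₁, h₂⟩ | ⟨t', ht', hvt', htop⟩
      · obtain ⟨hd, hP₁⟩ := (hn.left.isDominatingPath_iff (mem_leaves.1 ht₁).2).1 hP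
        have hA := hR.condA hn.left
        have hlo : I.lo v w₁ + I.sideSum F w₁ t ≤ F t := by
          by_cases hT : w₁ ∈ I.T
          · rw [leaves_leaf hn.left.ne_root hT, Finset.mem_singleton] at ht₁
            subst ht₁
            rw [sideSum_leaf hn.left.ne_root hT, (hA.leaf hn.left hT).1, add_zero,
              h₁.eq_cap_of_leaf hT]
          · obtain ⟨z₁, z₂, hz⟩ := I.exists_isNode hT
            have h3 := ih w₁ hn.left h₁ (hR.child hn.left) hn.left ht₁ hP₁ hz
            have h4 := updateLower_le (a := I.tildeA w₁ z₁ z₂) (c := I.cap w₁)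
            rw [(hA.node hn.left hz).2.1]
            omega
        have h5 := (hR.condA hn.right).bounds hn.right h₂
        have h6 := hn.isDominating_iff.1 hd
        rw [hn.sideSum_eq (mem_leaves.1 ht₁).2, hn.tildeA_of_dominating hd]
        omega
      -- Positive capacity makes the full top edge carry at least one unit, and uniqueness of the
      -- dominating path identifies `t'` with `t`.
      · have hc := huv.one_le_cap
        obtain ⟨h1, h2, -⟩ :=
          hB.dominating_of_reach hR hn.ne_root ht' hvt' (by omega)
        have := hR.dominatingPath_unique hn.ne_root ht ht' hP h1
        subst this
        omega
    rcases hn.mem_leaves_iff.1 ht with h | h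
    · exact key hn h
    · rw [hR.tildeA_comm hn]
      exact key hn.symm h

/-- Gluing at an inner vertex that is reached by a terminal below `w₁`. -/
theorem IsNode.preBlocking_of_reach (hn : I.IsNode v w₁ w₂) (ht : t ∈ I.leaves w₁)
    (h₁ : I.PreBlocking F w₁) (hmem : w₁ ∈ I.residualReach F t) (hlt : F w₁ < I.cap w₁)
    (h₂ : I.DownBlocking F w₂) (heq : F w₁ = F v + F w₂) (hc : F v ≤ I.cap v) :
    I.PreBlocking F v ∧ v ∈ I.residualReach F t :=
  Passes.preBlocking ⟨h₁, hmem, hlt, h₂, heq⟩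
    (hn.flowOn hc ⟨F w₂, by omega, le_rfl, by omega⟩ h₁.flow h₂.flow) hn ht

/-- Along the path to `t` each lower value is the upper one plus the sibling's, so values only grow
downwards. -/
theorem PreBlocking.le_of_reach (hB : I.PreBlocking F v) (hv : v ≠ I.r) (ht : t ∈ I.leaves v)
    (hvt : v ∈ I.residualReach F t) (hvq : I.IsAncestor v q) (hqt : I.IsAncestor q t) :
    F v ≤ F q := by
  induction v using subtree_induction (I := I) with
  | h v ih =>
    rcases hvq.eq_or_exists_child with rfl | ⟨w, hw, hwq⟩
    · rfl
    · obtain ⟨w₁, w₂, hn⟩ := I.exists_isNode (hw.not_mem_T hv)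
      have key : ∀ {w'}, I.IsNode v w w' → F v ≤ F q := by
        intro w' hn
        have ht' : t ∈ I.leaves w := mem_leaves.2 ⟨(mem_leaves.1 ht).1, hwq.trans hqt⟩
        have hP := hB.passes hn ht' hvt
        have h1 := ih w hw hP.pre hw.ne_root ht' hP.mem hwq
        have h2 := hP.eq
        omega
      rcases hn.eq_or_eq hw with rfl | rfl
      · exact key hn
      · exact key hn.symm

/-- Decreasing a flow along the path to a terminal that reaches `v`. -/
theorem PreBlocking.decrease (hB : I.PreBlocking F v) (hv : v ≠ I.r) (ht : t ∈ I.leaves v)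
    (hvt : v ∈ I.residualReach F t) {δ : ℕ} (hδ : δ ≤ F v)
    (hG : ∀ q, I.IsAncestor v q → I.IsAncestor q t → G q = F q - δ)
    (hG' : ∀ q, I.IsAncestor v q → ¬ I.IsAncestor q t → G q = F q) :
    I.PreBlocking G v ∧ v ∈ I.residualReach G t := by
  induction v using subtree_induction (I := I) with
  | h v ih =>
    have hvv := I.isAncestor_refl v
    have hGv := hG v hvv (mem_leaves.1 ht).2
    have hc := (hB.flow v hvv).1
    by_cases hT : v ∈ I.T
    · rw [leaves_leaf hv hT, Finset.mem_singleton] at ht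
      subst ht
      exact ⟨preBlocking_leaf hv hT (flowOn_leaf hv hT (by omega)), mem_residualReach_self⟩
    · have key : ∀ {w₁ w₂}, I.IsNode v w₁ w₂ → t ∈ I.leaves w₁ →
          I.PreBlocking G v ∧ v ∈ I.residualReach G t := by
        intro w₁ w₂ hn ht₁
        have hP := hB.passes hn ht₁ hvt
        have h1 := hP.eq
        have h2 := hP.lt
        have hn₂ : ∀ q, I.IsAncestor w₂ q → ¬ I.IsAncestor q t := fun q hq hqt =>
          hn.disjoint (mem_leaves.1 ht₁).2 (hq.trans hqt)
        have hG₁ := hG w₁ hn.left.2 (mem_leaves.1 ht₁).2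
        have hG₂ := hG' w₂ hn.right.2 (hn₂ w₂ (I.isAncestor_refl w₂))
        obtain ⟨h3, h4⟩ := ih w₁ hn.left hP.pre hn.left.ne_root ht₁ hP.mem (by omega)
          (fun q hq => hG q (hn.left.2.trans hq)) (fun q hq => hG' q (hn.left.2.trans hq))
        refine hn.preBlocking_of_reach ht₁ h3 h4 (by omega)
          (hP.down.congr hn.right fun q hq => (hG' q (hn.right.2.trans hq) (hn₂ q hq)).symm)
          (by omega) (by omega)
      obtain ⟨w₁, w₂, hn⟩ := I.exists_isNode hT
      rcases hn.mem_leaves_iff.1 ht with h | h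
      · exact key hn h
      · exact key hn.symm h

/-- A blocking flow with the least value is at least that value along the dominating path, and
decreasing it there makes the end of the path reach `v`. -/
theorem Blocking.decrease_of_eq_lo (hB : I.Blocking F v) (huv : I.IsParent u v)
    (hR : I.RegularBelow v) (hA : I.CondA u v) (hlo : F v = I.lo u v) (ht : t ∈ I.leaves v)
    (hP : I.IsDominatingPath v t) :
    (∀ q, I.IsAncestor v q → I.IsAncestor q t → I.lo u v ≤ F q) ∧
    ∀ (δ : ℕ) (G : V → ℕ), 1 ≤ δ → δ ≤ I.lo u v →
      (∀ q, I.IsAncestor v q → I.IsAncestor q t → G q = F q - δ) →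
      (∀ q, I.IsAncestor v q → ¬ I.IsAncestor q t → G q = F q) →
      I.PreBlocking G v ∧ v ∈ I.residualReach G t := by
  induction v using subtree_induction (I := I) generalizing u with
  | h v ih =>
    have hvv := I.isAncestor_refl v
    have hv := huv.ne_root
    have hc := (hB.flow v hvv).1
    by_cases hT : v ∈ I.T
    · rw [leaves_leaf hv hT, Finset.mem_singleton] at ht
      subst ht
      refine ⟨fun q hq _ => ?_, fun δ G _ _ hG _ => ?_⟩
      · rw [isAncestor_leaf_iff hv hT] at hq
        rw [hq, hlo]
      · have := hG t hvv hvv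
        exact ⟨preBlocking_leaf hv hT (flowOn_leaf hv hT (by omega)), mem_residualReach_self⟩
    · obtain ⟨w₁, w₂, hn, ht₁⟩ : ∃ w₁ w₂, I.IsNode v w₁ w₂ ∧ t ∈ I.leaves w₁ := by
        obtain ⟨w₁, w₂, hn⟩ := I.exists_isNode hT
        rcases hn.mem_leaves_iff.1 ht with h | h
        · exact ⟨w₁, w₂, hn, h⟩
        · exact ⟨w₂, w₁, hn.symm, h⟩
      rcases hB.cases hn with ⟨h₁, h₂⟩ | ⟨t', ht', hvt', htop⟩
      · obtain ⟨hd, hP₁⟩ := (hn.left.isDominatingPath_iff (mem_leaves.1 ht₁).2).1 hP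
        have hA₁ := hR.condA hn.left
        have hA₂ := hR.condA hn.right
        have b₁ := hA₁.bounds hn.left h₁
        have b₂ := hA₂.bounds hn.right h₂
        have hl := (updateLower_le (a := I.tildeA v w₁ w₂) (c := I.cap v)).1
        rw [← (hA.node huv hn).2.1, hn.tildeA_of_dominating hd] at hl
        have hd' := hn.isDominating_iff.1 hd
        obtain ⟨y, -, hy', hy⟩ := (hB.flow v hvv).2 w₁ w₂ hn
        -- Squeeze: `F v ≥ F w₁ - F w₂ ≥ lo v w₁ - hi v w₂ ≥ lo u v = F v`, so both children take
        -- extreme values.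
        have e₁ : F w₁ = I.lo v w₁ := by omega
        have e₂ : F w₂ = I.hi v w₂ := by omega
        obtain ⟨i₁, i₂⟩ := ih w₁ hn.left h₁ hn.left (hR.child hn.left) hA₁ e₁ ht₁ hP₁
        constructor
        · intro q hq hqt
          rcases hn.isAncestor_iff.1 hq with rfl | hq | hq
          · exact hlo.ge
          · have := i₁ q hq hqt
            omega
          · exact (hn.disjoint (mem_leaves.1 ht₁).2 (hq.trans hqt)).elim
        · intro δ G hδ hδ' hG hG'
          have hn₂ : ∀ q, I.IsAncestor w₂ q → ¬ I.IsAncestor q t := fun q hq hqt =>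
            hn.disjoint (mem_leaves.1 ht₁).2 (hq.trans hqt)
          have g₁ := hG w₁ hn.left.2 (mem_leaves.1 ht₁).2
          have g₂ := hG' w₂ hn.right.2 (hn₂ w₂ (I.isAncestor_refl w₂))
          have gv := hG v hvv (mem_leaves.1 ht).2
          have c₁ := (h₁.flow w₁ (I.isAncestor_refl w₁)).1
          obtain ⟨h3, h4⟩ := i₂ δ G hδ (by omega)
            (fun q hq => hG q (hn.left.2.trans hq)) (fun q hq => hG' q (hn.left.2.trans hq))
          -- The sibling at its maximum is down-blocking, and lowering by `δ ≥ 1` makes room above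
          -- `w₁`; so `t` passes on to `v`.
          have hD := h₂.downBlocking_of_eq_hi hn.right (hR.child hn.right) hA₂ e₂
          exact hn.preBlocking_of_reach ht₁ h3 h4 (by omega)
            (hD.congr hn.right fun q hq => (hG' q (hn.right.2.trans hq) (hn₂ q hq)).symm)
            (by omega) (by omega)
      · have h1 := huv.one_le_cap
        have h2 := (hB.dominating_of_reach hR hv ht' hvt' (by omega)).1
        have := hR.dominatingPath_unique hv ht ht' hP h2
        subst this
        refine ⟨fun q hq hqt => ?_, fun δ G _ hδ hG hG' => ?_⟩
        · rw [← hlo]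
          exact hB.le_of_reach hv ht hvt' hq hqt
        · exact hB.decrease hv ht hvt' (by omega) hG hG'

/-- Whatever `t` sends to another leaf below `v` leaves the path from `v` to `t` over one of the
edges hanging off it. -/
theorem IsDecomposition.le_add_sideSum {f g : Sym2 V → ℕ} (h : I.IsParent u v)
    (hg : I.IsDecomposition u v f g) (ht : t ∈ I.leaves v) :
    f (I.up t) ≤ g s(u, t) + I.sideSum (fun q => f (I.up q)) v t := by
  classical
  rw [h.isDecomposition_iff] at hg
  have hvt := (mem_leaves.1 ht).2
  have key : ∀ w, I.IsAncestor v w → t ∈ I.leaves w →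
      ∑ y ∈ (I.leaves w).erase t, g s(t, y) ≤ I.sideSum (fun q => f (I.up q)) w t := by
    intro w hw htw
    have hr := h.ne_root_of_isAncestor hw
    induction w using subtree_induction (I := I) with
    | h w ih =>
      by_cases hT : w ∈ I.T
      · rw [leaves_leaf hr hT, Finset.mem_singleton] at htw
        subst htw
        simp [leaves_leaf hr hT]
      · have aux : ∀ {w₁ w₂}, I.IsNode w w₁ w₂ → t ∈ I.leaves w₁ →
            ∑ y ∈ (I.leaves w).erase t, g s(t, y) ≤
              I.sideSum (fun q => f (I.up q)) w t := by
          intro w₁ w₂ hn ht₁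
          have hw₂ := hw.trans hn.right.2
          have ht₂ : t ∉ I.leaves w₂ := fun ht₂ =>
            hn.disjoint (mem_leaves.1 ht₁).2 (mem_leaves.1 ht₂).2
          have h1 := ih w₁ hn.left (hw.trans hn.left.2) ht₁ hn.left.ne_root
          have h2 : ∑ y ∈ I.leaves w₂, g s(t, y) ≤ f (I.up w₂) := by
            rw [hg w₂ hw₂]
            refine Finset.sum_le_sum fun y _ => ?_
            rw [Sym2.eq_swap]
            exact Finset.single_le_sum (f := fun z => g s(y, z)) (fun _ _ => Nat.zero_le _)
              (Finset.mem_sdiff.2 ⟨Finset.mem_insert_of_mem ht, ht₂⟩)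
          have h3 := hn.sum_leaves fun y => g s(t, y)
          rw [← Finset.add_sum_erase _ _ htw, ← Finset.add_sum_erase _ _ ht₁] at h3
          rw [hn.sideSum_eq (mem_leaves.1 ht₁).2]
          omega
        obtain ⟨w₁, w₂, hn⟩ := I.exists_isNode hT
        rcases hn.mem_leaves_iff.1 htw with h | h
        · exact aux hn h
        · exact aux hn.symm h
  have hu := h.notMem_leaves (I.isAncestor_refl v)
  have hut : u ∉ ({t} : Finset V) := by
    rw [Finset.mem_singleton]
    rintro rfl
    exact hu ht
  have h1 := key v (I.isAncestor_refl v) ht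
  rw [hg t hvt, leaves_leaf (h.ne_root_of_isAncestor hvt) (mem_leaves.1 ht).1, Finset.sum_singleton,
    Finset.insert_sdiff_of_notMem _ hut, Finset.sdiff_singleton_eq_erase,
    Finset.sum_insert fun h' => hu (Finset.mem_of_mem_erase h'), Sym2.eq_swap]
  omega

end TreeInstance

/-! ### Gluing on edge functions, and conditions (a) and (b) at the edge above `v`. -/

namespace TreeInstance

variable {V : Type*} {I : TreeInstance V} {F : V → ℕ} {u v w w₁ w₂ s t x q : V}
  {f f₁ f₂ g : Sym2 V → ℕ}

theorem IsParent.combine_up_self (huv : I.IsParent u v) {x : ℕ} :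
    I.combine u v w₁ x f₁ f₂ (I.up v) = x := by
  rw [combine, if_pos huv.up_eq]

theorem IsParent.combine_up_left (huv : I.IsParent u v) (hn : I.IsNode v w₁ w₂) {x : ℕ}
    (hq : I.IsAncestor w₁ q) : I.combine u v w₁ x f₁ f₂ (I.up q) = f₁ (I.up q) := by
  have hne : I.up q ≠ s(u, v) := by
    rw [← huv.up_eq]
    intro h
    have := up_injective (hn.left.ne_root_of_isAncestor hq) huv.ne_root h
    subst this
    exact hn.left.not_isAncestor hq
  rw [combine, if_neg hne, if_pos (hn.left.mem_subE.2 ⟨q, hq, rfl⟩)]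

theorem IsParent.combine_up_right (huv : I.IsParent u v) (hn : I.IsNode v w₁ w₂) {x : ℕ}
    (hq : I.IsAncestor w₂ q) : I.combine u v w₁ x f₁ f₂ (I.up q) = f₂ (I.up q) := by
  have hqr := hn.right.ne_root_of_isAncestor hq
  have hne : I.up q ≠ s(u, v) := by
    rw [← huv.up_eq]
    intro h
    have := up_injective hqr huv.ne_root h
    subst this
    exact hn.right.not_isAncestor hq
  have hns : I.up q ∉ I.subE v w₁ := by
    intro h
    obtain ⟨q', hq', he⟩ := hn.left.mem_subE.1 h
    have := up_injective hqr (hn.left.ne_root_of_isAncestor hq') he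
    subst this
    exact hn.disjoint hq' hq
  rw [combine, if_neg hne, if_neg hns]

theorem IsParent.up_mem_pathEdges (h : I.IsParent v w) (hq : I.IsAncestor w q) :
    I.up q ∈ I.pathEdges v t ↔ I.IsAncestor q t := by
  rw [up_mem_pathEdges_iff (h.ne_root_of_isAncestor hq)]
  have : ¬ I.IsAncestor q v := fun h' => h.not_isAncestor (hq.trans h')
  tauto

variable [Finite V]

theorem RegularBelow.otimes_eq (hR : I.RegularBelow v) (hn : I.IsNode v w₁ w₂) :
    (∃ k : ℕ, I.tildeB v w₁ w₂ = I.tildeA v w₁ w₂ + 2 * k) ∧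
      otimes (I.Psi v w₁) (I.Psi v w₂) =
        parityInterval (I.tildeA v w₁ w₂) (I.tildeB v w₁ w₂) := by
  have h₁ := hR.condA hn.left
  have h₂ := hR.condA hn.right
  obtain ⟨k₁, hk₁⟩ := h₁.1
  obtain ⟨k₂, hk₂⟩ := h₂.1
  refine ⟨exists_tildeLower_add hk₁ hk₂, ?_⟩
  rw [h₁.2.1, h₂.2.1]
  exact otimes_parityInterval hk₁ hk₂

/-- The top edge is full, as `t` would otherwise reach `u`; having positive capacity, it carries
flow, and `dominating_of_reach` applies. -/
theorem Blocking.top_of_reach (hB : I.Blocking F v) (hR : I.RegularBelow v)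
    (huv : I.IsParent u v) (hn : I.IsNode v w₁ w₂) (ht : t ∈ I.leaves v)
    (hvt : v ∈ I.residualReach F t) :
    I.IsDominatingPath v t ∧ I.cap v < I.tildeA v w₁ w₂ := by
  have h1 := huv.one_le_cap
  have h2 := hB.top t ht hvt
  obtain ⟨h3, -, h5⟩ := hB.dominating_of_reach hR huv.ne_root ht hvt (by omega)
  exact ⟨h3, h2 ▸ h5 w₁ w₂ hn⟩

theorem Blocking.mem_otimes (hB : I.Blocking F v) (hn : I.IsNode v w₁ w₂)
    (h₁ : I.Blocking F w₁) (h₂ : I.Blocking F w₂) :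
    F v ∈ otimes (I.Psi v w₁) (I.Psi v w₂) := by
  obtain ⟨y, hy₁, hy₂, hy⟩ := (hB.flow v (I.isAncestor_refl v)).2 w₁ w₂ hn
  exact ⟨F w₁, hn.left.mem_Psi.2 ⟨F, h₁, rfl⟩, F w₂, hn.right.mem_Psi.2 ⟨F, h₂, rfl⟩, y,
    le_min hy₁ hy₂, hy⟩

/-- Either no terminal reaches `v` and the value is at least `ã`, or one does and the capacity is
less than `ã`. -/
theorem Blocking.mem_or_eq (hB : I.Blocking F v) (hR : I.RegularBelow v)
    (huv : I.IsParent u v) (hn : I.IsNode v w₁ w₂) :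
    F v ∈ parityInterval (I.tildeA v w₁ w₂) (I.tildeB v w₁ w₂) ∨
      F v = I.cap v ∧ I.cap v < I.tildeA v w₁ w₂ := by
  rcases hB.cases hn with ⟨h₁, h₂⟩ | ⟨t, ht, hvt, htop⟩
  · left
    rw [← (hR.otimes_eq hn).2]
    exact hB.mem_otimes hn h₁ h₂
  · exact Or.inr ⟨htop, (hB.top_of_reach hR huv hn ht hvt).2⟩

theorem IsNode.isBlocking_combine (hn : I.IsNode v w₁ w₂) (huv : I.IsParent u v) {x y : ℕ}
    (hf₁ : I.IsBlocking v w₁ f₁) (hf₂ : I.IsBlocking v w₂ f₂) (hy₁ : y ≤ f₁ s(v, w₁))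
    (hy₂ : y ≤ f₂ s(v, w₂)) (hx : x + 2 * y = f₁ s(v, w₁) + f₂ s(v, w₂))
    (hc : x ≤ I.c s(u, v)) : I.IsBlocking u v (I.combine u v w₁ x f₁ f₂) := by
  rw [hn.left.isBlocking_iff] at hf₁
  rw [hn.right.isBlocking_iff] at hf₂
  rw [huv.isBlocking_iff]
  rw [← hn.left.up_eq] at hy₁ hx
  rw [← hn.right.up_eq] at hy₂ hx
  have h₁ := hf₁.congr (G := fun q => I.combine u v w₁ x f₁ f₂ (I.up q)) hn.left
    fun q hq => (huv.combine_up_left hn hq).symm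
  have h₂ := hf₂.congr (G := fun q => I.combine u v w₁ x f₁ f₂ (I.up q)) hn.right
    fun q hq => (huv.combine_up_right hn hq).symm
  refine (FlowOn.blocking_of_blocking (hn.flowOn ?_ ⟨y, ?_⟩ h₁.flow h₂.flow) hn h₁ h₂).1
  · rwa [huv.combine_up_self, cap, huv.up_eq]
  · rw [huv.combine_up_self, huv.combine_up_left hn (I.isAncestor_refl w₁),
      huv.combine_up_right hn (I.isAncestor_refl w₂)]
    exact ⟨hy₁, hy₂, hx⟩

/-- Lowering by `ã - c` puts the value above `w₁` at `c + hi v w₂`, exactly what is needed for `t`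
to pass through `v` and be stopped by the full edge above it. -/
theorem IsNode.isBlocking_combine_decrease (hn : I.IsNode v w₁ w₂) (huv : I.IsParent u v)
    (hR : I.RegularBelow v) (hc : I.c s(u, v) < I.tildeA v w₁ w₂) (hd : I.IsDominating v w₁)
    (ht : t ∈ I.leaves w₁) (hP : I.IsDominatingPath v t)
    (hf₁ : I.IsBlocking v w₁ f₁) (hv₁ : f₁ s(v, w₁) = I.lo v w₁)
    (hf₂ : I.IsBlocking v w₂ f₂) (hv₂ : f₂ s(v, w₂) = I.hi v w₂) :
    (∀ d ∈ I.pathEdges v t, I.tildeA v w₁ w₂ - I.c s(u, v) ≤ f₁ d) ∧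
      I.IsBlocking u v (I.combine u v w₁ (I.c s(u, v))
        (I.decreasePath f₁ v t (I.tildeA v w₁ w₂ - I.c s(u, v))) f₂) := by
  rw [hn.left.isBlocking_iff] at hf₁
  rw [hn.right.isBlocking_iff] at hf₂
  rw [← hn.left.up_eq] at hv₁
  rw [← hn.right.up_eq] at hv₂
  have hwt := (mem_leaves.1 ht).2
  have hP₁ := ((hn.left.isDominatingPath_iff hwt).1 hP).2
  have htl := hn.tildeA_of_dominating hd
  have hd' := hn.isDominating_iff.1 hd
  obtain ⟨h1, h2⟩ := hf₁.decrease_of_eq_lo hn.left (hR.child hn.left) (hR.condA hn.left) hv₁ ht hP₁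
  set δ := I.tildeA v w₁ w₂ - I.c s(u, v) with hδ
  constructor
  · intro d hd
    obtain ⟨q, rfl, hq⟩ := mem_pathEdges_iff.1 hd
    have hvt := hn.left.2.trans hwt
    have hqt : I.IsAncestor q t ∧ ¬ I.IsAncestor q v := by
      have : I.IsAncestor q v → I.IsAncestor q t := fun h => h.trans hvt
      tauto
    have hwq : I.IsAncestor w₁ q := by
      rcases hwt.total hqt.1 with h | h
      · exact h
      · rcases hn.left.isAncestor_iff.1 h with rfl | h
        · exact I.isAncestor_refl _
        · exact absurd h hqt.2
    have := h1 q hwq hqt.1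
    omega
  · rw [huv.isBlocking_iff]
    set G : V → ℕ := fun q => I.combine u v w₁ (I.c s(u, v)) (I.decreasePath f₁ v t δ) f₂ (I.up q)
      with hG
    have hG₁ : ∀ q, I.IsAncestor w₁ q → I.IsAncestor q t → G q = f₁ (I.up q) - δ := by
      intro q hq hqt
      rw [hG]
      dsimp only
      rw [huv.combine_up_left hn hq, decreasePath, if_pos ((hn.left.up_mem_pathEdges hq).2 hqt)]
    have hG₁' : ∀ q, I.IsAncestor w₁ q → ¬ I.IsAncestor q t → G q = f₁ (I.up q) := by
      intro q hq hqt
      rw [hG]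
      dsimp only
      rw [huv.combine_up_left hn hq, decreasePath,
        if_neg fun h => hqt ((hn.left.up_mem_pathEdges hq).1 h)]
    have hG₂ : ∀ q, I.IsAncestor w₂ q → f₂ (I.up q) = G q := fun q hq =>
      (huv.combine_up_right hn hq).symm
    have hGv : G v = I.cap v := by
      rw [cap, huv.up_eq]
      exact huv.combine_up_self
    have hcap : I.cap v = I.c s(u, v) := by rw [cap, huv.up_eq]
    have g₁ := hG₁ w₁ (I.isAncestor_refl w₁) hwt
    have g₂ := hG₂ w₂ (I.isAncestor_refl w₂)
    have hle := (hf₁.flow w₁ (I.isAncestor_refl w₁)).1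
    obtain ⟨h3, h4⟩ := h2 δ G (by omega) (by omega) hG₁ hG₁'
    have hD := hf₂.downBlocking_of_eq_hi hn.right (hR.child hn.right) (hR.condA hn.right) hv₂
    have h5 := (hn.preBlocking_of_reach ht h3 h4 (by omega) (hD.congr hn.right hG₂) (by omega)
      hGv.le).1
    exact ⟨h5, fun _ _ _ => hGv⟩

theorem IsNode.exists_dominatingPath (hn : I.IsNode v w₁ w₂) (hR : I.RegularBelow v)
    (hd : I.IsDominating v w₁) : ∃ t ∈ I.leaves w₁, I.IsDominatingPath v t := by
  have := hn.isDominating_iff.1 hd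
  obtain ⟨t, ht, hP⟩ := (hR.child hn.left).exists_dominatingPath hn.left (hR.condA hn.left)
    (by omega)
  exact ⟨t, ht, (hn.left.isDominatingPath_iff (mem_leaves.1 ht).2).2 ⟨hd, hP⟩⟩

/-- The lower bound on `F t` and the upper bound on what `t` can send elsewhere contain the same
side sum; their difference must go to `u`. -/
theorem IsParent.min_le_decomposition (huv : I.IsParent u v) (hR : I.RegularBelow v)
    (hn : I.IsNode v w₁ w₂) (ht : t ∈ I.leaves v) (hP : I.IsDominatingPath v t)
    (hf : I.IsBlocking u v f) (hg : I.IsDecomposition u v f g) :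
    min (I.tildeA v w₁ w₂) (I.c s(u, v)) ≤ g s(u, t) := by
  rw [huv.isBlocking_iff] at hf
  have h1 := hf.min_add_sideSum_le hR huv ht hP hn
  have h2 := hg.le_add_sideSum huv ht
  rw [cap, huv.up_eq] at h1
  omega

theorem CondA.lo_mem (h : I.CondA u v) : I.lo u v ∈ I.Psi u v := by
  obtain ⟨k, hk⟩ := h.1
  rw [h.2.1, mem_parityInterval]
  omega

theorem CondA.hi_mem (h : I.CondA u v) : I.hi u v ∈ I.Psi u v := by
  obtain ⟨k, hk⟩ := h.1
  rw [h.2.1, mem_parityInterval]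
  omega

theorem IsNode.cap_mem_Psi (hn : I.IsNode v w₁ w₂) (huv : I.IsParent u v)
    (hR : I.RegularBelow v) (hc : I.c s(u, v) < I.tildeA v w₁ w₂) (hd : I.IsDominating v w₁) :
    I.c s(u, v) ∈ I.Psi u v := by
  obtain ⟨t, ht, hP⟩ := hn.exists_dominatingPath hR hd
  obtain ⟨f₁, hf₁, hv₁⟩ := (hR.condA hn.left).lo_mem
  obtain ⟨f₂, hf₂, hv₂⟩ := (hR.condA hn.right).hi_mem
  exact ⟨_, (hn.isBlocking_combine_decrease huv hR hc hd ht hP hf₁ hv₁ hf₂ hv₂).2,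
    by rw [combine, if_pos rfl]⟩

theorem IsNode.Psi_eq_inter (hn : I.IsNode v w₁ w₂) (huv : I.IsParent u v)
    (hR : I.RegularBelow v) (hc : I.tildeA v w₁ w₂ ≤ I.c s(u, v)) :
    I.Psi u v = otimes (I.Psi v w₁) (I.Psi v w₂) ∩ Set.Icc 0 (I.c s(u, v)) := by
  ext x
  constructor
  · intro hx
    obtain ⟨F, hF, rfl⟩ := huv.mem_Psi.1 hx
    have hle := (hF.flow v (I.isAncestor_refl v)).1
    rw [cap, huv.up_eq] at hle
    refine ⟨?_, Nat.zero_le _, hle⟩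
    rw [(hR.otimes_eq hn).2]
    rcases hF.mem_or_eq hR huv hn with h | ⟨-, h⟩
    · exact h
    · rw [cap, huv.up_eq] at h
      omega
  · rintro ⟨⟨_, ⟨f₁, hf₁, rfl⟩, _, ⟨f₂, hf₂, rfl⟩, y, hy, hx⟩, -, hxc⟩
    rw [le_min_iff] at hy
    exact ⟨_, hn.isBlocking_combine huv hf₁ hf₂ hy.1 hy.2 hx hxc, by rw [combine, if_pos rfl]⟩

theorem IsNode.Psi_eq_singleton (hn : I.IsNode v w₁ w₂) (huv : I.IsParent u v)
    (hR : I.RegularBelow v) (hc : I.c s(u, v) < I.tildeA v w₁ w₂) :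
    I.Psi u v = {I.c s(u, v)} := by
  apply Set.eq_singleton_iff_unique_mem.2
  constructor
  -- Since `c ≥ 1`, the inequality `c < ã` gives `ã ≥ 2`, which only a dominating child edge can
  -- produce.
  · have h1 : 1 ≤ I.c s(u, v) := I.one_le_c _ huv.1
    rcases hn.isDominating_of_two_le (by omega) with hd | hd
    · exact hn.cap_mem_Psi huv hR hc hd
    · rw [hR.tildeA_comm hn] at hc
      exact hn.symm.cap_mem_Psi huv hR hc hd
  · intro x hx
    obtain ⟨F, hF, rfl⟩ := huv.mem_Psi.1 hx
    have hle := (hF.flow v (I.isAncestor_refl v)).1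
    rw [cap, huv.up_eq] at hle
    -- A split flow would have value at least `ã`, above the capacity.
    rcases hF.mem_or_eq hR huv hn with h | ⟨h, -⟩
    · have := (mem_parityInterval.1 h).1
      omega
    · rwa [cap, huv.up_eq] at h

theorem IsNode.Psi_eq_parityInterval (hn : I.IsNode v w₁ w₂) (huv : I.IsParent u v)
    (hR : I.RegularBelow v) :
    (∃ k, updateUpper (I.tildeA v w₁ w₂) (I.tildeB v w₁ w₂) (I.c s(u, v)) =
      updateLower (I.tildeA v w₁ w₂) (I.c s(u, v)) + 2 * k) ∧
    I.Psi u v = parityInterval (updateLower (I.tildeA v w₁ w₂) (I.c s(u, v)))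
      (updateUpper (I.tildeA v w₁ w₂) (I.tildeB v w₁ w₂) (I.c s(u, v))) := by
  obtain ⟨⟨k, hk⟩, hot⟩ := hR.otimes_eq hn
  constructor
  · refine ⟨(updateUpper (I.tildeA v w₁ w₂) (I.tildeB v w₁ w₂) (I.c s(u, v)) -
      updateLower (I.tildeA v w₁ w₂) (I.c s(u, v))) / 2, ?_⟩
    unfold updateUpper updateLower
    simp only [Nat.even_iff]
    split_ifs <;> omega
  · by_cases hc : I.c s(u, v) < I.tildeA v w₁ w₂
    · rw [hn.Psi_eq_singleton huv hR hc]
      ext x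
      rw [mem_parityInterval, updateLower, updateUpper, if_pos hc, if_pos hc,
        Set.mem_singleton_iff]
      omega
    · rw [hn.Psi_eq_inter huv hR (by omega), hot]
      ext x
      rw [Set.mem_inter_iff, mem_parityInterval, mem_parityInterval, updateLower, updateUpper,
        if_neg hc, if_neg hc, Set.mem_Icc]
      simp only [Nat.even_iff]
      split_ifs <;> omega

theorem IsNode.lo_hi_eq (hn : I.IsNode v w₁ w₂) (huv : I.IsParent u v)
    (hR : I.RegularBelow v) :
    I.lo u v = updateLower (I.tildeA v w₁ w₂) (I.c s(u, v)) ∧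
      I.hi u v = updateUpper (I.tildeA v w₁ w₂) (I.tildeB v w₁ w₂) (I.c s(u, v)) := by
  obtain ⟨⟨k, hk⟩, hΨ⟩ := hn.Psi_eq_parityInterval huv hR
  rw [lo, hi, hΨ]
  exact ⟨sInf_parityInterval hk, sSup_parityInterval hk⟩

theorem IsNode.condA (hn : I.IsNode v w₁ w₂) (huv : I.IsParent u v) (hR : I.RegularBelow v) :
    I.CondA u v := by
  obtain ⟨hk, hΨ⟩ := hn.Psi_eq_parityInterval huv hR
  obtain ⟨hlo, hhi⟩ := hn.lo_hi_eq huv hR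
  rw [← hlo, ← hhi] at hk hΨ
  refine ⟨hk, hΨ, fun hT => absurd hT hn.not_mem_T, fun _ z₁ z₂ hz₁ hz₂ hz => ?_⟩
  have hn' : I.IsNode v z₁ z₂ := ⟨hz₁, hz₂, hz, hn.ne_root⟩
  exact ⟨(hR.otimes_eq hn').1, (hR.otimes_eq hn').2, hn'.Psi_eq_inter huv hR,
    hn'.Psi_eq_singleton huv hR, hn'.lo_hi_eq huv hR⟩

theorem IsNode.exists_terminal (hn : I.IsNode v w₁ w₂) (huv : I.IsParent u v)
    (hR : I.RegularBelow v) (hd : I.IsDominating v w₁) : ∃ t ∈ I.subT v w₁,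
      (∀ f g, I.IsBlocking u v f → I.IsDecomposition u v f g →
        min (I.tildeA v w₁ w₂) (I.c s(u, v)) ≤ g s(u, t)) ∧ I.IsDominatingPath v t := by
  obtain ⟨t, ht, hP⟩ := hn.exists_dominatingPath hR hd
  exact ⟨t, hn.left.mem_subT_iff_mem_leaves.2 ht, fun f g hf hg =>
    huv.min_le_decomposition hR hn (hn.mem_leaves_iff.2 (Or.inl ht)) hP hf hg, hP⟩

theorem IsNode.condB (hn : I.IsNode v w₁ w₂) (huv : I.IsParent u v) (hR : I.RegularBelow v) :
    I.CondB u v := by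
  have key : ∀ {w w'}, I.IsNode v w w' → I.IsDominating v w → ∃ t ∈ I.subT v w,
      (∀ f g, I.IsBlocking u v f → I.IsDecomposition u v f g → I.lo u v ≤ g s(u, t)) ∧
      I.IsDominatingPath v t := by
    intro w w' hn hd
    obtain ⟨t, ht, h1, h2⟩ := hn.exists_terminal huv hR hd
    refine ⟨t, ht, fun f g hf hg => ?_, h2⟩
    have h3 := h1 f g hf hg
    have h4 := updateLower_le (a := I.tildeA v w w') (c := I.c s(u, v))
    rw [(hn.lo_hi_eq huv hR).1]
    omega
  intro w hd
  rcases hn.eq_or_eq hd.1 with rfl | rfl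
  · exact key hn hd
  · exact key hn.symm hd

end TreeInstance

/-! ### Assembly of the lemma. -/

theorem mainTheorem2 {V : Type*} [Finite V] (I : TreeInstance V)
    (u v : V) (huv : I.IsParent u v) (hv : v ∉ I.T)
    (hdeep : ∀ x y, I.IsParent x y → I.depth v + 1 ≤ I.depth y → I.CondA x y ∧ I.CondB x y)
    (w₁ w₂ : V) (hw₁ : I.IsParent v w₁) (hw₂ : I.IsParent v w₂) (hw : w₁ ≠ w₂) :
    -- the interval with ends `ã`, `b̃`
    ((∃ k : ℕ, I.tildeB v w₁ w₂ = I.tildeA v w₁ w₂ + 2 * k) ∧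
      otimes (I.Psi v w₁) (I.Psi v w₂) =
        parityInterval (I.tildeA v w₁ w₂) (I.tildeB v w₁ w₂)) ∧
    -- (i)
    (∀ f, I.IsBlocking u v f → ∀ t ∈ I.subT u v, s(u, v) ∈ I.cut u v (I.reach u v f t) →
      I.IsDominatingPath v t ∧
      (∀ f' g, I.IsBlocking u v f' → I.IsDecomposition u v f' g → I.c s(u, v) ≤ g s(u, t)) ∧
      I.c s(u, v) < I.tildeA v w₁ w₂) ∧
    -- (ii)
    ((I.c s(u, v) < I.tildeA v w₁ w₂ → I.IsDominating v w₁ ∨ I.IsDominating v w₂) ∧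
      I.CondB u v ∧
      (I.IsDominating v w₁ → ∃ t ∈ I.subT v w₁,
        (∀ f g, I.IsBlocking u v f → I.IsDecomposition u v f g →
          min (I.tildeA v w₁ w₂) (I.c s(u, v)) ≤ g s(u, t)) ∧
        I.IsDominatingPath v t)) ∧
    -- (iii)
    (∀ x₁ ∈ I.Psi v w₁, ∀ x₂ ∈ I.Psi v w₂, ∀ x y : ℕ, y ≤ min x₁ x₂ → x + 2 * y = x₁ + x₂ →
      I.tildeA v w₁ w₂ ≤ x ∧
      (I.tildeA v w₁ w₂ ≤ I.c s(u, v) → x ≤ I.c s(u, v) →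
        ∀ f₁ f₂, I.IsBlocking v w₁ f₁ → f₁ s(v, w₁) = x₁ →
          I.IsBlocking v w₂ f₂ → f₂ s(v, w₂) = x₂ →
          I.IsBlocking u v (I.combine u v w₁ x f₁ f₂))) ∧
    -- (iv)
    (∀ f, I.IsBlocking u v f → f s(u, v) < I.c s(u, v) →
      f s(u, v) ∈ parityInterval (I.tildeA v w₁ w₂) (I.tildeB v w₁ w₂)) ∧
    -- (v)
    (I.c s(u, v) < I.tildeA v w₁ w₂ → I.IsDominating v w₁ →
      ∀ t ∈ I.subT v w₁, I.IsDominatingPath v t →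
        (∃ f₁, I.IsBlocking v w₁ f₁ ∧ f₁ s(v, w₁) = I.lo v w₁) ∧
        (∃ f₂, I.IsBlocking v w₂ f₂ ∧ f₂ s(v, w₂) = I.hi v w₂) ∧
        (∀ f₁ f₂, I.IsBlocking v w₁ f₁ → f₁ s(v, w₁) = I.lo v w₁ →
          I.IsBlocking v w₂ f₂ → f₂ s(v, w₂) = I.hi v w₂ →
          (∀ d ∈ I.pathEdges v t, I.tildeA v w₁ w₂ - I.c s(u, v) ≤ f₁ d) ∧
          I.IsBlocking u v (I.combine u v w₁ (I.c s(u, v))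
            (I.decreasePath f₁ v t (I.tildeA v w₁ w₂ - I.c s(u, v))) f₂))) ∧
    -- (vi)
    I.CondA u v := by
  have hn : I.IsNode v w₁ w₂ := ⟨hw₁, hw₂, hw, huv.ne_root⟩
  have hR : I.RegularBelow v := by
    intro x y hxy hvx
    refine (hdeep x y hxy ?_).1
    have := hxy.depth_eq
    rcases hvx.depth_le with rfl | h <;> omega
  have hcap : I.cap v = I.c s(u, v) := by rw [TreeInstance.cap, huv.up_eq]
  refine ⟨hR.otimes_eq hn, ?_, ⟨?_, hn.condB huv hR, ?_⟩, ?_, ?_, ?_, hn.condA huv hR⟩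
  · intro f hf t ht hcut
    rw [huv.mem_subT_iff_mem_leaves] at ht
    have hB := huv.isBlocking_iff.1 hf
    -- The set of `t` never contains `u`, so the edge `e` is in its boundary only if `t` reaches
    -- `v`.
    have hu : u ∉ I.reach u v f t := by
      rw [TreeInstance.reach_eq]
      exact fun h => hB.notMem_parent huv ht h.2
    obtain ⟨q, hq, he, hX⟩ := huv.mem_cut.1 hcut
    rw [← huv.up_eq] at he
    have := TreeInstance.up_injective huv.ne_root (huv.ne_root_of_isAncestor hq) he
    subst this
    rw [huv.par_eq] at hX
    have hv' : v ∈ I.reach u v f t := by tauto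
    rw [TreeInstance.reach_eq] at hv'
    obtain ⟨h1, h2⟩ := hB.top_of_reach hR huv hn ht hv'.2
    rw [hcap] at h2
    refine ⟨h1, fun f' g hf' hg => ?_, h2⟩
    have := huv.min_le_decomposition hR hn ht h1 hf' hg
    omega
  · intro hc
    have h1 : 1 ≤ I.c s(u, v) := I.one_le_c _ huv.1
    exact hn.isDominating_of_two_le (by omega)
  · exact hn.exists_terminal huv hR
  · intro x₁ hx₁ x₂ hx₂ x y hy hx
    have hmem : x ∈ otimes (I.Psi v w₁) (I.Psi v w₂) := ⟨x₁, hx₁, x₂, hx₂, y, hy, hx⟩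
    rw [(hR.otimes_eq hn).2, mem_parityInterval] at hmem
    refine ⟨hmem.1, ?_⟩
    rintro - hxc f₁ f₂ hf₁ rfl hf₂ rfl
    rw [le_min_iff] at hy
    exact hn.isBlocking_combine huv hf₁ hf₂ hy.1 hy.2 hx hxc
  · intro f hf hlt
    have hB := huv.isBlocking_iff.1 hf
    rcases hB.mem_or_eq hR huv hn with h | ⟨h, -⟩
    · rwa [huv.up_eq] at h
    · rw [huv.up_eq, hcap] at h
      omega
  · intro hc hd t ht hP
    rw [hw₁.mem_subT_iff_mem_leaves] at ht
    exact ⟨(hR.condA hw₁).lo_mem, (hR.condA hw₂).hi_mem, fun f₁ f₂ hf₁ hv₁ hf₂ hv₂ =>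
      hn.isBlocking_combine_decrease huv hR hc hd ht hP hf₁ hv₁ hf₂ hv₂⟩
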